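/- **Proposition 3.3.** Work on $\mathbb R^{1+4}$, with $\Box=-\partial_t^2+\Delta$ and $|D|$ the Fourier multiplier with symbol $|\xi|$. Fix a smooth function $m_{\le 0}:\mathbb R\to\mathbb R$ with $m_{\le 0}(r)=1$ for $r\le 1$ and $m_{\le 0}(r)=0$ for $r\ge 2$, let $m_j(r)=m_{\le 0}(2^{-j}r)-m_{\le 0}(2^{-(j-1)}r)$, and let $P_j=m_j(|D|)$ ($j\in\mathbb Z$) be the associated spatial Littlewood–Paley projections. For a function $u$ on a time interval $J$ let $\|u\|_{L^pL^q[J]}$ be the norm that is $L^p$ in $t\in J$ and $L^q$ in $x\in\mathbb R^4$ ($J=\mathbb R$ if omitted), with the norm of a pair being the sum of the norms of its components. Set $$\|\phi(t)\|_{ED}=\sup_{j\in\mathbb Z}2^{-j}\|(P_j\phi,2^{-j}P_j\partial_t\phi)(t)\|_{L^\infty(\mathbb R^4)},\qquad \|\phi\|_{ED[I]}=\sup_{j\in\mathbb Z}2^{-j}\|(P_j\phi,2^{-j}P_j\partial_t\phi)\|_{L^\infty L^\infty[I]} .$$ Let $k\in\mathbb Z$, and let $I\subseteq\mathbb R$ be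 a closed interval (bounded or not) with $|I|\ge 2^{-k}$. Let $\phi_I\in C^1(I;L^2(\mathbb R^4;\mathbb C))$ be localized at frequency $2^k$: for some fixed $c\ge 1$, the spatial Fourier transform of $\phi_I(t)$ is supported in $\{c^{-1}2^k\le|\xi|\le c\,2^k\}$ for every $t\in I$. Let $\phi_I^{ext}$ be the extension of $\phi_I$ to $\mathbb R\times\mathbb R^4$ by homogeneous waves: it equals $\phi_I$ on $I$, and, for $t\notin I$ and $t_0$ the endpoint of $I$ nearest to $t$, $$\phi_I^{ext}(t)=\cos((t-t_0)|D|)\,\phi_I(t_0)+\frac{\sin((t-t_0)|D|)}{|D|}\,\partial_t\phi_I(t_0).$$ For $N\in\mathbb N$ put $\chi_I^k(t)=(1+2^k\,\mathrm{dist}(t,I))^{-N}$. There is $N_0$ such that for every $c\ge 1$ there is a constant $C$, depending only on $c$ and $m_{\le 0}$ (in particular not on $k$, $I$, $\phi_I$, $p$, $q$), such that for all $N\ge N_0$ and all $k$, $I$, $\phi_I$ as above, $\phi_I^{ext}\in C^1(\mathbb R;L^2(\mathbb R^4))$ and: 1. for every pair of admissible Strichartz exponents on $\mathbb R^{1+4}$,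 i.e. $2\le p,q\le\infty$ with $\frac1p+\frac{3/2}{q}\le\frac34$, if the distribution $\Box\phi_I$ on the interior of $I\times\mathbb R^4$ belongs to $L^2L^2[I]$, then $$\|\chi_I^k(\phi_I^{ext},2^{-k}\partial_t\phi_I^{ext})\|_{L^pL^q}\le C\Big(\|\phi_I\|_{L^pL^q[I]}+2^{(\frac12-\frac1p-\frac4q)k}\|\Box\phi_I\|_{L^2L^2[I]}\Big);$$ 2. for every $t\in\mathbb R$, $$\chi_I^k(t)\,\|\phi_I^{ext}(t)\|_{ED}\le C\,\|\phi_I\|_{ED[I]} .$$ -/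

import Mathlib

open MeasureTheory Set
open scoped ENNReal NNReal FourierTransform ContDiff

noncomputable section

namespace WaveExt

/-- The physical space `ℝ⁴` with its Euclidean structure. -/
abbrev Space : Type := EuclideanSpace ℝ (Fin 4)

/-- The complex Hilbert space `L²(ℝ⁴; ℂ)`. -/
abbrev L2 : Type := Lp ℂ 2 (volume : Measure Space)

/-- The Fourier multiplier on `L²(ℝ⁴)` with radial symbol `σ(|ξ|)`, where `ξ` is the angular
frequency (the symbol of `D = -i∂`). Mathlib's Fourier transform uses the kernel
`exp(-2πi⟨x, ζ⟩)`, so that `|ξ| = 2π‖ζ‖`. The value is `0` when `f` is not in the domain of the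
multiplier; all the symbols used below are bounded and continuous, so that this does not occur. -/
def radialMultiplier (σ : ℝ → ℝ) (f : L2) : L2 :=
  open scoped Classical in
  if h : MemLp (fun ζ : Space => ((σ (2 * Real.pi * ‖ζ‖) : ℝ) : ℂ) * (𝓕 f : L2) ζ) 2 volume then
    𝓕⁻ (h.toLp _ : L2)
  else 0

/-- `m` is a smooth cutoff (`m_{≤ 0}`) that equals `1` on `{r ≤ 1}` and vanishes on `{r ≥ 2}`. -/
structure IsCutoff (m : ℝ → ℝ) : Prop where
  smooth : ContDiff ℝ ∞ m
  eq_one : ∀ r, r ≤ 1 → m r = 1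
  eq_zero : ∀ r, 2 ≤ r → m r = 0

/-- The dyadic symbol `m_k(r) = m_{≤ 0}(r / 2^k) - m_{≤ 0}(r / 2^(k-1))`. -/
def dyadicSymbol (m : ℝ → ℝ) (k : ℤ) (r : ℝ) : ℝ :=
  m (r / (2 : ℝ) ^ k) - m (r / (2 : ℝ) ^ (k - 1))

/-- The Littlewood-Paley projection `P_k`. -/
def LP (m : ℝ → ℝ) (k : ℤ) (f : L2) : L2 :=
  radialMultiplier (dyadicSymbol m k) f

/-- The homogeneous wave with data `(f, g)` at time `0`:
`cos(t|D|) f + (sin(t|D|)/|D|) g`. Here `sin(tr)/r` is written as `t sinc(tr)`. -/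
def freeWave (t : ℝ) (f g : L2) : L2 :=
  radialMultiplier (fun r => Real.cos (t * r)) f +
    radialMultiplier (fun r => t * Real.sinc (t * r)) g

/-- The endpoint of the closed interval `I` which is closest to a time `t` outside `I`. -/
def nearEndpoint (I : Set ℝ) (t : ℝ) : ℝ :=
  open scoped Classical in
  if ∀ s ∈ I, s ≤ t then sSup I else sInf I

/-- The extension of `φ` from `I` by homogeneous waves: outside `I` it is the free wave whose
data `(φ, ∂ₜφ)` are those of `φ` at the nearest endpoint of `I`. -/
def waveExtension (I : Set ℝ) (φ : ℝ → L2) (t : ℝ) : L2 :=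
  open scoped Classical in
  if t ∈ I then φ t
  else freeWave (t - nearEndpoint I t) (φ (nearEndpoint I t))
    (derivWithin φ I (nearEndpoint I t))

/-- `f` has Fourier support in the annulus `{c⁻¹ 2^k ≤ |ξ| ≤ c 2^k}`. -/
def FreqLocalized (c : ℝ) (k : ℤ) (f : L2) : Prop :=
  ∀ᵐ ζ : Space ∂volume, (𝓕 f : L2) ζ ≠ 0 →
    2 * Real.pi * ‖ζ‖ ∈ Icc (c⁻¹ * (2 : ℝ) ^ k) (c * (2 : ℝ) ^ k)

/-- The mixed norm `‖u‖_{L^p L^q[J]}`, i.e. `L^p` in time over `J` and `L^q` in space. -/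
def mixedNorm (p q : ℝ≥0∞) (J : Set ℝ) (u : ℝ → L2) : ℝ≥0∞ :=
  eLpNorm (fun t => eLpNorm (u t : Space → ℂ) q volume) p (volume.restrict J)

/-- `(p, q)` is an admissible pair of Strichartz exponents on `ℝ^{1+4}`. -/
def Admissible (p q : ℝ≥0∞) : Prop :=
  2 ≤ p ∧ 2 ≤ q ∧ p⁻¹ + (3 / 2) * q⁻¹ ≤ 3 / 4

/-- The d'Alembertian `□η = -∂ₜ²η + Δη` of a smooth function on `ℝ × ℝ⁴`. -/
def box (η : ℝ × Space → ℂ) (t : ℝ) (x : Space) : ℂ :=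
  -iteratedDeriv 2 (fun s => η (s, x)) t + Laplacian.laplacian (fun y => η (t, y)) x

/-- `F ∈ L²(I; L²(ℝ⁴))` is the d'Alembertian `□φ` of `φ` in the sense of distributions on
the interior of `I × ℝ⁴`. -/
structure IsBox (I : Set ℝ) (φ F : ℝ → L2) : Prop where
  memLp : MemLp F 2 (volume.restrict I)
  weak : ∀ η : ℝ × Space → ℂ, ContDiff ℝ ∞ η → HasCompactSupport η →
    tsupport η ⊆ interior I ×ˢ univ →
    ∫ t in I, ∫ x, (φ t : Space → ℂ) x * box η t x =
      ∫ t in I, ∫ x, (F t : Space → ℂ) x * η (t, x)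

/-- The cutoff `χ_I^k(t) = (1 + 2^k dist(t, I))^{-N}`. -/
def chi (N : ℕ) (k : ℤ) (I : Set ℝ) (t : ℝ) : ℝ :=
  ((1 + (2 : ℝ) ^ k * Metric.infDist t I) ^ N)⁻¹

/-- The energy dispersion norm at a fixed time of a pair `(f, g) = (φ, ∂ₜφ)(t)`:
`sup_k 2^{-k} ‖(P_k f, 2^{-k} P_k g)‖_{L^∞}`. -/
def edAt (m : ℝ → ℝ) (f g : L2) : ℝ≥0∞ :=
  ⨆ k : ℤ, (2 : ℝ≥0∞) ^ (-k) *
    (eLpNorm (LP m k f : Space → ℂ) ∞ volume +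
      eLpNorm (((2 : ℝ) ^ (-k) • LP m k g : L2) : Space → ℂ) ∞ volume)

/-- The energy dispersion norm over `I`:
`sup_k 2^{-k} ‖(P_k φ, 2^{-k} P_k ∂ₜφ)‖_{L^∞[I × ℝ⁴]}`. -/
def edOn (m : ℝ → ℝ) (I : Set ℝ) (φ : ℝ → L2) : ℝ≥0∞ :=
  ⨆ k : ℤ, (2 : ℝ≥0∞) ^ (-k) *
    (mixedNorm ∞ ∞ I (fun t => LP m k (φ t)) +
      mixedNorm ∞ ∞ I (fun t => (2 : ℝ) ^ (-k) • LP m k (derivWithin φ I t)))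

end WaveExt

end

/-! All functions live at the single frequency 2^k, so no dispersive estimate is needed: the theorem
reduces to multiplier bounds at that frequency and convolution inequalities in time. Write π for the
point of I nearest to t and τ = t - π. For every t, inside I or not, the extension is cos(τ|D|)φ(π)
+ |D|⁻¹sin(τ|D|)∂ₜφ(π) (`waveExtension_eq`). On an annulus these propagators are bounded and
differentiable in operator norm. The formal velocity `waveVelocity` is continuous and the extension
is its integral, so the extension is C¹ (`hasDerivAt_waveExtension`).

The Strichartz bound has three ingredients. First, a free wave at frequency 2^k grows in L^q at most
like (1 + 2^k|τ|)^5 (`exists_propagation_bound`): the kernel of the rescaled propagator is the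
Fourier transform of a compactly supported symbol, and five derivatives in dimension four make it
integrable. Second, the data at a time of I are bounded by 2^k times the integral, over a piece of I
of length comparable to 2^(-k), of ‖φ‖_{L^q} + 2^(-4k/q)‖□φ‖_{L²} (`exists_pointwise_bound`). Here
the weak equation is integrated to show that ∂ₜφ varies by the integral of Δφ - □φ
(`IsBox.derivWithin_sub_eq_integral`); Δ costs 2^(2k), and Bernstein pays for □φ. Third, χ absorbs
the growth of the wave and leaves two powers of decay. The weighted extension is thus dominated by a
convolution with 2^k(1 + 2^k|t|)^(-2) (`exists_waveExtension_bound`), and Young's inequality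
finishes: L¹ * L^p for φ, and from L² to L^p with factor 2^(k(1/2 - 1/p)) for □φ.

For energy dispersion no averaging is needed. The P_j commute with the propagators, only j with 2^j
comparable to 2^k contribute, the propagation bound with q = ∞ applies, and the data at π are
controlled by the essential supremum over I by continuity (`exists_energyDispersion_bound`). -/

noncomputable section

namespace WaveExt

/-! ### Fourier multipliers on L² restricted to a frequency annulus. -/

section Multipliers

/-- The modulus `|ξ| = 2π‖ζ‖` of the angular frequency. -/
def freq (ζ : Space) : ℝ := 2 * Real.pi * ‖ζ‖

lemma continuous_freq : Continuous freq := by unfold freq; fun_prop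

/-- The frequencies `r` with `c⁻¹ 2^k ≤ r ≤ c 2^k`. -/
def band (c : ℝ) (k : ℤ) : Set ℝ := Icc (c⁻¹ * (2 : ℝ) ^ k) (c * (2 : ℝ) ^ k)

lemma band_pos {c : ℝ} (hc : 1 ≤ c) {k : ℤ} {r : ℝ} (hr : r ∈ band c k) : 0 < r :=
  lt_of_lt_of_le (by positivity) hr.1

/-- The annulus of those `ζ` whose angular frequency lies in `band c k`. -/
def annulus (c : ℝ) (k : ℤ) : Set Space := freq ⁻¹' band c k

lemma measurableSet_annulus (c : ℝ) (k : ℤ) : MeasurableSet (annulus c k) :=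
  continuous_freq.measurable measurableSet_Icc

lemma fourier_ext {f g : L2} (h : (𝓕 f : L2) =ᵐ[volume] (𝓕 g : L2)) : f = g :=
  (Lp.fourierTransformₗᵢ Space ℂ).injective (Lp.ext h)

lemma fourier_sub_ae (f g : L2) :
    (𝓕 (f - g) : L2) =ᵐ[volume] fun ζ => (𝓕 f : L2) ζ - (𝓕 g : L2) ζ := by
  have : (𝓕 (f - g) : L2) = 𝓕 f - 𝓕 g := (Lp.fourierTransformₗᵢ Space ℂ).map_sub f g
  rw [this]; exact Lp.coeFn_sub _ _

lemma fourier_smul_ae (a : ℂ) (f : L2) :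
    (𝓕 (a • f) : L2) =ᵐ[volume] fun ζ => a * (𝓕 f : L2) ζ := by
  rw [FourierTransform.fourier_smul]
  filter_upwards [Lp.coeFn_smul a (𝓕 f : L2)] with ζ h using by simpa using h

open scoped Classical in
/-- The Fourier multiplier with a bounded symbol `a` as an operator on `L²`. -/
def multOp (a : Space → ℂ) : L2 →L[ℂ] L2 :=
  if ha : MemLp a ∞ (volume : Measure Space) then
    (FourierTransform.fourierInvCLM ℂ L2) ∘L
      ((ContinuousLinearMap.mul ℂ ℂ).holderL volume ∞ 2 2 (ha.toLp a)) ∘L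
        (FourierTransform.fourierCLM ℂ L2)
  else 0

lemma fourier_multOp {a : Space → ℂ} (ha : MemLp a ∞ (volume : Measure Space)) (f : L2) :
    (𝓕 (multOp a f) : L2) =ᵐ[volume] fun ζ => a ζ * (𝓕 f : L2) ζ := by
  have : (𝓕 (multOp a f) : L2) = (ContinuousLinearMap.mul ℂ ℂ).holder 2 (ha.toLp a) (𝓕 f) := by
    rw [multOp, dif_pos ha]
    exact FourierTransform.fourier_fourierInv_eq _
  rw [this]
  filter_upwards [(ContinuousLinearMap.mul ℂ ℂ).coeFn_holder (r := 2) (ha.toLp a) (𝓕 f : L2),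
    ha.coeFn_toLp] with ζ h1 h2
  rw [h1, h2]; rfl

lemma norm_multOp_le {a : Space → ℂ} (ha : MemLp a ∞ (volume : Measure Space)) {B : ℝ}
    (hB : 0 ≤ B) (h : ∀ ζ, ‖a ζ‖ ≤ B) : ‖multOp a‖ ≤ B := by
  refine ContinuousLinearMap.opNorm_le_bound _ hB fun f => ?_
  rw [← Lp.norm_fourier_eq (multOp a f), ← Lp.norm_fourier_eq f]
  refine Lp.norm_le_mul_norm_of_ae_le_mul ?_
  filter_upwards [fourier_multOp ha f] with ζ hζ
  rw [hζ, norm_mul]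
  gcongr
  exact h ζ

/-- The symbol `σ(|ξ|)` cut off to an annulus. -/
def bandSymbol (c : ℝ) (k : ℤ) (σ : ℝ → ℝ) : Space → ℂ :=
  (annulus c k).indicator fun ζ => ((σ (freq ζ) : ℝ) : ℂ)

/-- Symbols that are measurable, and continuous on the positive half-line. -/
structure IsSymbol (σ : ℝ → ℝ) : Prop where
  measurable : Measurable σ
  continuousOn : ContinuousOn σ (Ioi 0)

lemma isSymbol_of_continuous {σ : ℝ → ℝ} (h : Continuous σ) : IsSymbol σ :=
  ⟨h.measurable, h.continuousOn⟩

lemma isSymbol_const (a : ℝ) : IsSymbol fun _ => a :=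
  isSymbol_of_continuous continuous_const

lemma IsSymbol.mul {σ τ : ℝ → ℝ} (h : IsSymbol σ) (h' : IsSymbol τ) :
    IsSymbol fun r => σ r * τ r :=
  ⟨h.measurable.mul h'.measurable, h.continuousOn.mul h'.continuousOn⟩

lemma IsSymbol.sub {σ τ : ℝ → ℝ} (h : IsSymbol σ) (h' : IsSymbol τ) :
    IsSymbol fun r => σ r - τ r :=
  ⟨h.measurable.sub h'.measurable, h.continuousOn.sub h'.continuousOn⟩

lemma isSymbol_inv : IsSymbol fun r : ℝ => r⁻¹ :=
  ⟨measurable_inv, continuousOn_inv₀.mono fun r (hr : 0 < r) => hr.ne'⟩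

/-- The band is a compact subset of the open half-line, so symbols singular at the origin, such as
`r⁻¹`, are harmless. -/
lemma IsSymbol.exists_bound {σ : ℝ → ℝ} (h : IsSymbol σ) {c : ℝ} (hc : 1 ≤ c) (k : ℤ) :
    ∃ B, ∀ r ∈ band c k, ‖σ r‖ ≤ B :=
  isCompact_Icc.exists_bound_of_continuousOn
    (h.continuousOn.mono fun _ hr => band_pos hc hr)

lemma IsSymbol.memLp {σ : ℝ → ℝ} (h : IsSymbol σ) {c : ℝ} (hc : 1 ≤ c) (k : ℤ) :
    MemLp (bandSymbol c k σ) ∞ (volume : Measure Space) := by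
  obtain ⟨B, hB⟩ := h.exists_bound hc k
  refine memLp_top_of_bound (C := max B 0) ?_ (Filter.Eventually.of_forall fun ζ => ?_)
  · refine ((Complex.measurable_ofReal.comp
      (h.measurable.comp continuous_freq.measurable)).indicator
        (measurableSet_annulus c k)).aestronglyMeasurable
  · unfold bandSymbol
    by_cases hζ : ζ ∈ annulus c k
    · rw [indicator_of_mem hζ, Complex.norm_real]
      exact (hB _ hζ).trans (le_max_left _ _)
    · simp [indicator_of_notMem hζ]

/-- The multiplier with symbol `σ(|ξ|)` cut off to the annulus `c⁻¹ 2^k ≤ |ξ| ≤ c 2^k`. -/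
def bandOp (c : ℝ) (k : ℤ) (σ : ℝ → ℝ) : L2 →L[ℂ] L2 := multOp (bandSymbol c k σ)

variable {c : ℝ} {k : ℤ} {σ τ : ℝ → ℝ}

lemma fourier_bandOp (hc : 1 ≤ c) (hσ : IsSymbol σ) (f : L2) :
    (𝓕 (bandOp c k σ f) : L2) =ᵐ[volume] fun ζ => bandSymbol c k σ ζ * (𝓕 f : L2) ζ :=
  fourier_multOp (hσ.memLp hc k) f

lemma norm_bandOp_le (hc : 1 ≤ c) (hσ : IsSymbol σ) {B : ℝ} (hB : 0 ≤ B)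
    (h : ∀ r ∈ band c k, |σ r| ≤ B) : ‖bandOp c k σ‖ ≤ B := by
  refine norm_multOp_le (hσ.memLp hc k) hB fun ζ => ?_
  unfold bandSymbol
  by_cases hζ : ζ ∈ annulus c k
  · rw [indicator_of_mem hζ, Complex.norm_real]
    exact h _ hζ
  · simpa [indicator_of_notMem hζ] using hB

lemma bandOp_sub (hc : 1 ≤ c) (hσ : IsSymbol σ) (hτ : IsSymbol τ) :
    bandOp c k σ - bandOp c k τ = bandOp c k fun r => σ r - τ r := by
  refine ContinuousLinearMap.ext fun f => fourier_ext ?_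
  rw [sub_apply]
  filter_upwards [fourier_sub_ae (bandOp c k σ f) (bandOp c k τ f), fourier_bandOp hc hσ f,
    fourier_bandOp hc hτ f, fourier_bandOp (k := k) hc (hσ.sub hτ) f] with ζ h1 h2 h3 h4
  rw [h1, h2, h3, h4]
  by_cases hζ : ζ ∈ annulus c k
  · simp [bandSymbol, hζ, sub_mul]
  · simp [bandSymbol, hζ]

lemma smul_bandOp (hc : 1 ≤ c) (hσ : IsSymbol σ) (a : ℝ) :
    a • bandOp c k σ = bandOp c k fun r => a * σ r := by
  refine ContinuousLinearMap.ext fun f => fourier_ext ?_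
  have : (a • bandOp c k σ) f = (a : ℂ) • bandOp c k σ f := rfl
  rw [this]
  filter_upwards [fourier_smul_ae (a : ℂ) (bandOp c k σ f), fourier_bandOp hc hσ f,
    fourier_bandOp (k := k) hc ((isSymbol_const a).mul hσ) f] with ζ h1 h2 h4
  rw [h1, h2, h4]
  by_cases hζ : ζ ∈ annulus c k
  · simp [bandSymbol, hζ, mul_assoc]
  · simp [bandSymbol, hζ]

lemma bandOp_bandOp (hc : 1 ≤ c) (hσ : IsSymbol σ) (hτ : IsSymbol τ) (f : L2) :
    bandOp c k σ (bandOp c k τ f) = bandOp c k (fun r => σ r * τ r) f := by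
  refine fourier_ext ?_
  filter_upwards [fourier_bandOp (k := k) hc hσ (bandOp c k τ f), fourier_bandOp hc hτ f,
    fourier_bandOp (k := k) hc (hσ.mul hτ) f] with ζ h1 h2 h4
  rw [h1, h2, h4]
  by_cases hζ : ζ ∈ annulus c k
  · simp [bandSymbol, hζ, mul_assoc]
  · simp [bandSymbol, hζ]

/-- By Plancherel the operator norm is at most the supremum of the symbol over the band, so a
quadratic Taylor remainder that is uniform there gives a derivative in operator norm. -/
lemma hasDerivAt_bandOp (hc : 1 ≤ c) {σ : ℝ → ℝ → ℝ} {σ' : ℝ → ℝ}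
    (hσ : ∀ t, IsSymbol (σ t)) (hσ' : IsSymbol σ') {t B : ℝ}
    (h : ∀ s, ∀ r ∈ band c k, |σ s r - σ t r - (s - t) * σ' r| ≤ B * (s - t) ^ 2) :
    HasDerivAt (fun s => bandOp c k (σ s)) (bandOp c k σ') t := by
  rw [hasDerivAt_iff_isLittleO]
  have hO : (fun s => bandOp c k (σ s) - bandOp c k (σ t) - (s - t) • bandOp c k σ')
      =O[nhds t] fun s => (s - t) ^ 2 := by
    refine Asymptotics.IsBigO.of_bound |B| (Filter.Eventually.of_forall fun s => ?_)
    rw [bandOp_sub hc (hσ s) (hσ t), smul_bandOp hc hσ',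
      bandOp_sub hc ((hσ s).sub (hσ t)) ((isSymbol_const _).mul hσ')]
    refine norm_bandOp_le hc (((hσ s).sub (hσ t)).sub ((isSymbol_const _).mul hσ'))
      (by positivity) fun r hr => (h s r hr).trans ?_
    rw [Real.norm_of_nonneg (sq_nonneg _)]
    gcongr
    exact le_abs_self B
  refine hO.trans_isLittleO ?_
  simpa using! (Asymptotics.isLittleO_pow_sub_sub (x₀ := t) (m := 2) (by norm_num))

lemma freqLocalized_iff {f : L2} : FreqLocalized c k f ↔
    ∀ᵐ ζ : Space ∂volume, (𝓕 f : L2) ζ ≠ 0 → ζ ∈ annulus c k := Iff.rfl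

lemma freqLocalized_bandOp (hc : 1 ≤ c) (hσ : IsSymbol σ) (f : L2) :
    FreqLocalized c k (bandOp c k σ f) := by
  rw [freqLocalized_iff]
  filter_upwards [fourier_bandOp (k := k) hc hσ f] with ζ h1 h2
  by_contra h
  simp [bandSymbol, h] at h1
  exact h2 h1

/-- The sharp projection to the annulus. -/
def proj (c : ℝ) (k : ℤ) : L2 →L[ℂ] L2 := bandOp c k fun _ => 1

lemma freqLocalized_proj (hc : 1 ≤ c) (f : L2) : FreqLocalized c k (proj c k f) :=
  freqLocalized_bandOp hc (isSymbol_const 1) f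

lemma FreqLocalized.proj_eq (hc : 1 ≤ c) {f : L2} (hf : FreqLocalized c k f) :
    proj c k f = f := by
  refine fourier_ext ?_
  filter_upwards [fourier_bandOp (k := k) hc (isSymbol_const 1) f,
    freqLocalized_iff.1 hf] with ζ h1 h2
  rw [proj, h1]
  by_cases hζ : ζ ∈ annulus c k
  · simp [bandSymbol, hζ]
  · simp [not_imp_comm.1 h2 hζ]

lemma freqLocalized_iff_proj (hc : 1 ≤ c) {f : L2} : FreqLocalized c k f ↔ proj c k f = f :=
  ⟨fun h => h.proj_eq hc, fun h => h ▸ freqLocalized_proj hc f⟩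

lemma proj_bandOp (hc : 1 ≤ c) (hσ : IsSymbol σ) (f : L2) :
    proj c k (bandOp c k σ f) = bandOp c k σ f :=
  (freqLocalized_bandOp hc hσ f).proj_eq hc

/-- Localization makes the product of symbol and transform agree a.e. with the transform of a
`bandOp`, hence square integrable. This excludes the default value 0 of `radialMultiplier`. -/
lemma fourier_radialMultiplier (hc : 1 ≤ c) (hσ : IsSymbol σ) {f : L2}
    (hf : FreqLocalized c k f) :
    (𝓕 (radialMultiplier σ f) : L2) =ᵐ[volume] fun ζ => ((σ (freq ζ) : ℝ) : ℂ) * (𝓕 f : L2) ζ := by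
  have hae : (fun ζ => ((σ (freq ζ) : ℝ) : ℂ) * (𝓕 f : L2) ζ) =ᵐ[volume]
      (𝓕 (bandOp c k σ f) : L2) := by
    filter_upwards [fourier_bandOp (k := k) hc hσ f, freqLocalized_iff.1 hf] with ζ h1 h2
    rw [h1]
    by_cases hζ : ζ ∈ annulus c k
    · simp [bandSymbol, hζ]
    · simp [not_imp_comm.1 h2 hζ]
  have hmem : MemLp (fun ζ : Space => ((σ (2 * Real.pi * ‖ζ‖) : ℝ) : ℂ) * (𝓕 f : L2) ζ) 2
      volume := (memLp_congr_ae hae).2 (Lp.memLp _)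
  rw [radialMultiplier, dif_pos hmem, FourierTransform.fourier_fourierInv_eq]
  exact hmem.coeFn_toLp

lemma radialMultiplier_eq_bandOp (hc : 1 ≤ c) (hσ : IsSymbol σ) {f : L2}
    (hf : FreqLocalized c k f) : radialMultiplier σ f = bandOp c k σ f := by
  refine fourier_ext ?_
  filter_upwards [fourier_radialMultiplier hc hσ hf, fourier_bandOp (k := k) hc hσ f,
    freqLocalized_iff.1 hf] with ζ h0 h1 h2
  rw [h0, h1]
  by_cases hζ : ζ ∈ annulus c k
  · simp [bandSymbol, hζ]
  · simp [not_imp_comm.1 h2 hζ]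

lemma bandOp_eq_zero (hc : 1 ≤ c) (hσ : IsSymbol σ) (h : ∀ r ∈ band c k, σ r = 0) :
    bandOp c k σ = 0 := by
  have := norm_bandOp_le (k := k) hc hσ le_rfl fun r hr => by rw [h r hr, abs_zero]
  exact norm_le_zero_iff.1 this

end Multipliers

/-! ### Minkowski's integral inequality and interpolation of Lebesgue norms. -/

section Inequalities

variable {X Y : Type*} [MeasurableSpace X] [MeasurableSpace Y]

/-- Minkowski's integral inequality for a finite measure and slices of bounded `L^q` norm. -/
lemma eLpNorm_lintegral_le {μ : Measure X} {ν : Measure Y} [SFinite μ] [IsFiniteMeasure ν]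
    {g : X → Y → ℝ≥0∞} (hg : Measurable (Function.uncurry g)) {q : ℝ≥0∞} (hq : 1 ≤ q)
    {B : ℝ≥0∞} (hB : ∀ y, eLpNorm (fun x => g x y) q μ ≤ B) :
    eLpNorm (fun x => ∫⁻ y, g x y ∂ν) q μ ≤ ν univ * B := by
  rcases eq_or_ne q ∞ with rfl | hq'
  · have h1 : ∀ᵐ x ∂μ, ∀ᵐ y ∂ν, g x y ≤ B := by
      have hms : MeasurableSet {z : X × Y | g z.1 z.2 ≤ B} := measurableSet_le hg measurable_const
      rw [Measure.ae_ae_comm hms]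
      refine Filter.Eventually.of_forall fun y => ?_
      have := hB y
      rw [eLpNorm_exponent_top] at this
      filter_upwards [enorm_ae_le_eLpNormEssSup (fun x => g x y) μ] with x hx
      exact (by simpa using hx : g x y ≤ _).trans this
    rw [eLpNorm_exponent_top]
    refine eLpNormEssSup_le_of_ae_enorm_bound ?_
    filter_upwards [h1] with x hx
    calc ‖∫⁻ y, g x y ∂ν‖ₑ = ∫⁻ y, g x y ∂ν := by simp
      _ ≤ ∫⁻ _, B ∂ν := lintegral_mono_ae hx
      _ = ν univ * B := by rw [lintegral_const, mul_comm]
  have hq0 : q ≠ 0 := (zero_lt_one.trans_le hq).ne'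
  have hr : 1 ≤ q.toReal := by
    rw [← ENNReal.toReal_one]; exact ENNReal.toReal_mono hq' hq
  have hr0 : 0 < q.toReal := by linarith
  set r := q.toReal
  -- Hölder in y against the constant 1 on the finite measure; afterwards Tonelli suffices.
  have key : ∀ x, (∫⁻ y, g x y ∂ν) ^ r ≤ ν univ ^ (r - 1) * ∫⁻ y, g x y ^ r ∂ν := by
    intro x
    have hm : Measurable (fun y => g x y) := hg.comp measurable_prodMk_left
    have := eLpNorm_le_eLpNorm_mul_rpow_measure_univ (μ := ν) (f := fun y => g x y) hq
      hm.aestronglyMeasurable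
    rw [eLpNorm_one_eq_lintegral_enorm, eLpNorm_eq_lintegral_rpow_enorm_toReal hq0 hq'] at this
    simp only [enorm_eq_self] at this
    calc (∫⁻ y, g x y ∂ν) ^ r
        ≤ ((∫⁻ y, g x y ^ r ∂ν) ^ (1 / r) * ν univ ^ (1 / (1 : ℝ≥0∞).toReal - 1 / r)) ^ r := by
          gcongr
      _ = ν univ ^ (r - 1) * ∫⁻ y, g x y ^ r ∂ν := by
          rw [ENNReal.mul_rpow_of_nonneg _ _ hr0.le, ← ENNReal.rpow_mul, ← ENNReal.rpow_mul,
            mul_comm]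
          congr 2
          · simp; field_simp
          · rw [one_div_mul_cancel hr0.ne', ENNReal.rpow_one]
  rw [eLpNorm_eq_lintegral_rpow_enorm_toReal hq0 hq']
  simp only [enorm_eq_self]
  have hB' : ∀ y, ∫⁻ x, g x y ^ r ∂μ ≤ B ^ r := by
    intro y
    have := hB y
    rw [eLpNorm_eq_lintegral_rpow_enorm_toReal hq0 hq'] at this
    simp only [enorm_eq_self] at this
    calc ∫⁻ x, g x y ^ r ∂μ = ((∫⁻ x, g x y ^ r ∂μ) ^ (1 / r)) ^ r := by
          rw [← ENNReal.rpow_mul, one_div_mul_cancel hr0.ne', ENNReal.rpow_one]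
      _ ≤ B ^ r := by gcongr
  calc (∫⁻ x, (∫⁻ y, g x y ∂ν) ^ r ∂μ) ^ (1 / r)
      ≤ (∫⁻ x, ν univ ^ (r - 1) * ∫⁻ y, g x y ^ r ∂ν ∂μ) ^ (1 / r) := by
        gcongr with x; exact key x
    _ = (ν univ ^ (r - 1) * ∫⁻ y, ∫⁻ x, g x y ^ r ∂μ ∂ν) ^ (1 / r) := by
        rw [lintegral_const_mul' _ _ (ENNReal.rpow_ne_top_of_nonneg (by linarith)
          (measure_ne_top _ _)), lintegral_lintegral_swap (hg.pow_const r).aemeasurable]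
    _ ≤ (ν univ ^ (r - 1) * (ν univ * B ^ r)) ^ (1 / r) := by
        gcongr
        calc ∫⁻ y, ∫⁻ x, g x y ^ r ∂μ ∂ν ≤ ∫⁻ _, B ^ r ∂ν := lintegral_mono hB'
          _ = ν univ * B ^ r := by rw [lintegral_const, mul_comm]
    _ = ν univ * B := by
        have h1 : ν univ ^ (r - 1) * (ν univ * B ^ r) = (ν univ * B) ^ r := by
          rw [ENNReal.mul_rpow_of_nonneg _ _ hr0.le, ← mul_assoc]
          congr 1
          rcases eq_or_ne (ν univ) 0 with h0 | h0
          · rw [h0, mul_zero, ENNReal.zero_rpow_of_pos hr0]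
          · nth_rewrite 2 [← ENNReal.rpow_one (ν univ)]
            rw [← ENNReal.rpow_add _ _ h0 (measure_ne_top _ _), sub_add_cancel]
        rw [h1, ← ENNReal.rpow_mul, mul_one_div_cancel hr0.ne', ENNReal.rpow_one]

/-- Log-convexity of `L^q` norms between `L²` and `L^∞`. -/
lemma eLpNorm_le_top_two {E : Type*} [TopologicalSpace E] [ENormedAddMonoid E] {μ : Measure X}
    {f : X → E}
    (hf : AEStronglyMeasurable f μ) {q : ℝ≥0∞} (hq : 2 ≤ q) :
    eLpNorm f q μ ≤
      eLpNorm f ∞ μ ^ (1 - 2 * (q⁻¹).toReal) * eLpNorm f 2 μ ^ (2 * (q⁻¹).toReal) := by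
  rcases eq_or_ne q ∞ with rfl | hq'
  · simp
  have hq0 : q ≠ 0 := ((by norm_num : (0 : ℝ≥0∞) < 2).trans_le hq).ne'
  have hr : 2 ≤ q.toReal := by
    have := ENNReal.toReal_mono hq' hq
    simpa using this
  have hr0 : 0 < q.toReal := by linarith
  rw [ENNReal.toReal_inv, eLpNorm_eq_lintegral_rpow_enorm_toReal hq0 hq',
    eLpNorm_eq_lintegral_rpow_enorm_toReal two_ne_zero ENNReal.ofNat_ne_top]
  set r := q.toReal
  set S := eLpNorm f ∞ μ with hS
  have h1 : ∫⁻ x, ‖f x‖ₑ ^ r ∂μ ≤ ∫⁻ x, S ^ (r - 2) * ‖f x‖ₑ ^ (2 : ℝ) ∂μ := by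
    refine lintegral_mono_ae ?_
    filter_upwards [enorm_ae_le_eLpNormEssSup f μ] with x hx
    rw [← eLpNorm_exponent_top, ← hS] at hx
    calc ‖f x‖ₑ ^ r = ‖f x‖ₑ ^ ((r - 2) + 2) := by ring_nf
      _ = ‖f x‖ₑ ^ (r - 2) * ‖f x‖ₑ ^ (2 : ℝ) :=
        ENNReal.rpow_add_of_nonneg _ _ (by linarith) (by norm_num)
      _ ≤ _ := by gcongr
  -- The constant can be pulled out directly only when it is finite. If S = ∞ and r > 2, the right
  -- side is ∞ unless ∫|f|² = 0, which would force S = 0; hence S = 0 is treated first.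
  have h2 : ∫⁻ x, S ^ (r - 2) * ‖f x‖ₑ ^ (2 : ℝ) ∂μ ≤
      S ^ (r - 2) * ∫⁻ x, ‖f x‖ₑ ^ (2 : ℝ) ∂μ := by
    rcases eq_or_ne S 0 with h0 | h0
    · have : f =ᵐ[μ] 0 := by
        rw [hS, eLpNorm_exponent_top, eLpNormEssSup_eq_zero_iff] at h0; exact h0
      have h3 : ∫⁻ x, S ^ (r - 2) * ‖f x‖ₑ ^ (2 : ℝ) ∂μ = 0 := by
        rw [lintegral_eq_zero_iff' ]
        · filter_upwards [this] with x hx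
          simp [hx]
        · refine AEMeasurable.congr (f := fun _ => 0) aemeasurable_const ?_
          filter_upwards [this] with x hx
          simp [hx]
      rw [h3]; exact zero_le
    rcases eq_or_ne S ∞ with h3 | h3
    · rcases eq_or_lt_of_le hr with h4 | h4
      · simp [← h4]
      · rcases eq_or_ne (∫⁻ x, ‖f x‖ₑ ^ (2 : ℝ) ∂μ) 0 with h5 | h5
        · exfalso
          have : eLpNorm f 2 μ = 0 := by
            rw [eLpNorm_eq_lintegral_rpow_enorm_toReal two_ne_zero ENNReal.ofNat_ne_top]
            simp only [ENNReal.toReal_ofNat]; rw [h5]; simp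
          rw [eLpNorm_eq_zero_iff hf two_ne_zero] at this
          refine h0 ?_
          rw [hS, eLpNorm_congr_ae this, eLpNorm_zero]
        · rw [h3, ENNReal.top_rpow_of_pos (by linarith), ENNReal.top_mul h5]; exact le_top
    rw [lintegral_const_mul' _ _ (ENNReal.rpow_ne_top_of_nonneg (by linarith) h3)]
  calc (∫⁻ x, ‖f x‖ₑ ^ r ∂μ) ^ (1 / r)
      ≤ (S ^ (r - 2) * ∫⁻ x, ‖f x‖ₑ ^ (2 : ℝ) ∂μ) ^ (1 / r) := by
        gcongr; exact h1.trans h2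
    _ = _ := by
        rw [ENNReal.mul_rpow_of_nonneg _ _ (by positivity), ← ENNReal.rpow_mul,
          ← ENNReal.rpow_mul]
        congr 2
        · field_simp
        · simp

end Inequalities

/-! ### Agreement of the L² inverse transform with the inversion integral. -/

section FourierInversion

lemma continuous_fourierInv {g : Space → ℂ} (hg : Integrable g) : Continuous (𝓕⁻ g) := by
  have : 𝓕⁻ g = fun x => 𝓕 g (-x) := by
    ext x; exact Real.fourierInv_eq_fourier_neg g x
  rw [this]
  exact (VectorFourier.fourierIntegral_continuous Real.continuous_fourierChar
    (by exact continuous_inner) hg).comp continuous_neg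

/-- This is Fubini, in its form for Fourier integrals along a bilinear form. Minus the inner product
is its own flip, so inverse transforms appear on both sides. -/
lemma integral_mul_fourierInv {u g : Space → ℂ} (hu : Integrable u) (hg : Integrable g) :
    ∫ x, u x * 𝓕⁻ g x = ∫ x, 𝓕⁻ u x * g x := by
  have h : ∀ v : Space → ℂ, 𝓕⁻ v =
      VectorFourier.fourierIntegral Real.fourierChar volume (-innerₗ Space) v := by
    intro v; ext x
    simp [Real.fourierInv_eq, VectorFourier.fourierIntegral]
  have hflip : (-innerₗ Space).flip = -innerₗ Space := by
    ext x y; simp [real_inner_comm]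
  have := VectorFourier.integral_fourierIntegral_smul_eq_flip (L := -innerₗ Space)
    (μ := volume) (ν := volume) Real.continuous_fourierChar
    (by simpa using! continuous_inner.neg) hu hg
  rw [hflip, ← h, ← h] at this
  simpa using this.symm

/-- For an integrable element of `L²` the inverse Fourier transform is given by the integral. -/
lemma fourierInv_ae_eq {g : L2} (hg : Integrable (g : Space → ℂ)) :
    (𝓕⁻ g : L2) =ᵐ[volume] 𝓕⁻ (g : Space → ℂ) := by
  refine ae_eq_of_integral_contDiff_smul_eq ((Lp.memLp _).locallyIntegrable (by norm_num))
    (continuous_fourierInv hg).locallyIntegrable fun ψ hψ hψc => ?_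
  have h1 : ContDiff ℝ ∞ fun x => (ψ x : ℂ) := Complex.ofRealCLM.contDiff.comp hψ
  have h2 : HasCompactSupport fun x => (ψ x : ℂ) := hψc.comp_left (g := fun r : ℝ => (r : ℂ)) rfl
  set Ψ := h2.toSchwartzMap h1 with hΨ
  have e1 : ∫ x, ψ x • (𝓕⁻ g : L2) x = Lp.toTemperedDistribution (𝓕⁻ g : L2) Ψ := by
    rw [Lp.toTemperedDistribution_apply]; rfl
  -- For tempered distributions, moving the inverse transform onto the test function is the
  -- definition.
  have e2 : Lp.toTemperedDistribution (𝓕⁻ g : L2) Ψ = ∫ x, 𝓕⁻ (Ψ : Space → ℂ) x * g x := by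
    rw [← Lp.fourierInv_toTemperedDistribution_eq, TemperedDistribution.fourierInv_apply,
      Lp.toTemperedDistribution_apply, SchwartzMap.fourierInv_coe]
    rfl
  rw [e1, e2, ← integral_mul_fourierInv Ψ.integrable hg]
  rfl

end FourierInversion

/-! ### Bernstein's inequality. -/

section Bernstein

variable {c : ℝ} {k : ℤ}

lemma volume_annulus_le (hc : 1 ≤ c) (k : ℤ) : volume (annulus c k) ≤
    ENNReal.ofReal ((c * (2 : ℝ) ^ k) ^ 4) * volume (Metric.ball (0 : Space) 1) := by
  have h0 : (0 : ℝ) ≤ c * (2 : ℝ) ^ k := by positivity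
  have hsub : annulus c k ⊆ Metric.closedBall 0 (c * (2 : ℝ) ^ k) := by
    intro ζ hζ
    rw [mem_closedBall_zero_iff]
    have h1 : 2 * Real.pi * ‖ζ‖ ≤ c * (2 : ℝ) ^ k := hζ.2
    have h2 : 1 ≤ 2 * Real.pi := by linarith [Real.two_le_pi]
    nlinarith [norm_nonneg ζ]
  refine (measure_mono hsub).trans ?_
  rw [Measure.addHaar_closedBall _ _ h0]
  simp

lemma volume_annulus_ne_top (hc : 1 ≤ c) (k : ℤ) : volume (annulus c k) ≠ (∞ : ℝ≥0∞) :=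
  ((volume_annulus_le hc k).trans_lt
    (ENNReal.mul_lt_top ENNReal.ofReal_lt_top measure_ball_lt_top)).ne

/-- Cauchy–Schwarz on the annulus, outside which the transform vanishes, followed by Plancherel. -/
lemma FreqLocalized.lintegral_fourier_le {f : L2} (hf : FreqLocalized c k f) :
    ∫⁻ ζ, ‖(𝓕 f : L2) ζ‖ₑ ≤ volume (annulus c k) ^ (1 / 2 : ℝ) * ‖f‖ₑ := by
  have h1 : ∫⁻ ζ, ‖(𝓕 f : L2) ζ‖ₑ = ∫⁻ ζ in annulus c k, ‖(𝓕 f : L2) ζ‖ₑ := by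
    rw [← lintegral_indicator (measurableSet_annulus c k)]
    refine lintegral_congr_ae ?_
    filter_upwards [freqLocalized_iff.1 hf] with ζ h
    by_cases hζ : ζ ∈ annulus c k
    · simp [hζ]
    · simp [hζ, not_imp_comm.1 h hζ]
  have h2 := eLpNorm_le_eLpNorm_mul_rpow_measure_univ (μ := volume.restrict (annulus c k))
    (f := (𝓕 f : L2)) (p := 1) (q := 2) (by norm_num) (Lp.aestronglyMeasurable _).restrict
  rw [eLpNorm_one_eq_lintegral_enorm, ← h1, Measure.restrict_apply_univ] at h2
  refine h2.trans ?_
  rw [mul_comm]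
  have h3 : eLpNorm (𝓕 f : L2) 2 (volume.restrict (annulus c k)) ≤ ‖f‖ₑ := by
    refine (eLpNorm_mono_measure _ Measure.restrict_le_self).trans ?_
    rw [← Lp.enorm_def, ← ofReal_norm, Lp.norm_fourier_eq, ofReal_norm]
  exact mul_le_mul' (le_of_eq (by norm_num)) h3

lemma FreqLocalized.integrable_fourier (hc : 1 ≤ c) {f : L2} (hf : FreqLocalized c k f) :
    Integrable (𝓕 f : L2) := by
  refine ⟨Lp.aestronglyMeasurable _, (hf.lintegral_fourier_le).trans_lt ?_⟩
  exact ENNReal.mul_lt_top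
    (ENNReal.rpow_lt_top_of_nonneg (by norm_num) (volume_annulus_ne_top hc k)) enorm_lt_top

lemma ae_eq_fourierInv_fourier {f : L2} (hf : Integrable (𝓕 f : L2)) :
    f =ᵐ[volume] 𝓕⁻ ((𝓕 f : L2) : Space → ℂ) := by
  have := fourierInv_ae_eq hf
  rwa [FourierTransform.fourierInv_fourier_eq] at this

/-- The inversion integral converges absolutely, so the sup norm is at most the L¹ norm of the
transform. This is the endpoint q = ∞ of Bernstein; in dimension four the root of the volume is of
order 2^(2k). -/
lemma FreqLocalized.eLpNorm_top_le (hc : 1 ≤ c) {f : L2} (hf : FreqLocalized c k f) :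
    eLpNorm f (∞ : ℝ≥0∞) volume ≤ volume (annulus c k) ^ (1 / 2 : ℝ) * ‖f‖ₑ := by
  rw [eLpNorm_congr_ae (ae_eq_fourierInv_fourier (hf.integrable_fourier hc)),
    eLpNorm_exponent_top]
  refine (eLpNormEssSup_le_of_ae_enorm_bound (Filter.Eventually.of_forall fun x => ?_)).trans
    (hf.lintegral_fourier_le)
  rw [Real.fourierInv_eq]
  refine (enorm_integral_le_lintegral_enorm _).trans (le_of_eq ?_)
  refine lintegral_congr fun ζ => ?_
  rw [← ofReal_norm, Circle.norm_smul, ofReal_norm]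

/-- **Bernstein's inequality** from `L²` to `L^q` for frequency localized functions. -/
lemma exists_bernstein (hc : 1 ≤ c) : ∃ C : ℝ≥0, ∀ (k : ℤ) (f : L2), FreqLocalized c k f →
    ∀ q : ℝ≥0∞, 2 ≤ q → eLpNorm f q volume ≤
      C * (2 : ℝ≥0∞) ^ ((2 - 4 * (q⁻¹).toReal) * (k : ℝ)) * ‖f‖ₑ := by
  set V := volume (Metric.ball (0 : Space) 1) with hV
  have hVt : V ≠ (∞ : ℝ≥0∞) := measure_ball_lt_top.ne
  -- The maximum with 1 gives D^(1 - 2θ) ≤ D in the interpolation below.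
  set D : ℝ≥0 := max 1 (c.toNNReal ^ 2 * V.toNNReal ^ (1 / 2 : ℝ)) with hD
  have hD1 : (1 : ℝ≥0∞) ≤ D := by exact_mod_cast le_max_left _ _
  refine ⟨D, fun k f hf q hq => ?_⟩
  have htop : eLpNorm f (∞ : ℝ≥0∞) volume ≤ D * (2 : ℝ≥0∞) ^ (2 * (k : ℝ)) * ‖f‖ₑ := by
    refine (hf.eLpNorm_top_le hc).trans ?_
    gcongr
    calc volume (annulus c k) ^ (1 / 2 : ℝ)
        ≤ (ENNReal.ofReal ((c * (2 : ℝ) ^ k) ^ 4) * V) ^ (1 / 2 : ℝ) := by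
          gcongr; exact volume_annulus_le hc k
      _ = ENNReal.ofReal c ^ 2 * V ^ (1 / 2 : ℝ) * (2 : ℝ≥0∞) ^ (2 * (k : ℝ)) := by
          rw [ENNReal.mul_rpow_of_nonneg _ _ (by norm_num), ENNReal.ofReal_pow (by positivity),
            ENNReal.ofReal_mul (by positivity), mul_pow, ENNReal.mul_rpow_of_nonneg _ _ (by norm_num)]
          have e1 : ∀ x : ℝ≥0∞, (x ^ 4) ^ (1 / 2 : ℝ) = x ^ 2 := by
            intro x
            rw [← ENNReal.rpow_natCast, ← ENNReal.rpow_mul, ← ENNReal.rpow_natCast]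
            norm_num
          rw [e1, e1, ← Real.rpow_intCast, ← ENNReal.ofReal_rpow_of_pos (by norm_num),
            ENNReal.ofReal_ofNat, ← ENNReal.rpow_natCast (_ ^ (k : ℝ)), ← ENNReal.rpow_mul,
            mul_comm (k : ℝ)]
          push_cast
          ring
      _ ≤ D * (2 : ℝ≥0∞) ^ (2 * (k : ℝ)) := by
          gcongr
          rw [hD]
          refine le_trans (le_of_eq ?_) (ENNReal.coe_le_coe.2 (le_max_right _ _))
          rw [ENNReal.coe_mul, ENNReal.coe_pow, ENNReal.coe_rpow_of_nonneg _ (by norm_num),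
            ENNReal.coe_toNNReal hVt]
          rfl
  set θ := (q⁻¹).toReal with hθ
  have hθ0 : 0 ≤ θ := ENNReal.toReal_nonneg
  have hθ1 : θ ≤ 1 / 2 := by
    have : q⁻¹ ≤ 2⁻¹ := ENNReal.inv_le_inv.2 hq
    have := ENNReal.toReal_mono (by norm_num) this
    rw [hθ]; simpa using this
  refine (eLpNorm_le_top_two (Lp.aestronglyMeasurable f) hq).trans ?_
  rw [← hθ, ← Lp.enorm_def]
  have h2t : (2 : ℝ≥0∞) ^ (2 * (k : ℝ)) ≠ (∞ : ℝ≥0∞) := ENNReal.rpow_ne_top_of_ne_zero (by norm_num) (by norm_num)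
  calc eLpNorm f (∞ : ℝ≥0∞) volume ^ (1 - 2 * θ) * ‖f‖ₑ ^ (2 * θ)
      ≤ (D * (2 : ℝ≥0∞) ^ (2 * (k : ℝ)) * ‖f‖ₑ) ^ (1 - 2 * θ) * ‖f‖ₑ ^ (2 * θ) := by
        gcongr; linarith
    _ = (D : ℝ≥0∞) ^ (1 - 2 * θ) * (2 : ℝ≥0∞) ^ ((2 - 4 * θ) * (k : ℝ)) *
          (‖f‖ₑ ^ (1 - 2 * θ) * ‖f‖ₑ ^ (2 * θ)) := by
        rw [ENNReal.mul_rpow_of_nonneg _ _ (by linarith),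
          ENNReal.mul_rpow_of_nonneg _ _ (by linarith), ← ENNReal.rpow_mul]
        rw [show 2 * (k : ℝ) * (1 - 2 * θ) = (2 - 4 * θ) * k by ring]
        ring
    _ ≤ (D : ℝ≥0∞) ^ (1 : ℝ) * (2 : ℝ≥0∞) ^ ((2 - 4 * θ) * (k : ℝ)) * ‖f‖ₑ := by
        rw [← ENNReal.rpow_add_of_nonneg _ _ (by linarith) (by linarith), sub_add_cancel,
          ENNReal.rpow_one]
        gcongr
        linarith
    _ = _ := by rw [ENNReal.rpow_one]

end Bernstein

/-! ### Multipliers with integrable kernel on L^q. -/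

section KernelBound

/-- A function of frequency `λζ` with integrable Fourier transform acts boundedly on `L^q`. -/
lemma eLpNorm_le_of_symbol {σ : Space → ℂ} (hσc : Continuous σ) (hσ : Integrable σ)
    (hK : Integrable (𝓕 σ)) {f h : L2} (hf : Integrable (𝓕 f : L2)) (l : ℝ)
    (hfh : (𝓕 h : L2) =ᵐ[volume] fun ζ => σ (l • ζ) * (𝓕 f : L2) ζ) {q : ℝ≥0∞} (hq : 1 ≤ q) :
    eLpNorm h q volume ≤ (∫⁻ y, ‖𝓕 σ y‖ₑ) * eLpNorm f q volume := by
  set K := 𝓕 σ with hKdef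
  have hσK : ∀ η, σ η = ∫ y, (Real.fourierChar (inner ℝ y η)) • K y := by
    intro η
    rw [← Real.fourierInv_eq, hKdef, hσc.fourierInv_fourier_eq hσ hK]
  have hbd : ∀ η, ‖σ η‖ ≤ ∫ y, ‖K y‖ := by
    intro η
    rw [hσK]
    refine (norm_integral_le_integral_norm _).trans (le_of_eq ?_)
    simp
  have hh : Integrable (𝓕 h : L2) := by
    refine Integrable.congr ?_ hfh.symm
    refine hf.bdd_mul (c := ∫ y, ‖K y‖) ?_ (Filter.Eventually.of_forall fun ζ => hbd _)
    exact (hσc.comp (by fun_prop)).aestronglyMeasurable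
  set F := 𝓕⁻ ((𝓕 f : L2) : Space → ℂ) with hF
  have hFc : Continuous F := continuous_fourierInv hf
  -- Writing σ(lζ) as the inversion integral of K turns h into a superposition of translates F(x +
  -- ly) with weights K(y).
  have key : ∀ x, 𝓕⁻ ((𝓕 h : L2) : Space → ℂ) x = ∫ y, K y * F (x + l • y) := by
    intro x
    set Φ : Space → Space → ℂ := fun ζ y =>
      (Real.fourierChar (inner ℝ ζ x)) • ((Real.fourierChar (inner ℝ y (l • ζ)) • K y) *
        (𝓕 f : L2) ζ) with hΦ
    have hint : Integrable (Function.uncurry Φ) (volume.prod volume) := by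
      refine Integrable.mono (hf.mul_prod hK) ?_ (Filter.Eventually.of_forall fun z => ?_)
      · have a1 : AEStronglyMeasurable (fun z : Space × Space => K z.2) (volume.prod volume) :=
          hK.aestronglyMeasurable.comp_snd
        have a2 : AEStronglyMeasurable (fun z : Space × Space => (𝓕 f : L2) z.1)
          (volume.prod volume) := hf.aestronglyMeasurable.comp_fst
        have a3 : Continuous (fun z : Space × Space => Real.fourierChar (inner ℝ z.1 x)) :=
          Real.continuous_fourierChar.comp (by fun_prop)
        have a4 : Continuous (fun z : Space × Space => Real.fourierChar (inner ℝ z.2 (l • z.1))) :=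
          Real.continuous_fourierChar.comp (by fun_prop)
        exact a3.aestronglyMeasurable.smul ((a4.aestronglyMeasurable.smul a1).mul a2)
      · simp [Function.uncurry, hΦ, mul_comm]
    calc 𝓕⁻ ((𝓕 h : L2) : Space → ℂ) x
        = ∫ ζ, Real.fourierChar (inner ℝ ζ x) • (𝓕 h : L2) ζ := Real.fourierInv_eq _ _
      _ = ∫ ζ, ∫ y, Φ ζ y := by
          refine integral_congr_ae ?_
          filter_upwards [hfh] with ζ hζ
          rw [hζ, hσK, ← integral_mul_const]
          simp only [hΦ, Circle.smul_def, smul_eq_mul]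
          rw [← integral_const_mul]
      _ = ∫ y, ∫ ζ, Φ ζ y := integral_integral_swap hint
      _ = ∫ y, K y * F (x + l • y) := by
          refine integral_congr_ae (Filter.Eventually.of_forall fun y => ?_)
          simp only [hΦ, hF, Real.fourierInv_eq]
          rw [← integral_const_mul]
          refine integral_congr_ae (Filter.Eventually.of_forall fun ζ => ?_)
          simp only [Circle.smul_def, smul_eq_mul]
          rw [inner_add_right, AddChar.map_add_eq_mul, inner_smul_right, inner_smul_right,
            real_inner_comm ζ y, Circle.coe_mul]
          ring
  -- With |K| as the density of a finite measure, Minkowski's inequality applies; all translates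
  -- have the same L^q norm, so the dilation l costs nothing.
  set ν := (volume : Measure Space).withDensity fun y => ‖K y‖ₑ with hν
  have : IsFiniteMeasure ν := isFiniteMeasure_withDensity hK.2.ne
  have hνu : ν univ = ∫⁻ y, ‖K y‖ₑ := by rw [hν, withDensity_apply _ MeasurableSet.univ]; simp
  rw [eLpNorm_congr_ae (ae_eq_fourierInv_fourier hh),
    eLpNorm_congr_ae (ae_eq_fourierInv_fourier hf), ← hνu]
  have hmeas : Measurable (Function.uncurry fun (x y : Space) => ‖F (x + l • y)‖ₑ) := by
    have : Continuous (Function.uncurry fun (x y : Space) => F (x + l • y)) :=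
      hFc.comp (by fun_prop)
    exact this.measurable.enorm
  refine le_trans ?_ (eLpNorm_lintegral_le (μ := volume) (ν := ν) hmeas hq (B := eLpNorm F q volume)
    fun y => ?_)
  · refine eLpNorm_mono_enorm fun x => ?_
    rw [key x, enorm_eq_self]
    refine (enorm_integral_le_lintegral_enorm _).trans (le_of_eq ?_)
    rw [hν, lintegral_withDensity_eq_lintegral_mul₀ hK.aestronglyMeasurable.enorm
      (g := fun y => ‖F (x + l • y)‖ₑ) (hmeas.comp measurable_prodMk_left).aemeasurable]
    simp [enorm_mul]
  · have := eLpNorm_comp_measurePreserving (p := q) (g := F)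
      hFc.aestronglyMeasurable (measurePreserving_add_right volume (l • y))
    rw [← this]
    refine le_of_eq (eLpNorm_congr_enorm_ae (Filter.Eventually.of_forall fun x => ?_))
    simp

end KernelBound

/-! ### Kernel bounds for oscillating symbols. -/

section SymbolEstimates

/-- The `L¹` norm of a Fourier transform is bounded by the derivatives of order at most `5`. -/
lemma exists_lintegral_fourier_le {S : Set Space} (hS : IsCompact S) :
    ∃ C : ℝ≥0, ∀ (σ : Space → ℂ) (R : ℝ), ContDiff ℝ ∞ σ → tsupport σ ⊆ S → 0 ≤ R →
      (∀ n ≤ 5, ∀ η, ‖iteratedFDeriv ℝ n σ η‖ ≤ R) →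
      ∫⁻ y, ‖𝓕 σ y‖ₑ ≤ C * ENNReal.ofReal R := by
  set V := (volume S).toReal with hV
  -- Five derivatives are used because the decay exponent must exceed the dimension 4. In M below,
  -- the two summands come from the bounds of order 0 and 5 in `hbound`, and the outer 2^5 from
  -- merging them into a power of 1 + ‖w‖.
  have hJ : Integrable (fun w : Space => (1 + ‖w‖) ^ (-(5 : ℝ))) :=
    integrable_one_add_norm (by simp; norm_num)
  set M : ℝ := 2 ^ 5 * (V + 2 ^ 5 * (6 * V)) with hM
  have hM0 : 0 ≤ M := by positivity
  refine ⟨(M * ∫ w : Space, (1 + ‖w‖) ^ (-(5 : ℝ))).toNNReal, fun σ R hσ hsupp hR hd => ?_⟩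
  have hderiv_supp : ∀ n, ∀ η ∉ S, iteratedFDeriv ℝ n σ η = 0 := by
    intro n η hη
    by_contra h
    exact hη (hsupp (support_iteratedFDeriv_subset n h))
  have hint : ∀ n, Integrable (fun η => ‖η‖ ^ 0 * ‖iteratedFDeriv ℝ n σ η‖) := by
    intro n
    simp only [pow_zero, one_mul]
    refine Continuous.integrable_of_hasCompactSupport
      (hσ.continuous_iteratedFDeriv (by exact_mod_cast le_top)).norm ?_
    exact HasCompactSupport.intro hS fun η hη => by rw [hderiv_supp n η hη, norm_zero]
  have hI : ∀ n ≤ 5, ∫ η, ‖η‖ ^ 0 * ‖iteratedFDeriv ℝ n σ η‖ ≤ V * R := by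
    intro n hn
    have : ∀ η, ‖η‖ ^ 0 * ‖iteratedFDeriv ℝ n σ η‖ ≤ S.indicator (fun _ => R) η := by
      intro η
      by_cases h : η ∈ S
      · simpa [h] using hd n hn η
      · simp [h, hderiv_supp n η h]
    refine (integral_mono (hint n) ?_ this).trans (le_of_eq ?_)
    · exact (integrable_indicator_iff hS.measurableSet).2
        (integrableOn_const hS.measure_lt_top.ne)
    · rw [integral_indicator hS.measurableSet, setIntegral_const, smul_eq_mul]; rfl
  have hbound : ∀ n : ℕ, n ≤ 5 → ∀ w, ‖w‖ ^ n * ‖𝓕 σ w‖ ≤ 2 ^ n * ((n + 1) * (V * R)) := by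
    intro n hn w
    have := Real.pow_mul_norm_iteratedFDeriv_fourier_le (f := σ) (K := 0) (N := ⊤) (k := 0) (n := n)
      hσ (fun k m hk _ => by
        have : k = 0 := by simpa using hk
        subst this; exact hint m) le_rfl le_top w
    rw [norm_iteratedFDeriv_zero] at this
    refine this.trans ?_
    simp only [CharP.cast_eq_zero, mul_zero, zero_add, pow_zero, one_mul]
    gcongr
    rw [Finset.range_one, Finset.sum_product]
    simp only [Finset.sum_singleton]
    refine (Finset.sum_le_card_nsmul _ _ (V * R) fun m hm => ?_).trans (le_of_eq ?_)
    · exact hI m (by have := Finset.mem_range.1 hm; omega)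
    · simp
  have hpt : ∀ w, ‖𝓕 σ w‖ ≤ M * R * (1 + ‖w‖) ^ (-(5 : ℝ)) := by
    intro w
    have h0 := hbound 0 (by norm_num) w
    have h5 := hbound 5 le_rfl w
    have := pow_mul_le_of_le_of_pow_mul_le (k := 0) (l := 5) (norm_nonneg w) (norm_nonneg (𝓕 σ w))
      (C₁ := V * R) (C₂ := 2 ^ 5 * (6 * (V * R))) (by simpa using h0)
      (by norm_num at h5 ⊢; exact h5)
    rw [pow_zero, one_mul] at this
    refine this.trans (le_of_eq ?_)
    rw [hM]
    norm_num
    left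
    ring
  calc ∫⁻ y, ‖𝓕 σ y‖ₑ ≤ ∫⁻ y : Space, ENNReal.ofReal (M * R * (1 + ‖y‖) ^ (-(5 : ℝ))) := by
        refine lintegral_mono fun y => ?_
        rw [← ofReal_norm]
        exact ENNReal.ofReal_le_ofReal (hpt y)
    _ = ENNReal.ofReal (∫ y : Space, M * R * (1 + ‖y‖) ^ (-(5 : ℝ))) :=
        (ofReal_integral_eq_lintegral_ofReal (hJ.const_mul _)
          (Filter.Eventually.of_forall fun y => by positivity)).symm
    _ = _ := by
        rw [integral_const_mul, mul_right_comm, ENNReal.ofReal_mul (by positivity)]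
        rfl

lemma integrable_fourier_of_smooth {σ : Space → ℂ} (hσ : ContDiff ℝ ∞ σ)
    (hc : HasCompactSupport σ) : Integrable (𝓕 σ) := by
  have := (𝓕 (hc.toSchwartzMap hσ)).integrable (μ := volume)
  rwa [SchwartzMap.fourier_coe] at this

/-- A smooth cutoff to an annulus. -/
lemma exists_annulus_cutoff {c : ℝ} (hc : 1 ≤ c) : ∃ χ : Space → ℝ, ContDiff ℝ ∞ χ ∧
    HasCompactSupport χ ∧ (∀ η, freq η ∈ Icc c⁻¹ c → χ η = 1) ∧ (∀ᶠ η in nhds 0, χ η = 0) := by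
  have hc0 : 0 < c := by linarith
  let f₁ : ContDiffBump (0 : Space) := ⟨c, c + 1, hc0, by linarith⟩
  have hpi : 0 < c⁻¹ / (2 * Real.pi) := by positivity
  let f₂ : ContDiffBump (0 : Space) := ⟨c⁻¹ / (2 * Real.pi) / 2, c⁻¹ / (2 * Real.pi),
    by positivity, by linarith⟩
  refine ⟨fun η => f₁ η * (1 - f₂ η), f₁.contDiff.mul (contDiff_const.sub f₂.contDiff),
    f₁.hasCompactSupport.mul_right, fun η hη => ?_, ?_⟩
  · have hη1 : 2 * Real.pi * ‖η‖ ≤ c := hη.2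
    have hη2 : c⁻¹ ≤ 2 * Real.pi * ‖η‖ := hη.1
    have h1 : f₁ η = 1 := f₁.one_of_mem_closedBall (by
      rw [mem_closedBall_zero_iff]
      have h2 : 1 ≤ 2 * Real.pi := by linarith [Real.two_le_pi]
      change ‖η‖ ≤ c
      nlinarith [norm_nonneg η])
    have h2 : f₂ η = 0 := f₂.zero_of_le_dist (by
      rw [dist_zero_right]
      change c⁻¹ / (2 * Real.pi) ≤ ‖η‖
      rw [div_le_iff₀ (by positivity)]
      linarith)
    simp [h1, h2]
  · filter_upwards [f₂.eventuallyEq_one] with η hη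
    simp [hη]

/-- Functions of `|ξ|` that are smooth away from the origin become smooth after cutting off. -/
lemma contDiff_cutoff_mul {χ : Space → ℝ} (hχ : ContDiff ℝ ∞ χ) (h0 : ∀ᶠ η in nhds 0, χ η = 0)
    {b : ℝ → ℝ} (hb : ContDiffOn ℝ ∞ b (Ioi 0)) : ContDiff ℝ ∞ fun η => χ η * b (freq η) := by
  rw [contDiff_iff_contDiffAt]
  intro η
  rcases eq_or_ne η 0 with rfl | hη
  · refine (contDiffAt_const (c := (0 : ℝ))).congr_of_eventuallyEq ?_
    filter_upwards [h0] with ζ hζ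
    simp [hζ]
  · have hpos : 0 < freq η := by unfold freq; positivity
    refine hχ.contDiffAt.mul ?_
    refine (hb.contDiffAt (Ioi_mem_nhds hpos)).comp η ?_
    unfold freq
    exact contDiffAt_const.mul (contDiffAt_norm ℝ hη)

lemma exists_iteratedFDeriv_bound {f : Space → ℝ} (hf : ContDiff ℝ ∞ f)
    (hc : HasCompactSupport f) (N : ℕ) :
    ∃ D : ℝ, 1 ≤ D ∧ ∀ n ≤ N, ∀ η, ‖iteratedFDeriv ℝ n f η‖ ≤ D := by
  have h : ∀ n : ℕ, ∃ D : ℝ, ∀ η, ‖iteratedFDeriv ℝ n f η‖ ≤ D := fun n =>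
    (hf.continuous_iteratedFDeriv (by exact_mod_cast le_top)).bounded_above_of_compact_support
      (hc.iteratedFDeriv n)
  choose D hD using h
  refine ⟨1 + ∑ n ∈ Finset.range (N + 1), |D n|, ?_, fun n hn η => ?_⟩
  · have := Finset.sum_nonneg (s := Finset.range (N + 1)) (fun n _ => abs_nonneg (D n))
    linarith
  · have h1 : |D n| ≤ ∑ n ∈ Finset.range (N + 1), |D n| :=
      Finset.single_le_sum (f := fun n => |D n|) (fun n _ => abs_nonneg (D n))
        (Finset.mem_range.2 (by omega))
    linarith [hD n η, le_abs_self (D n)]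

/-- Smooth functions all of whose derivatives are bounded by `1`, such as `sin` and `cos`. -/
structure IsWave (g : ℝ → ℝ) : Prop where
  contDiff : ContDiff ℝ ∞ g
  bound : ∀ n x, |iteratedDeriv n g x| ≤ 1

lemma isWave_cos : IsWave Real.cos := ⟨Real.contDiff_cos, Real.abs_iteratedDeriv_cos_le_one⟩

lemma isWave_sin : IsWave Real.sin := ⟨Real.contDiff_sin, Real.abs_iteratedDeriv_sin_le_one⟩

/-- Derivatives of the composite with the phase cost at most one factor 1 + |s| per order (Faà di
Bruno), and Leibniz distributes derivatives over the product. As the derivatives of g are bounded by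
1, one M serves every g. -/
lemma exists_oscillating_symbol_bound {B ρ : Space → ℝ} (hB : ContDiff ℝ ∞ B)
    (hBc : HasCompactSupport B) (hρ : ContDiff ℝ ∞ ρ) (hρc : HasCompactSupport ρ) :
    ∃ M : ℝ, 0 ≤ M ∧ ∀ g : ℝ → ℝ, IsWave g → ∀ s : ℝ, ∀ n ≤ 5, ∀ η,
      ‖iteratedFDeriv ℝ n (fun η => ((B η * g (s * ρ η) : ℝ) : ℂ)) η‖ ≤ M * (1 + |s|) ^ 5 := by
  obtain ⟨D, hD1, hD⟩ := exists_iteratedFDeriv_bound hB hBc 5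
  obtain ⟨E, hE1, hE⟩ := exists_iteratedFDeriv_bound hρ hρc 5
  refine ⟨2 ^ 5 * (D * (Nat.factorial 5 * E ^ 5)), by positivity, fun g hg s n hn η => ?_⟩
  have hsρ : ContDiff ℝ ∞ fun η => s * ρ η := contDiff_const.mul hρ
  have hs1 : 1 ≤ 1 + |s| := by linarith [abs_nonneg s]
  have hA : ∀ m ≤ 5, ‖iteratedFDeriv ℝ m (g ∘ fun η => s * ρ η) η‖ ≤
      Nat.factorial 5 * E ^ 5 * (1 + |s|) ^ 5 := by
    intro m hm
    have := norm_iteratedFDeriv_comp_le (𝕜 := ℝ) (n := m) hg.contDiff hsρ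
      (by exact_mod_cast le_top) η (C := 1) (D := E * (1 + |s|))
      (fun i _ => by
        rw [norm_iteratedFDeriv_eq_norm_iteratedDeriv]; exact hg.bound i _)
      (fun i hi him => by
        have e : iteratedFDeriv ℝ i (fun η => s * ρ η) η = s • iteratedFDeriv ℝ i ρ η :=
          iteratedFDeriv_const_smul_apply (a := s)
            (hρ.of_le (by exact_mod_cast le_top)).contDiffAt
        rw [e, norm_smul, Real.norm_eq_abs]
        calc |s| * ‖iteratedFDeriv ℝ i ρ η‖ ≤ (1 + |s|) * E := by
              gcongr
              · linarith
              · exact hE i (him.trans hm) η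
          _ = E * (1 + |s|) := mul_comm _ _
          _ ≤ (E * (1 + |s|)) ^ i :=
              le_self_pow₀ (one_le_mul_of_one_le_of_one_le hE1 hs1) (by omega))
    refine this.trans ?_
    rw [mul_one, mul_assoc, ← mul_pow]
    have h1 : 1 ≤ E * (1 + |s|) := one_le_mul_of_one_le_of_one_le hE1 hs1
    gcongr
  have hcomp : ContDiff ℝ ∞ (g ∘ fun η => s * ρ η) := hg.contDiff.comp hsρ
  have e1 : iteratedFDeriv ℝ n (fun η => ((B η * g (s * ρ η) : ℝ) : ℂ)) η =
      iteratedFDeriv ℝ n (Complex.ofRealLI ∘ fun η => B η * (g ∘ fun η => s * ρ η) η) η := rfl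
  rw [e1, Complex.ofRealLI.norm_iteratedFDeriv_comp_left (hB.mul hcomp).contDiffAt
    (by exact_mod_cast le_top)]
  refine (norm_iteratedFDeriv_mul_le hB hcomp η (by exact_mod_cast le_top)).trans ?_
  calc ∑ i ∈ Finset.range (n + 1), (n.choose i : ℝ) * ‖iteratedFDeriv ℝ i B η‖ *
        ‖iteratedFDeriv ℝ (n - i) (g ∘ fun η => s * ρ η) η‖
      ≤ ∑ i ∈ Finset.range (n + 1), (n.choose i : ℝ) * D *
        (Nat.factorial 5 * E ^ 5 * (1 + |s|) ^ 5) := by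
        gcongr with i hi
        · exact hD i (by have := Finset.mem_range.1 hi; omega) η
        · exact hA _ (by omega)
    _ = 2 ^ n * (D * (Nat.factorial 5 * E ^ 5 * (1 + |s|) ^ 5)) := by
        have h2 : (2 : ℝ) ^ n = ∑ i ∈ Finset.range (n + 1), (n.choose i : ℝ) := by
          exact_mod_cast (Nat.sum_range_choose n).symm
        rw [h2, Finset.sum_mul]
        exact Finset.sum_congr rfl fun _ _ => by ring
    _ ≤ 2 ^ 5 * (D * (Nat.factorial 5 * E ^ 5 * (1 + |s|) ^ 5)) := by
        gcongr
        norm_num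
    _ = _ := by ring

/-- Oscillating radial multipliers are bounded on frequency localized functions in `L^q`, with
polynomial growth in the oscillation parameter. -/
lemma exists_multiplier_bound {c : ℝ} (hc : 1 ≤ c) {b : ℝ → ℝ} (hb : ContDiffOn ℝ ∞ b (Ioi 0)) :
    ∃ C : ℝ≥0, ∀ g : ℝ → ℝ, IsWave g → ∀ (s : ℝ) (k : ℤ) (f h : L2), FreqLocalized c k f →
      (∀ᵐ ζ : Space ∂volume, (𝓕 h : L2) ζ =
        ((b (freq ζ / 2 ^ k) * g (s * (freq ζ / 2 ^ k)) : ℝ) : ℂ) * (𝓕 f : L2) ζ) →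
      ∀ q : ℝ≥0∞, 1 ≤ q →
        eLpNorm h q volume ≤ C * ENNReal.ofReal ((1 + |s|) ^ 5) * eLpNorm f q volume := by
  obtain ⟨χ, hχ, hχc, hχ1, hχ0⟩ := exists_annulus_cutoff hc
  set B : Space → ℝ := fun η => χ η * b (freq η) with hBdef
  -- The phase is cut off as well as the amplitude, since |η| is not smooth at the origin; on the
  -- rescaled band the cutoff is 1 and changes nothing.
  set ρ : Space → ℝ := fun η => χ η * freq η with hρdef
  have hB : ContDiff ℝ ∞ B := contDiff_cutoff_mul hχ hχ0 hb
  have hBc : HasCompactSupport B := hχc.mul_right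
  have hρ : ContDiff ℝ ∞ ρ := contDiff_cutoff_mul hχ hχ0 (b := id) contDiff_id.contDiffOn
  have hρc : HasCompactSupport ρ := hχc.mul_right
  obtain ⟨C, hC⟩ := exists_lintegral_fourier_le hBc.isCompact
  obtain ⟨M, hM0, hM⟩ := exists_oscillating_symbol_bound hB hBc hρ hρc
  refine ⟨C * M.toNNReal, fun g hg s k f h hf hfh q hq => ?_⟩
  set σ : Space → ℂ := fun η => ((B η * g (s * ρ η) : ℝ) : ℂ) with hσdef
  have hσ : ContDiff ℝ ∞ σ := Complex.ofRealCLM.contDiff.comp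
    (hB.mul (hg.contDiff.comp (contDiff_const.mul hρ)))
  have hsub : Function.support σ ⊆ Function.support B := by
    intro η hη h0
    exact hη (by simp [hσdef, h0])
  have hσc : HasCompactSupport σ := hBc.mono hsub
  have h1 := hC σ (M * (1 + |s|) ^ 5) hσ (closure_mono hsub) (by positivity)
    fun n hn η => hM g hg s n hn η
  have h2 := eLpNorm_le_of_symbol hσ.continuous (hσ.continuous.integrable_of_hasCompactSupport hσc)
    (integrable_fourier_of_smooth hσ hσc) (f := f) (h := h) (hf.integrable_fourier hc)
    ((2 : ℝ) ^ (-k)) (by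
      filter_upwards [hfh, freqLocalized_iff.1 hf] with ζ e1 e2
      rw [e1]
      by_cases hζ : (𝓕 f : L2) ζ = 0
      · simp [hζ]
      congr 1
      have hfr : freq ((2 : ℝ) ^ (-k) • ζ) = freq ζ / 2 ^ k := by
        unfold freq
        rw [norm_smul, zpow_neg, norm_inv, Real.norm_of_nonneg (by positivity)]
        field_simp
      have h2k : (0 : ℝ) < 2 ^ k := by positivity
      have hmem : freq ((2 : ℝ) ^ (-k) • ζ) ∈ Icc c⁻¹ c := by
        rw [hfr]
        obtain ⟨h3, h4⟩ : freq ζ ∈ band c k := e2 hζ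
        exact ⟨(le_div_iff₀ h2k).2 h3, (div_le_iff₀ h2k).2 h4⟩
      have hχe := hχ1 _ hmem
      simp only [hσdef, hBdef, hρdef, hχe, hfr, one_mul]) hq
  refine h2.trans ?_
  gcongr
  refine h1.trans (le_of_eq ?_)
  rw [ENNReal.ofReal_mul hM0, ← mul_assoc]
  rfl

end SymbolEstimates

/-! ### The wave propagators on an annulus and their time derivatives. -/

section WaveOperators

/-- Mean value inequality for z ↦ cos z + (z - y) sin y, whose derivative sin y - sin z is at most
|x - y| between the two points. -/
lemma abs_cos_sub_le (x y : ℝ) : |Real.cos x - Real.cos y + (x - y) * Real.sin y| ≤ (x - y) ^ 2 := by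
  have h := (convex_uIcc y x).norm_image_sub_le_of_norm_hasDerivWithin_le
    (f := fun z => Real.cos z + (z - y) * Real.sin y)
    (f' := fun z => -Real.sin z + 1 * Real.sin y) (C := |x - y|)
    (fun z _ => ((Real.hasDerivAt_cos z).add
      (((hasDerivAt_id z).sub_const y).mul_const _)).hasDerivWithinAt)
    (fun z hz => by
      have h1 := Real.abs_sin_sub_sin_le z y
      have h2 := abs_sub_left_of_mem_uIcc hz
      rw [Real.norm_eq_abs, one_mul, neg_add_eq_sub, abs_sub_comm]
      exact h1.trans h2) left_mem_uIcc right_mem_uIcc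
  rw [Real.norm_eq_abs, Real.norm_eq_abs, abs_mul_abs_self, ← sq] at h
  refine le_trans (le_of_eq ?_) h
  congr 1; ring

lemma abs_sin_sub_le (x y : ℝ) : |Real.sin x - Real.sin y - (x - y) * Real.cos y| ≤ (x - y) ^ 2 := by
  have h := (convex_uIcc y x).norm_image_sub_le_of_norm_hasDerivWithin_le
    (f := fun z => Real.sin z - (z - y) * Real.cos y)
    (f' := fun z => Real.cos z - 1 * Real.cos y) (C := |x - y|)
    (fun z _ => ((Real.hasDerivAt_sin z).sub
      (((hasDerivAt_id z).sub_const y).mul_const _)).hasDerivWithinAt)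
    (fun z hz => by
      have h1 := Real.abs_cos_sub_cos_le z y
      have h2 := abs_sub_left_of_mem_uIcc hz
      rw [Real.norm_eq_abs, one_mul]
      exact h1.trans h2) left_mem_uIcc right_mem_uIcc
  rw [Real.norm_eq_abs, Real.norm_eq_abs, abs_mul_abs_self, ← sq] at h
  refine le_trans (le_of_eq ?_) h
  congr 1; ring

variable {c : ℝ} {k : ℤ}

lemma isSymbol_cos (t : ℝ) : IsSymbol fun r => Real.cos (t * r) :=
  isSymbol_of_continuous (by fun_prop)

lemma isSymbol_sin (t : ℝ) : IsSymbol fun r => r⁻¹ * Real.sin (t * r) :=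
  isSymbol_inv.mul (isSymbol_of_continuous (by fun_prop))

lemma isSymbol_dcos (t : ℝ) : IsSymbol fun r => -(r * Real.sin (t * r)) :=
  isSymbol_of_continuous (by fun_prop)

lemma bandOp_congr {σ τ : ℝ → ℝ} (hc : 1 ≤ c) (h : ∀ r, 0 < r → σ r = τ r) :
    bandOp c k σ = bandOp c k τ := by
  unfold bandOp
  congr 1
  ext ζ
  by_cases hζ : ζ ∈ annulus c k
  · simp [bandSymbol, hζ, h _ (band_pos hc hζ)]
  · simp [bandSymbol, hζ]

/-- `cos(t|D|)` on an annulus. -/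
def cosOp (c : ℝ) (k : ℤ) (t : ℝ) : L2 →L[ℂ] L2 := bandOp c k fun r => Real.cos (t * r)

/-- `sin(t|D|)/|D|` on an annulus. -/
def sinOp (c : ℝ) (k : ℤ) (t : ℝ) : L2 →L[ℂ] L2 := bandOp c k fun r => r⁻¹ * Real.sin (t * r)

/-- `-|D| sin(t|D|)` on an annulus. -/
def dcosOp (c : ℝ) (k : ℤ) (t : ℝ) : L2 →L[ℂ] L2 := bandOp c k fun r => -(r * Real.sin (t * r))

/-- The Laplacian on an annulus. -/
def lapOp (c : ℝ) (k : ℤ) : L2 →L[ℂ] L2 := bandOp c k fun r => -r ^ 2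

lemma hasDerivAt_cosOp (hc : 1 ≤ c) (t : ℝ) :
    HasDerivAt (cosOp c k) (dcosOp c k t) t := by
  refine hasDerivAt_bandOp hc isSymbol_cos (isSymbol_dcos t) (B := (c * 2 ^ k) ^ 2)
    fun s r hr => ?_
  have h := abs_cos_sub_le (s * r) (t * r)
  have hr0 := band_pos hc hr
  have hr1 : r ≤ c * 2 ^ k := hr.2
  calc |Real.cos (s * r) - Real.cos (t * r) - (s - t) * -(r * Real.sin (t * r))|
      = |Real.cos (s * r) - Real.cos (t * r) + (s * r - t * r) * Real.sin (t * r)| := by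
        congr 1; ring
    _ ≤ (s * r - t * r) ^ 2 := h
    _ = r ^ 2 * (s - t) ^ 2 := by ring
    _ ≤ _ := by gcongr

lemma hasDerivAt_sinOp (hc : 1 ≤ c) (t : ℝ) :
    HasDerivAt (sinOp c k) (cosOp c k t) t := by
  refine hasDerivAt_bandOp hc isSymbol_sin (isSymbol_cos t) (B := c * 2 ^ k)
    fun s r hr => ?_
  have h := abs_sin_sub_le (s * r) (t * r)
  have hr0 := band_pos hc hr
  have hr1 : r ≤ c * 2 ^ k := hr.2
  calc |r⁻¹ * Real.sin (s * r) - r⁻¹ * Real.sin (t * r) - (s - t) * Real.cos (t * r)|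
      = r⁻¹ * |Real.sin (s * r) - Real.sin (t * r) - (s * r - t * r) * Real.cos (t * r)| := by
        rw [← abs_of_pos (inv_pos.2 hr0), ← abs_mul, abs_of_pos (inv_pos.2 hr0)]
        congr 1; field_simp
    _ ≤ r⁻¹ * (s * r - t * r) ^ 2 := by gcongr
    _ = r * (s - t) ^ 2 := by field_simp
    _ ≤ _ := by gcongr

/-- Factoring -r sin(tr) as -r² · r⁻¹ sin(tr) reduces the norm continuity of `dcosOp` to that of
`sinOp`. -/
lemma dcosOp_eq (hc : 1 ≤ c) (t : ℝ) : dcosOp c k t = lapOp c k ∘L sinOp c k t := by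
  ext1 f
  rw [ContinuousLinearMap.comp_apply, lapOp, sinOp,
    bandOp_bandOp hc (isSymbol_of_continuous (by fun_prop)) (isSymbol_sin t), dcosOp]
  refine congrArg (· f) (bandOp_congr hc fun r hr => ?_)
  field_simp

lemma continuous_cosOp (hc : 1 ≤ c) : Continuous (cosOp c k) :=
  continuous_iff_continuousAt.2 fun t => (hasDerivAt_cosOp hc t).continuousAt

lemma continuous_sinOp (hc : 1 ≤ c) : Continuous (sinOp c k) :=
  continuous_iff_continuousAt.2 fun t => (hasDerivAt_sinOp hc t).continuousAt

lemma continuous_dcosOp (hc : 1 ≤ c) : Continuous (dcosOp c k) := by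
  have : dcosOp c k = fun t => lapOp c k ∘L sinOp c k t := funext (dcosOp_eq hc)
  rw [this]
  exact continuous_const.clm_comp (continuous_sinOp hc)

lemma cosOp_zero : cosOp c k 0 = proj c k := by
  simp [cosOp, proj]

lemma sinOp_zero (hc : 1 ≤ c) : sinOp c k 0 = 0 :=
  bandOp_eq_zero hc (isSymbol_sin 0) fun r _ => by simp

lemma dcosOp_zero (hc : 1 ≤ c) : dcosOp c k 0 = 0 :=
  bandOp_eq_zero hc (isSymbol_dcos 0) fun r _ => by simp

/-- The symbols t sinc(tr) and r⁻¹ sin(tr) agree for r > 0, and only such r occur in the band. -/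
lemma freeWave_eq (hc : 1 ≤ c) {f g : L2} (hf : FreqLocalized c k f) (hg : FreqLocalized c k g)
    (t : ℝ) : freeWave t f g = cosOp c k t f + sinOp c k t g := by
  have h : IsSymbol fun r => t * Real.sinc (t * r) := isSymbol_of_continuous
    (continuous_const.mul (Real.continuous_sinc.comp (by fun_prop)))
  rw [freeWave, radialMultiplier_eq_bandOp hc (isSymbol_cos t) hf,
    radialMultiplier_eq_bandOp hc h hg, sinOp]
  congr 2
  refine bandOp_congr hc fun r hr => ?_
  rcases eq_or_ne t 0 with rfl | ht
  · simp
  · rw [Real.sinc_of_ne_zero (mul_ne_zero ht hr.ne')]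
    field_simp

end WaveOperators

/-! ### The nearest point map of a closed interval. -/

section NearestPoint

variable {I : Set ℝ}

open scoped Classical in
/-- The point of the closed interval `I` nearest to `t`. -/
def nearest (I : Set ℝ) (t : ℝ) : ℝ := if t ∈ I then t else nearEndpoint I t

lemma nearest_of_mem {t : ℝ} (ht : t ∈ I) : nearest I t = t := if_pos ht

/-- In a closed set a finite supremum or infimum is attained. A time outside I with a point of I
above it lies below all of I, because I is order-connected. -/
lemma nearest_cases (hI : I.OrdConnected) (hIc : IsClosed I) (hne : I.Nonempty) (t : ℝ) :
    (t ∈ I ∧ nearest I t = t) ∨ (IsGreatest I (nearest I t) ∧ nearest I t < t) ∨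
      (IsLeast I (nearest I t) ∧ t < nearest I t) := by
  by_cases ht : t ∈ I
  · exact Or.inl ⟨ht, nearest_of_mem ht⟩
  right
  rw [nearest, if_neg ht, nearEndpoint]
  by_cases h : ∀ s ∈ I, s ≤ t
  · left
    rw [if_pos h]
    have hg : IsGreatest I (sSup I) :=
      ⟨hIc.csSup_mem hne ⟨t, h⟩, fun s hs => le_csSup ⟨t, h⟩ hs⟩
    exact ⟨hg, lt_of_le_of_ne (h _ hg.1) fun e => ht (e ▸ hg.1)⟩
  · right
    rw [if_neg h]
    push Not at h
    obtain ⟨s, hs, hts⟩ := h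
    have hlow : t ∈ lowerBounds I := fun u hu => by
      by_contra hut
      exact ht (hI.out hu hs ⟨(not_le.1 hut).le, hts.le⟩)
    have hl : IsLeast I (sInf I) :=
      ⟨hIc.csInf_mem hne ⟨t, hlow⟩, fun s hs => csInf_le ⟨t, hlow⟩ hs⟩
    exact ⟨hl, lt_of_le_of_ne (hlow hl.1) fun e => ht (e ▸ hl.1)⟩

lemma nearest_mem (hI : I.OrdConnected) (hIc : IsClosed I) (hne : I.Nonempty) (t : ℝ) :
    nearest I t ∈ I := by
  rcases nearest_cases hI hIc hne t with h | h | h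
  · rw [h.2]; exact h.1
  · exact h.1.1
  · exact h.1.1

lemma nearest_eq_of_isGreatest (hI : I.OrdConnected) (hIc : IsClosed I) {a t : ℝ}
    (ha : IsGreatest I a) (hat : a < t) : nearest I t = a := by
  rcases nearest_cases hI hIc ⟨a, ha.1⟩ t with h | h | h
  · exact absurd (ha.2 h.1) (not_le.2 hat)
  · exact h.1.unique ha
  · have := h.1.2 ha.1; linarith [h.2]

lemma nearest_eq_of_isLeast (hI : I.OrdConnected) (hIc : IsClosed I) {a t : ℝ}
    (ha : IsLeast I a) (hat : t < a) : nearest I t = a := by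
  rcases nearest_cases hI hIc ⟨a, ha.1⟩ t with h | h | h
  · exact absurd (ha.2 h.1) (not_le.2 hat)
  · have := h.1.2 ha.1; linarith [h.2]
  · exact h.1.unique ha

lemma abs_sub_nearest_le (hI : I.OrdConnected) (hIc : IsClosed I) (hne : I.Nonempty) (t : ℝ) :
    |t - nearest I t| ≤ Metric.infDist t I := by
  refine (Metric.le_infDist hne).2 fun s hs => ?_
  rw [Real.dist_eq]
  rcases nearest_cases hI hIc hne t with h | h | h
  · simp [h.2]
  · have := h.1.2 hs
    rw [abs_of_pos (by linarith [h.2]), abs_of_pos (by linarith [h.2])]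
    linarith
  · have := h.1.2 hs
    rw [abs_of_neg (by linarith [h.2]), abs_of_neg (by linarith [h.2])]
    linarith

/-- The map is nondecreasing and its increments never exceed those of t, so it is 1-Lipschitz. -/
lemma continuous_nearest (hI : I.OrdConnected) (hIc : IsClosed I) (hne : I.Nonempty) :
    Continuous (nearest I) := by
  have key : ∀ s t, s ≤ t → nearest I s ≤ nearest I t ∧ nearest I t - nearest I s ≤ t - s := by
    intro s t hst
    have hs' := nearest_mem hI hIc hne s
    have ht' := nearest_mem hI hIc hne t
    rcases nearest_cases hI hIc hne s with h | h | h <;>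
    rcases nearest_cases hI hIc hne t with h' | h' | h'
    · rw [h.2, h'.2]; exact ⟨hst, le_rfl⟩
    · have := h'.1.2 hs'; constructor <;> linarith [h.2, h'.2]
    · have := h'.1.2 hs'; have := h'.1.2 h.1; constructor <;> linarith [h.2, h'.2]
    · have := h.1.2 ht'; have := h.1.2 h'.1; constructor <;> linarith [h.2, h'.2]
    · rw [h.1.unique h'.1]; constructor <;> linarith
    · have := h.1.2 ht'; have := h'.1.2 hs'; constructor <;> linarith [h.2, h'.2]
    · have := h.1.2 ht'; constructor <;> linarith [h.2, h'.2]
    · have := h.1.2 ht'; have := h'.1.2 hs'; constructor <;> linarith [h.2, h'.2]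
    · rw [h.1.unique h'.1]; constructor <;> linarith
  refine (LipschitzWith.of_dist_le_mul (K := 1) fun s t => ?_).continuous
  rw [NNReal.coe_one, one_mul, Real.dist_eq, Real.dist_eq]
  rcases le_total s t with h | h
  · have := key s t h
    rw [abs_of_nonpos (by linarith), abs_of_nonpos (by linarith)]
    linarith
  · have := key t s h
    rw [abs_of_nonneg (by linarith), abs_of_nonneg (by linarith)]
    linarith

end NearestPoint

/-! ### Regularity of the extension. -/

section Extension

variable {c : ℝ} {k : ℤ} {I : Set ℝ} {φ : ℝ → L2}

lemma uniqueDiffOn_of_nontrivial (hI : I.OrdConnected) (hne : I.Nontrivial) :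
    UniqueDiffOn ℝ I := by
  refine uniqueDiffOn_convex hI.convex ?_
  obtain ⟨a, ha, b, hb, hab⟩ := hne.exists_lt
  exact ⟨(a + b) / 2, mem_interior.2 ⟨Ioo a b, fun x hx => hI.out ha hb (Ioo_subset_Icc_self hx),
    isOpen_Ioo, ⟨by linarith, by linarith⟩⟩⟩

/-- Differentiating φ = Pφ within I, with P the bounded sharp projection, and uniqueness of the
derivative give φ' = Pφ'. -/
lemma freqLocalized_derivWithin (hc : 1 ≤ c) (hu : UniqueDiffOn ℝ I) (hφ : ContDiffOn ℝ 1 φ I)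
    (hloc : ∀ t ∈ I, FreqLocalized c k (φ t)) {t : ℝ} (ht : t ∈ I) :
    FreqLocalized c k (derivWithin φ I t) := by
  rw [freqLocalized_iff_proj hc]
  have h1 : HasDerivWithinAt φ (derivWithin φ I t) I t :=
    (hφ.differentiableOn one_ne_zero t ht).hasDerivWithinAt
  have h2 : HasDerivWithinAt (fun s => proj c k (φ s)) (proj c k (derivWithin φ I t)) I t :=
    ((proj c k).restrictScalars ℝ).hasFDerivAt.comp_hasDerivWithinAt t h1
  have h3 : HasDerivWithinAt φ (proj c k (derivWithin φ I t)) I t :=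
    h2.congr (fun s hs => ((hloc s hs).proj_eq hc).symm) ((hloc t ht).proj_eq hc).symm
  exact (hu t ht).eq_deriv _ h3 h1

/-- The velocity of the extension by homogeneous waves. -/
def waveVelocity (c : ℝ) (k : ℤ) (I : Set ℝ) (φ : ℝ → L2) (t : ℝ) : L2 :=
  dcosOp c k (t - nearest I t) (φ (nearest I t)) +
    cosOp c k (t - nearest I t) (derivWithin φ I (nearest I t))

/-- On I the elapsed time is 0, where the cosine is the projection, hence the identity on localized
functions, and the sine vanishes. One formula therefore holds inside and outside I, and continuity
across the endpoints comes from the nearest point map. -/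
lemma waveExtension_eq (hc : 1 ≤ c) (hI : I.OrdConnected) (hIc : IsClosed I) (hne : I.Nontrivial)
    (hφ : ContDiffOn ℝ 1 φ I) (hloc : ∀ t ∈ I, FreqLocalized c k (φ t)) (t : ℝ) :
    waveExtension I φ t = cosOp c k (t - nearest I t) (φ (nearest I t)) +
      sinOp c k (t - nearest I t) (derivWithin φ I (nearest I t)) := by
  by_cases ht : t ∈ I
  · rw [waveExtension, if_pos ht, nearest_of_mem ht, sub_self, cosOp_zero, sinOp_zero hc,
      (hloc t ht).proj_eq hc]
    simp
  · have hn : nearest I t = nearEndpoint I t := if_neg ht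
    have hm := nearest_mem hI hIc hne.nonempty t
    rw [waveExtension, if_neg ht, ← hn]
    exact freeWave_eq hc (hloc _ hm)
      (freqLocalized_derivWithin hc (uniqueDiffOn_of_nontrivial hI hne) hφ hloc hm) _

lemma waveVelocity_of_mem (hc : 1 ≤ c) (hI : I.OrdConnected) (hne : I.Nontrivial)
    (hφ : ContDiffOn ℝ 1 φ I) (hloc : ∀ t ∈ I, FreqLocalized c k (φ t)) {t : ℝ} (ht : t ∈ I) :
    waveVelocity c k I φ t = derivWithin φ I t := by
  rw [waveVelocity, nearest_of_mem ht, sub_self, cosOp_zero, dcosOp_zero hc,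
    (freqLocalized_derivWithin hc (uniqueDiffOn_of_nontrivial hI hne) hφ hloc ht).proj_eq hc]
  simp

lemma continuous_waveVelocity (hc : 1 ≤ c) (hI : I.OrdConnected) (hIc : IsClosed I)
    (hne : I.Nontrivial) (hφ : ContDiffOn ℝ 1 φ I) : Continuous (waveVelocity c k I φ) := by
  have hn := continuous_nearest hI hIc hne.nonempty
  have hm := nearest_mem hI hIc hne.nonempty
  have hτ : Continuous fun t => t - nearest I t := continuous_id.sub hn
  refine (((continuous_dcosOp hc).comp hτ).clm_apply
    (hφ.continuousOn.comp_continuous hn hm)).add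
    (((continuous_cosOp hc).comp hτ).clm_apply
      ((hφ.continuousOn_derivWithin (uniqueDiffOn_of_nontrivial hI hne) le_rfl).comp_continuous
        hn hm))

lemma continuous_waveExtension (hc : 1 ≤ c) (hI : I.OrdConnected) (hIc : IsClosed I)
    (hne : I.Nontrivial) (hφ : ContDiffOn ℝ 1 φ I)
    (hloc : ∀ t ∈ I, FreqLocalized c k (φ t)) : Continuous (waveExtension I φ) := by
  have hn := continuous_nearest hI hIc hne.nonempty
  have hm := nearest_mem hI hIc hne.nonempty
  have hτ : Continuous fun t => t - nearest I t := continuous_id.sub hn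
  rw [funext (waveExtension_eq hc hI hIc hne hφ hloc)]
  refine (((continuous_cosOp hc).comp hτ).clm_apply
    (hφ.continuousOn.comp_continuous hn hm)).add
    (((continuous_sinOp hc).comp hτ).clm_apply
      ((hφ.continuousOn_derivWithin (uniqueDiffOn_of_nontrivial hI hne) le_rfl).comp_continuous
        hn hm))

/-- As long as the nearest point is constant, the extension is one fixed free wave, differentiated
through its propagators. -/
lemma hasDerivAt_waveExtension_of_eventually (hc : 1 ≤ c) (hI : I.OrdConnected)
    (hIc : IsClosed I) (hne : I.Nontrivial) (hφ : ContDiffOn ℝ 1 φ I)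
    (hloc : ∀ t ∈ I, FreqLocalized c k (φ t)) {t : ℝ}
    (h : ∀ᶠ s in nhds t, nearest I s = nearest I t) :
    HasDerivAt (waveExtension I φ) (waveVelocity c k I φ t) t := by
  set a := nearest I t with ha
  have h1 : HasDerivAt (fun s => cosOp c k (s - a) (φ a) + sinOp c k (s - a) (derivWithin φ I a))
      (dcosOp c k (t - a) (φ a) + cosOp c k (t - a) (derivWithin φ I a)) t := by
    refine HasDerivAt.add ?_ ?_
    · have := ((ContinuousLinearMap.apply ℂ L2 (φ a)).restrictScalars ℝ).hasFDerivAt.comp_hasDerivAt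
        t ((hasDerivAt_cosOp (k := k) hc (t - a)).comp_sub_const t a)
      exact this
    · have := ((ContinuousLinearMap.apply ℂ L2
        (derivWithin φ I a)).restrictScalars ℝ).hasFDerivAt.comp_hasDerivAt
        t ((hasDerivAt_sinOp (k := k) hc (t - a)).comp_sub_const t a)
      exact this
  refine h1.congr_of_eventuallyEq ?_
  filter_upwards [h] with s hs
  rw [waveExtension_eq hc hI hIc hne hφ hloc, hs]

/-- The extension by homogeneous waves is differentiable. -/
theorem hasDerivAt_waveExtension (hc : 1 ≤ c) (hI : I.OrdConnected) (hIc : IsClosed I)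
    (hne : I.Nontrivial) (hφ : ContDiffOn ℝ 1 φ I)
    (hloc : ∀ t ∈ I, FreqLocalized c k (φ t)) (t : ℝ) :
    HasDerivAt (waveExtension I φ) (waveVelocity c k I φ t) t := by
  have hv := continuous_waveVelocity (k := k) hc hI hIc hne hφ
  have hw := continuous_waveExtension hc hI hIc hne hφ hloc
  -- Only the endpoints of I, at most two, escape the local arguments. The fundamental theorem with
  -- a countable exceptional set presents the extension as the integral of its continuous velocity,
  -- which is then differentiable at the endpoints too.
  set T : Set ℝ := {t | IsLeast I t} ∪ {t | IsGreatest I t} with hT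
  have hTc : T.Countable := by
    refine Countable.union ?_ ?_ <;> refine Subsingleton.countable ?_
    · exact fun x (hx : IsLeast I x) y (hy : IsLeast I y) => hx.unique hy
    · exact fun x (hx : IsGreatest I x) y (hy : IsGreatest I y) => hx.unique hy
  have hd : ∀ s ∉ T, HasDerivAt (waveExtension I φ) (waveVelocity c k I φ s) s := by
    intro s hs
    rcases nearest_cases hI hIc hne.nonempty s with h | h | h
    · have hsI := h.1
      have hnhds : I ∈ nhds s := by
        have h1 : ¬ IsLeast I s := fun h' => hs (Or.inl h')
        have h2 : ¬ IsGreatest I s := fun h' => hs (Or.inr h')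
        simp only [IsLeast, IsGreatest, hsI, true_and, lowerBounds, upperBounds,
          mem_ofPred_eq, not_forall, not_le] at h1 h2
        obtain ⟨a, ha, has⟩ := h1
        obtain ⟨b, hb, hbs⟩ := h2
        exact Filter.mem_of_superset (Icc_mem_nhds has hbs) (hI.out ha hb)
      rw [waveVelocity_of_mem hc hI hne hφ hloc hsI]
      refine (((hφ.differentiableOn one_ne_zero s hsI).hasDerivWithinAt).hasDerivAt
        hnhds).congr_of_eventuallyEq ?_
      filter_upwards [hnhds] with x hx
      rw [waveExtension, if_pos hx]
    · refine hasDerivAt_waveExtension_of_eventually hc hI hIc hne hφ hloc ?_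
      filter_upwards [Ioi_mem_nhds h.2] with x hx using nearest_eq_of_isGreatest hI hIc h.1 hx
    · refine hasDerivAt_waveExtension_of_eventually hc hI hIc hne hφ hloc ?_
      filter_upwards [Iio_mem_nhds h.2] with x hx using nearest_eq_of_isLeast hI hIc h.1 hx
  have hint : ∀ s, waveExtension I φ s =
      waveExtension I φ 0 + ∫ x in (0 : ℝ)..s, waveVelocity c k I φ x := by
    intro s
    rw [integral_eq_of_hasDerivAt_off_countable _ _ hTc hw.continuousOn
      (fun x hx => hd x hx.2) (hv.intervalIntegrable _ _)]
    abel
  rw [funext hint]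
  exact (intervalIntegral.integral_hasDerivAt_right (hv.intervalIntegrable _ _)
    (hv.stronglyMeasurableAtFilter _ _) hv.continuousAt).const_add _

end Extension

/-! ### Weak second derivatives of scalar functions of time. -/

section WeakDerivative

/-- Real test functions supported in the open interval `(α, β)`. -/
structure IsTest (α β : ℝ) (a : ℝ → ℝ) : Prop where
  smooth : ContDiff ℝ ∞ a
  tsupport_subset : tsupport a ⊆ Ioo α β

variable {α β : ℝ} {a : ℝ → ℝ}

lemma IsTest.hasCompactSupport (h : IsTest α β a) : HasCompactSupport a :=
  isCompact_Icc.of_isClosed_subset (isClosed_tsupport a)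
    (h.tsupport_subset.trans Ioo_subset_Icc_self)

lemma IsTest.support_subset (h : IsTest α β a) : Function.support a ⊆ Ioo α β :=
  (subset_tsupport a).trans h.tsupport_subset

lemma IsTest.left (h : IsTest α β a) : a α = 0 := by
  by_contra h'; exact lt_irrefl _ (h.support_subset h').1

lemma IsTest.right (h : IsTest α β a) : a β = 0 := by
  by_contra h'; exact lt_irrefl _ (h.support_subset h').2

lemma IsTest.deriv (h : IsTest α β a) : IsTest α β (deriv a) :=
  ⟨(contDiff_infty_iff_deriv.1 h.smooth).2,
    (closure_minimal support_deriv_subset (isClosed_tsupport a)).trans h.tsupport_subset⟩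

lemma IsTest.hasDerivAt (h : IsTest α β a) (t : ℝ) : HasDerivAt a (_root_.deriv a t) t :=
  ((contDiff_infty_iff_deriv.1 h.smooth).1 t).hasDerivAt

/-- The primitive from α vanishes before the support of a, and after it equals the total integral,
which is 0. -/
lemma IsTest.exists_primitive (h : IsTest α β a) (h0 : ∫ x, a x = 0) :
    ∃ A, IsTest α β A ∧ _root_.deriv A = a := by
  have hcont := h.smooth.continuous
  have hd : ∀ t, HasDerivAt (fun t => ∫ x in α..t, a x) (a t) t := fun t =>
    intervalIntegral.integral_hasDerivAt_right (hcont.intervalIntegrable _ _)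
      (hcont.stronglyMeasurableAtFilter _ _) hcont.continuousAt
  have hda : _root_.deriv (fun t => ∫ x in α..t, a x) = a := funext fun t => (hd t).deriv
  refine ⟨fun t => ∫ x in α..t, a x, ⟨?_, ?_⟩, hda⟩
  · rw [contDiff_infty_iff_deriv, hda]
    exact ⟨fun t => (hd t).differentiableAt, h.smooth⟩
  rcases (tsupport a).eq_empty_or_nonempty with he | hne
  · have : a = 0 := by rwa [tsupport_eq_empty_iff] at he
    simp [this]
  obtain ⟨α', hα'⟩ := h.hasCompactSupport.isCompact.exists_isLeast hne
  obtain ⟨β', hβ'⟩ := h.hasCompactSupport.isCompact.exists_isGreatest hne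
  have hz : ∀ x, x ∉ Icc α' β' → a x = 0 := by
    intro x hx
    by_contra h'
    exact hx ⟨hα'.2 (subset_tsupport a h'), hβ'.2 (subset_tsupport a h')⟩
  have h1 := (h.tsupport_subset hα'.1).1
  have h2 := (h.tsupport_subset hβ'.1).2
  refine (closure_minimal ?_ isClosed_Icc).trans (Icc_subset_Ioo h1 h2)
  intro t ht
  by_contra hcon
  refine ht ?_
  simp only [mem_Icc, not_and_or, not_le] at hcon
  rcases hcon with hlt | hlt
  · have : ∫ x in α..t, a x = ∫ x in α..t, (0 : ℝ) := by
      refine intervalIntegral.integral_congr fun x hx => hz x fun hx' => ?_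
      have := hx.2
      rcases le_max_iff.1 this with h3 | h3 <;> linarith [hx'.1]
    simpa using this
  · change ∫ x in α..t, a x = 0
    rw [intervalIntegral.integral_eq_integral_of_support_subset, h0]
    intro x hx
    exact ⟨(h.support_subset hx).1, by
      by_contra h'
      exact hx (hz x fun h3 => h' (h3.2.trans hlt.le))⟩

/-- The lemma of du Bois-Reymond for continuous functions. -/
lemma eq_of_integral_deriv_mul_eq_zero (hαβ : α < β) {h : ℝ → ℝ} (hh : ContinuousOn h (Icc α β))
    (hweak : ∀ a, IsTest α β a → ∫ x in α..β, deriv a x * h x = 0) : h α = h β := by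
  let f : ContDiffBump ((α + β) / 2) := ⟨(β - α) / 8, (β - α) / 4, by linarith, by linarith⟩
  set ρ := f.normed volume with hρdef
  have hρ : IsTest α β ρ := by
    refine ⟨f.contDiff_normed, ?_⟩
    rw [f.tsupport_normed_eq, Real.closedBall_eq_Icc]
    change Icc ((α + β) / 2 - (β - α) / 4) ((α + β) / 2 + (β - α) / 4) ⊆ _
    exact Icc_subset_Ioo (by linarith) (by linarith)
  have hρ1 : ∫ x, ρ x = 1 := f.integral_normed
  set C := ∫ x in α..β, ρ x * h x with hC
  have hii : ∀ a, IsTest α β a → IntervalIntegrable (fun x => a x * h x) volume α β := by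
    intro a ha
    refine ContinuousOn.intervalIntegrable ?_
    rw [uIcc_of_le hαβ.le]
    exact ha.smooth.continuous.continuousOn.mul hh
  have key : ∀ b, IsTest α β b → ∫ x in α..β, b x * h x = (∫ x, b x) * C := by
    intro b hb
    -- Removing a multiple of ρ with the same mass leaves mean zero, so B is the derivative of a
    -- test function; hence h pairs with b as the constant C does.
    set B : ℝ → ℝ := fun x => b x - (∫ x, b x) * ρ x with hB
    have hBt : IsTest α β B := by
      refine ⟨hb.smooth.sub (contDiff_const.mul hρ.smooth), ?_⟩
      refine (tsupport_sub b _).trans (union_subset hb.tsupport_subset ?_)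
      exact (closure_mono (Function.support_mul_subset_right _ _)).trans hρ.tsupport_subset
    have hB0 : ∫ x, B x = 0 := by
      rw [integral_sub (hb.smooth.continuous.integrable_of_hasCompactSupport hb.hasCompactSupport)
        ((hρ.smooth.continuous.integrable_of_hasCompactSupport hρ.hasCompactSupport).const_mul _),
        integral_const_mul, hρ1, mul_one, sub_self]
    obtain ⟨A, hA, hAB⟩ := hBt.exists_primitive hB0
    have := hweak A hA
    rw [hAB] at this
    have h2 : ∫ x in α..β, B x * h x =
        (∫ x in α..β, b x * h x) - (∫ x, b x) * ∫ x in α..β, ρ x * h x := by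
      rw [← intervalIntegral.integral_const_mul, ← intervalIntegral.integral_sub (hii b hb)
        ((hii ρ hρ).const_mul _)]
      refine intervalIntegral.integral_congr fun x _ => ?_
      simp only [hB]; ring
    linarith
  have hae : ∀ᵐ x ∂volume, x ∈ Ioo α β → h x - C = 0 := by
    refine isOpen_Ioo.ae_eq_zero_of_integral_contDiff_smul_eq_zero ?_ fun g hg hgc hgs => ?_
    · exact ((hh.mono Ioo_subset_Icc_self).sub continuousOn_const).locallyIntegrableOn
        measurableSet_Ioo
    · have hgt : IsTest α β g := ⟨hg, hgs⟩
      have e1 : ∫ x, g x • (h x - C) = ∫ x in α..β, g x * (h x - C) := by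
        rw [intervalIntegral.integral_eq_integral_of_support_subset]
        · rfl
        · exact (Function.support_mul_subset_left _ _).trans
            (hgt.support_subset.trans Ioo_subset_Ioc_self)
      have e2 : ∫ x in α..β, g x = ∫ x, g x :=
        intervalIntegral.integral_eq_integral_of_support_subset
          (hgt.support_subset.trans Ioo_subset_Ioc_self)
      rw [e1]
      have e3 : ∫ x in α..β, g x * (h x - C) =
          (∫ x in α..β, g x * h x) - ∫ x in α..β, g x * C := by
        rw [← intervalIntegral.integral_sub (hii g hgt)
          ((hg.continuous.intervalIntegrable _ _).mul_const _)]
        refine intervalIntegral.integral_congr fun x _ => ?_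
        ring
      rw [e3, key g hgt, intervalIntegral.integral_mul_const, e2, sub_self]
  have heq : EqOn h (fun _ => C) (Icc α β) := by
    refine Measure.eqOn_Icc_of_ae_eq volume hαβ.ne ?_ hh continuousOn_const
    rw [← Measure.restrict_congr_set Ioo_ae_eq_Icc]
    filter_upwards [ae_restrict_of_ae hae, ae_restrict_mem measurableSet_Ioo] with x h1 h2
    linarith [h1 h2]
  rw [heq (left_mem_Icc.2 hαβ.le), heq (right_mem_Icc.2 hαβ.le)]

/-- A `C¹` function with integrable weak second derivative `G` satisfies the fundamental theorem
of calculus for its first derivative. -/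
lemma deriv_sub_eq_integral_of_weak (hαβ : α < β) {p p' G : ℝ → ℝ}
    (hp : ∀ t ∈ Icc α β, HasDerivWithinAt p (p' t) (Icc α β) t) (hp' : ContinuousOn p' (Icc α β))
    (hG : IntervalIntegrable G volume α β)
    (hweak : ∀ a, IsTest α β a →
      ∫ x in α..β, deriv (deriv a) x * p x = ∫ x in α..β, a x * G x) :
    p' β - p' α = ∫ x in α..β, G x := by
  have hu : uIcc α β = Icc α β := uIcc_of_le hαβ.le
  set P : ℝ → ℝ := fun t => ∫ x in α..t, G x with hP
  have hPac : AbsolutelyContinuousOnInterval P α β :=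
    hG.absolutelyContinuousOnInterval_intervalIntegral left_mem_uIcc
  have hPc : ContinuousOn P (Icc α β) := hu ▸ hPac.continuousOn
  have hpc : ContinuousOn p (Icc α β) := fun t ht => (hp t ht).continuousWithinAt
  -- The difference p' - P has zero weak derivative, hence equal values at α and β; since P α = 0
  -- this is the claim.
  have := eq_of_integral_deriv_mul_eq_zero hαβ (hp'.sub hPc) fun a ha => by
    have e1 : ∫ x in α..β, deriv (deriv a) x * p x = - ∫ x in α..β, deriv a x * p' x := by
      have := intervalIntegral.integral_deriv_mul_eq_sub_of_hasDeriv_right (a := α) (b := β)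
        (u := deriv a) (v := p) (u' := deriv (deriv a)) (v' := p')
        ha.deriv.smooth.continuous.continuousOn (hu ▸ hpc)
        (fun x _ => (ha.deriv.hasDerivAt x).hasDerivWithinAt)
        (fun x hx => by
          rw [min_eq_left hαβ.le, max_eq_right hαβ.le] at hx
          exact ((hp x (Ioo_subset_Icc_self hx)).hasDerivAt
            (Icc_mem_nhds hx.1 hx.2)).hasDerivWithinAt)
        (ha.deriv.deriv.smooth.continuous.intervalIntegrable _ _)
        (ContinuousOn.intervalIntegrable (hu ▸ hp'))
      rw [ha.deriv.left, ha.deriv.right, intervalIntegral.integral_add] at this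
      · linarith
      · exact ContinuousOn.intervalIntegrable
          (ha.deriv.deriv.smooth.continuous.continuousOn.mul (hu ▸ hpc))
      · exact ContinuousOn.intervalIntegrable
          (ha.deriv.smooth.continuous.continuousOn.mul (hu ▸ hp'))
    -- G is merely integrable, so P is only absolutely continuous, and integration by parts is used
    -- in that class.
    have haac : AbsolutelyContinuousOnInterval a α β := by
      have h1 := (ha.deriv.smooth.continuous.intervalIntegrable (μ := volume) α
        β).absolutelyContinuousOnInterval_intervalIntegral (left_mem_uIcc)
      have h2 : (fun x => ∫ v in α..x, deriv a v) = a := by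
        ext x
        rw [intervalIntegral.integral_eq_sub_of_hasDerivAt (fun y _ => ha.hasDerivAt y)
          (ha.deriv.smooth.continuous.intervalIntegrable _ _), ha.left, sub_zero]
      rwa [h2] at h1
    have e2 : ∫ x in α..β, a x * G x = - ∫ x in α..β, deriv a x * P x := by
      have h1 := haac.integral_mul_deriv_eq_deriv_mul hPac
      rw [ha.left, ha.right] at h1
      have h2 : ∫ x in α..β, a x * deriv P x = ∫ x in α..β, a x * G x := by
        refine intervalIntegral.integral_congr_ae ?_
        filter_upwards [hG.ae_hasDerivAt_integral] with x hx hx'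
        rw [(hx (uIoc_subset_uIcc hx') α left_mem_uIcc).deriv]
      rw [← h2, h1]
      ring
    have e3 : ∫ x in α..β, deriv a x * (p' - P) x =
        (∫ x in α..β, deriv a x * p' x) - ∫ x in α..β, deriv a x * P x := by
      rw [← intervalIntegral.integral_sub]
      · refine intervalIntegral.integral_congr fun x _ => ?_
        simp only [Pi.sub_apply]; ring
      · exact ContinuousOn.intervalIntegrable
          (ha.deriv.smooth.continuous.continuousOn.mul (hu ▸ hp'))
      · exact ContinuousOn.intervalIntegrable
          (ha.deriv.smooth.continuous.continuousOn.mul (hu ▸ hPc))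
    rw [e3]
    linarith [hweak a ha]
  have hP0 : P α = 0 := intervalIntegral.integral_same
  simp only [Pi.sub_apply, hP0] at this
  have hPβ : P β = ∫ x in α..β, G x := rfl
  linarith

end WeakDerivative

/-! ### From the distributional wave equation to an integral identity in L². -/

section Equation

open scoped SchwartzMap Laplacian

/-- The pairing `f ↦ ∫ f u` on `L²` with a Schwartz function. -/
def pairing (u : 𝓢(Space, ℂ)) : L2 →L[ℂ] ℂ :=
  ((ContinuousLinearMap.mul ℂ ℂ).lpPairing volume 2 2).flip (u.toLp 2)

lemma pairing_apply (u : 𝓢(Space, ℂ)) (f : L2) : pairing u f = ∫ x, (f : Space → ℂ) x * u x := by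
  rw [pairing, ContinuousLinearMap.flip_apply, ContinuousLinearMap.lpPairing_eq_integral]
  refine integral_congr_ae ?_
  filter_upwards [u.coeFn_toLp 2 volume] with x hx
  rw [hx]; rfl

lemma pairing_eq_toTemperedDistribution (u : 𝓢(Space, ℂ)) (f : L2) :
    pairing u f = Lp.toTemperedDistribution f u := by
  rw [pairing_apply, Lp.toTemperedDistribution_apply]
  simp [mul_comm]

/-- Parseval for the bilinear pairing: with no conjugation, the inverse transform falls on the test
function. -/
lemma pairing_eq_pairing_fourier (u : 𝓢(Space, ℂ)) (f : L2) :
    pairing u f = pairing (𝓕⁻ u) (𝓕 f) := by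
  rw [pairing_eq_toTemperedDistribution, pairing_eq_toTemperedDistribution,
    ← TemperedDistribution.fourierInv_apply, Lp.fourierInv_toTemperedDistribution_eq,
    FourierTransform.fourierInv_fourier_eq]

lemma integrable_mul_schwartz (u : 𝓢(Space, ℂ)) (f : L2) :
    Integrable fun x => (f : Space → ℂ) x * u x :=
  (Lp.memLp f).integrable_mul (u.memLp 2 volume)

/-- The Laplacian is the multiplier -(2π‖x‖)², which is `-freq ^ 2`; passing from inverse to forward
transform reflects ζ and leaves this even symbol unchanged. -/
lemma fourierInv_laplacian_apply (u : 𝓢(Space, ℂ)) (ζ : Space) :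
    (𝓕⁻ (Δ u) : 𝓢(Space, ℂ)) ζ = -((freq ζ : ℝ) : ℂ) ^ 2 * (𝓕⁻ u : 𝓢(Space, ℂ)) ζ := by
  have h1 : ∀ v : 𝓢(Space, ℂ), (𝓕⁻ v : 𝓢(Space, ℂ)) ζ = (𝓕 v : 𝓢(Space, ℂ)) (-ζ) := by
    intro v
    rw [SchwartzMap.fourierInv_coe, SchwartzMap.fourier_coe, Real.fourierInv_eq_fourier_neg]
  have h2 : (𝓕 (Δ u) : 𝓢(Space, ℂ)) =
      -(2 * Real.pi) ^ 2 • SchwartzMap.smulLeftCLM ℂ (fun x : Space => ‖x‖ ^ 2) (𝓕 u) := by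
    rw [SchwartzMap.laplacian_eq_fourierMultiplierCLM, FourierTransform.fourier_smul,
      SchwartzMap.fourierMultiplierCLM_apply, FourierTransform.fourier_fourierInv_eq]
  rw [h1, h1, h2, smul_apply, SchwartzMap.smulLeftCLM_apply_apply (by fun_prop)]
  simp only [norm_neg, freq, Complex.real_smul]
  push_cast
  ring

/-- The pairing of a frequency localized function with a Laplacian. -/
lemma pairing_laplacian {c : ℝ} (hc : 1 ≤ c) {k : ℤ} {f : L2} (hf : FreqLocalized c k f)
    (u : 𝓢(Space, ℂ)) : pairing (Δ u) f = pairing u (lapOp c k f) := by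
  rw [pairing_eq_pairing_fourier, pairing_eq_pairing_fourier u, pairing_apply, pairing_apply]
  refine integral_congr_ae ?_
  filter_upwards [freqLocalized_iff.1 hf, fourier_bandOp (σ := fun r => -r ^ 2) (k := k) hc
    (isSymbol_of_continuous (by fun_prop)) f] with ζ h1 h2
  rw [lapOp, h2, fourierInv_laplacian_apply]
  by_cases hζ : ζ ∈ annulus c k
  · simp only [bandSymbol, hζ, indicator_of_mem]
    push_cast
    ring
  · simp [not_imp_comm.1 h1 hζ]

/-- Real parts suffice because test functions may be multiplied by i. This reduces an equation in L²
to real functions of time. -/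
lemma eq_of_re_pairing_eq {f g : L2}
    (h : ∀ u : 𝓢(Space, ℂ), HasCompactSupport u → (pairing u f).re = (pairing u g).re) :
    f = g := by
  refine Lp.ext (ae_eq_of_integral_contDiff_smul_eq ((Lp.memLp _).locallyIntegrable (by norm_num))
    ((Lp.memLp _).locallyIntegrable (by norm_num)) fun ψ hψ hψc => ?_)
  have h1 : ∀ z : ℂ, ContDiff ℝ ∞ fun x => z * (ψ x : ℂ) := fun z =>
    contDiff_const.mul (Complex.ofRealCLM.contDiff.comp hψ)
  have h2 : ∀ z : ℂ, HasCompactSupport fun x => z * (ψ x : ℂ) := fun z =>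
    (hψc.comp_left (g := fun r : ℝ => (r : ℂ)) rfl).mul_left
  have h3 : ∀ (z : ℂ) (w : L2), pairing ((h2 z).toSchwartzMap (h1 z)) w =
      z * ∫ x, ψ x • (w : Space → ℂ) x := by
    intro z w
    rw [pairing_apply, ← integral_const_mul]
    refine integral_congr_ae (Filter.Eventually.of_forall fun x => ?_)
    change (w : Space → ℂ) x * (z * (ψ x : ℂ)) = _
    simp only [Complex.real_smul]
    ring
  have h4 : ∀ z : ℂ, (z * ∫ x, ψ x • (f : Space → ℂ) x).re =
      (z * ∫ x, ψ x • (g : Space → ℂ) x).re := by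
    intro z
    rw [← h3, ← h3]
    exact h _ (h2 z)
  refine Complex.ext ?_ ?_
  · simpa using h4 1
  · simpa using h4 Complex.I

variable {c : ℝ} {k : ℤ} {I : Set ℝ} {φ F : ℝ → L2}

lemma box_mul_schwartz {a : ℝ → ℝ} (ha : ContDiff ℝ ∞ a) (u : 𝓢(Space, ℂ)) (t : ℝ) (x : Space) :
    box (fun z => (a z.1 : ℂ) * u z.2) t x =
      -((deriv (deriv a) t : ℝ) : ℂ) * u x + (a t : ℂ) * (Δ u : 𝓢(Space, ℂ)) x := by
  have h1 : ∀ b : ℝ → ℝ, ContDiff ℝ ∞ b →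
      deriv (fun s => (b s : ℂ) * u x) = fun s => ((deriv b s : ℝ) : ℂ) * u x := by
    intro b hb
    ext s
    exact (((contDiff_infty_iff_deriv.1 hb).1 s).hasDerivAt.ofReal_comp.mul_const _).deriv
  have h2 : iteratedDeriv 2 (fun s => (a s : ℂ) * u x) t =
      ((deriv (deriv a) t : ℝ) : ℂ) * u x := by
    rw [iteratedDeriv_succ, iteratedDeriv_one, h1 a ha, h1 _ (contDiff_infty_iff_deriv.1 ha).2]
  have h3 : Laplacian.laplacian (fun y => (a t : ℂ) * u y) x =
      (a t : ℂ) * (Δ u : 𝓢(Space, ℂ)) x := by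
    rw [SchwartzMap.laplacian_apply]
    exact InnerProductSpace.laplacian_smul (a t : ℂ)
      ((u.smooth 2).contDiffAt)
  rw [box, h2, h3]
  ring

/-- Testing the wave equation against `a(t) u(x)`. -/
lemma IsBox.weak_time (hc : 1 ≤ c) (hI : I.OrdConnected) (hIc : IsClosed I)
    (hφ : ContinuousOn φ I) (hloc : ∀ t ∈ I, FreqLocalized c k (φ t)) (hF : IsBox I φ F)
    {α β : ℝ} (hαβ : α < β) (hα : α ∈ I) (hβ : β ∈ I) {a : ℝ → ℝ} (ha : IsTest α β a)
    (u : 𝓢(Space, ℂ)) (hu : HasCompactSupport u) :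
    ∫ t in α..β, deriv (deriv a) t * (pairing u (φ t)).re =
      ∫ t in α..β, a t * (pairing u (lapOp c k (φ t) - F t)).re := by
  have hsub : Icc α β ⊆ I := hI.out hα hβ
  have hIoc : Ioc α β ⊆ I := Ioc_subset_Icc_self.trans hsub
  set η : ℝ × Space → ℂ := fun z => (a z.1 : ℂ) * u z.2 with hη
  have hηs : ContDiff ℝ ∞ η :=
    (Complex.ofRealCLM.contDiff.comp (ha.smooth.comp contDiff_fst)).mul
      ((u.smooth ⊤).comp contDiff_snd)
  have hηt : tsupport η ⊆ tsupport a ×ˢ tsupport u := by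
    refine closure_minimal ?_ ((isClosed_tsupport a).prod (isClosed_tsupport u))
    intro z hz
    refine ⟨subset_tsupport a fun h => hz ?_, subset_tsupport u fun h => hz ?_⟩ <;> simp [hη, h]
  have hηc : HasCompactSupport η :=
    (ha.hasCompactSupport.isCompact.prod hu.isCompact).of_isClosed_subset (isClosed_tsupport η) hηt
  have hηI : tsupport η ⊆ interior I ×ˢ univ := by
    refine hηt.trans (prod_mono ?_ (subset_univ _))
    exact ha.tsupport_subset.trans
      (interior_maximal (Ioo_subset_Icc_self.trans hsub) isOpen_Ioo)
  have hw := hF.weak η hηs hηc hηI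
  have hloc' : ∀ t ∈ I, ∫ x, (φ t : Space → ℂ) x * box η t x =
      -((deriv (deriv a) t : ℝ) : ℂ) * pairing u (φ t) +
        (a t : ℂ) * pairing u (lapOp c k (φ t)) := by
    intro t ht
    rw [← pairing_laplacian hc (hloc t ht), pairing_apply, pairing_apply, ← integral_const_mul,
      ← integral_const_mul, ← integral_add ((integrable_mul_schwartz u _).const_mul _)
        ((integrable_mul_schwartz (Δ u) _).const_mul _)]
    refine integral_congr_ae (Filter.Eventually.of_forall fun x => ?_)
    simp only [hη, box_mul_schwartz ha.smooth]
    ring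
  have hR : ∀ t, ∫ x, (F t : Space → ℂ) x * η (t, x) = (a t : ℂ) * pairing u (F t) := by
    intro t
    rw [pairing_apply, ← integral_const_mul]
    refine integral_congr_ae (Filter.Eventually.of_forall fun x => ?_)
    simp only [hη]; ring
  rw [setIntegral_congr_fun hIc.measurableSet hloc'] at hw
  simp only [hR] at hw
  -- Both integrands vanish off (α, β), so the integral over a possibly unbounded I becomes an
  -- interval integral.
  have hset : ∀ G : ℝ → ℂ, (∀ t ∉ Ioc α β, G t = 0) → ∫ t in I, G t = ∫ t in α..β, G t := by
    intro G hG
    rw [intervalIntegral.integral_of_le hαβ.le]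
    exact (setIntegral_eq_of_subset_of_forall_sdiff_eq_zero hIc.measurableSet hIoc
      fun t ht => hG t ht.2).symm ▸ rfl
  have ha0 : ∀ t ∉ Ioc α β, a t = 0 := fun t ht => by
    by_contra h; exact ht (Ioo_subset_Ioc_self (ha.support_subset h))
  have ha0'' : ∀ t ∉ Ioc α β, deriv (deriv a) t = 0 := fun t ht => by
    by_contra h; exact ht (Ioo_subset_Ioc_self (ha.deriv.deriv.support_subset h))
  rw [hset _ (fun t ht => by simp [ha0 t ht, ha0'' t ht]),
    hset _ (fun t ht => by simp [ha0 t ht])] at hw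
  have hu' : uIcc α β = Icc α β := uIcc_of_le hαβ.le
  have hφ' : ContinuousOn φ (uIcc α β) := hu' ▸ hφ.mono hsub
  have i1 : IntervalIntegrable (fun t => ((deriv (deriv a) t : ℝ) : ℂ) * pairing u (φ t))
      volume α β := by
    refine ContinuousOn.intervalIntegrable (ContinuousOn.mul ?_ ?_)
    · exact (Complex.continuous_ofReal.comp ha.deriv.deriv.smooth.continuous).continuousOn
    · exact (pairing u).continuous.comp_continuousOn hφ'
  have i2 : IntervalIntegrable (fun t => (a t : ℂ) * pairing u (lapOp c k (φ t)))
      volume α β := by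
    refine ContinuousOn.intervalIntegrable (ContinuousOn.mul ?_ ?_)
    · exact (Complex.continuous_ofReal.comp ha.smooth.continuous).continuousOn
    · exact ((pairing u).continuous.comp (lapOp c k).continuous).comp_continuousOn hφ'
  have i3 : IntervalIntegrable (fun t => (a t : ℂ) * pairing u (F t)) volume α β := by
    refine IntervalIntegrable.continuousOn_mul ?_
      (Complex.continuous_ofReal.comp ha.smooth.continuous).continuousOn
    rw [intervalIntegrable_iff_integrableOn_Ioc_of_le hαβ.le]
    have : IntegrableOn F (Ioc α β) :=
      ((hF.memLp.mono_measure (Measure.restrict_mono_set _ hIoc))).integrable (by norm_num)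
    exact (pairing u).integrable_comp this
  have hw' : ∫ t in α..β, ((deriv (deriv a) t : ℝ) : ℂ) * pairing u (φ t) =
      ∫ t in α..β, (a t : ℂ) * pairing u (lapOp c k (φ t) - F t) := by
    have e1 : ∫ t in α..β, (a t : ℂ) * pairing u (lapOp c k (φ t) - F t) =
        (∫ t in α..β, (a t : ℂ) * pairing u (lapOp c k (φ t))) -
          ∫ t in α..β, (a t : ℂ) * pairing u (F t) := by
      rw [← intervalIntegral.integral_sub i2 i3]
      refine intervalIntegral.integral_congr fun t _ => ?_
      simp only [map_sub]; ring
    have e2 : ∫ t in α..β, (-((deriv (deriv a) t : ℝ) : ℂ) * pairing u (φ t) +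
          (a t : ℂ) * pairing u (lapOp c k (φ t))) =
        -(∫ t in α..β, ((deriv (deriv a) t : ℝ) : ℂ) * pairing u (φ t)) +
          ∫ t in α..β, (a t : ℂ) * pairing u (lapOp c k (φ t)) := by
      rw [neg_add_eq_sub, ← intervalIntegral.integral_sub i2 i1]
      refine intervalIntegral.integral_congr fun t _ => ?_
      ring
    rw [e2] at hw
    rw [e1, ← hw]
    ring
  have hre : ∀ G : ℝ → ℂ, IntervalIntegrable G volume α β →
      (∫ t in α..β, G t).re = ∫ t in α..β, (G t).re := fun G hG =>
    (Complex.reCLM.intervalIntegral_comp_comm hG).symm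
  have i4 : IntervalIntegrable (fun t => (a t : ℂ) * pairing u (lapOp c k (φ t) - F t))
      volume α β := by
    refine (i2.sub i3).congr fun t _ => ?_
    simp only [map_sub]; ring
  have := congrArg Complex.re hw'
  rw [hre _ i1, hre _ i4] at this
  simpa using this

/-- The wave equation in integrated form, as an identity in `L²`. -/
lemma IsBox.derivWithin_sub_eq_integral (hc : 1 ≤ c) (hI : I.OrdConnected) (hIc : IsClosed I)
    (hφ : ContDiffOn ℝ 1 φ I) (hloc : ∀ t ∈ I, FreqLocalized c k (φ t)) (hF : IsBox I φ F)
    {α β : ℝ} (hαβ : α < β) (hα : α ∈ I) (hβ : β ∈ I) :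
    derivWithin φ I β - derivWithin φ I α = ∫ t in α..β, (lapOp c k (φ t) - F t) := by
  have hsub : Icc α β ⊆ I := hI.out hα hβ
  have hne : I.Nontrivial := ⟨α, hα, β, hβ, hαβ.ne⟩
  have huI := uniqueDiffOn_of_nontrivial hI hne
  have hu' : uIcc α β = Icc α β := uIcc_of_le hαβ.le
  have hint : IntervalIntegrable (fun t => lapOp c k (φ t) - F t) volume α β := by
    refine IntervalIntegrable.sub ?_ ?_
    · exact ContinuousOn.intervalIntegrable
        ((lapOp c k).continuous.comp_continuousOn (hu' ▸ hφ.continuousOn.mono hsub))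
    · rw [intervalIntegrable_iff_integrableOn_Ioc_of_le hαβ.le]
      exact (hF.memLp.mono_measure (Measure.restrict_mono_set _
        (Ioc_subset_Icc_self.trans hsub))).integrable (by norm_num)
  refine eq_of_re_pairing_eq fun u hu => ?_
  set l : L2 →L[ℝ] ℝ := Complex.reCLM ∘L (pairing u).restrictScalars ℝ with hl
  have hlap : ∀ f, (pairing u f).re = l f := fun f => rfl
  rw [hlap, hlap, map_sub, ← l.intervalIntegral_comp_comm hint]
  refine deriv_sub_eq_integral_of_weak hαβ (p := fun t => l (φ t))
    (p' := fun t => l (derivWithin φ I t)) (fun t ht => ?_) ?_ ?_ fun a ha => ?_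
  · exact (l.hasFDerivAt.comp_hasDerivWithinAt t
      ((hφ.differentiableOn one_ne_zero t (hsub ht)).hasDerivWithinAt)).mono hsub
  · exact l.continuous.comp_continuousOn
      ((hφ.continuousOn_derivWithin huI le_rfl).mono hsub)
  · exact ⟨l.integrable_comp hint.1, l.integrable_comp hint.2⟩
  · exact hF.weak_time hc hI hIc hφ.continuousOn hloc hαβ hα hβ ha u hu

end Equation

/-! ### Control of a function and its derivative on a short interval. -/

section Window

variable {E : Type*} [NormedAddCommGroup E]

/-- The minimum of the norm is at most its mean. -/
lemma exists_norm_mul_le_integral {Φ : ℝ → E} {a b : ℝ} (hab : a ≤ b)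
    (hΦ : ContinuousOn Φ (Icc a b)) :
    ∃ s ∈ Icc a b, (b - a) * ‖Φ s‖ ≤ ∫ x in a..b, ‖Φ x‖ := by
  obtain ⟨s, hs, hmin⟩ := isCompact_Icc.exists_isMinOn (nonempty_Icc.2 hab) hΦ.norm
  refine ⟨s, hs, ?_⟩
  have hu : uIcc a b = Icc a b := uIcc_of_le hab
  have := intervalIntegral.integral_mono_on (μ := volume) hab (intervalIntegrable_const (c := ‖Φ s‖))
    (ContinuousOn.intervalIntegrable (hu ▸ hΦ.norm)) (fun x hx => hmin hx)
  simpa using this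

/-- On a bounded interval a function and its derivative are controlled by the mean of the function
and the oscillation of the derivative. -/
lemma norm_add_norm_deriv_le [NormedSpace ℝ E] {Φ Φ' : ℝ → E} {α β Γ : ℝ} (hαβ : α < β)
    (hΦ : ∀ s ∈ Icc α β, HasDerivWithinAt Φ (Φ' s) (Icc α β) s)
    (hΓ : ∀ s ∈ Icc α β, ∀ t ∈ Icc α β, ‖Φ' s - Φ' t‖ ≤ Γ) {t : ℝ} (ht : t ∈ Icc α β) :
    ‖Φ t‖ + (β - α) * ‖Φ' t‖ ≤ 39 / (β - α) * (∫ x in α..β, ‖Φ x‖) + 3 * (β - α) * Γ := by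
  set l := β - α with hl
  have hl0 : 0 < l := by simp only [hl]; linarith
  have hΦc : ContinuousOn Φ (Icc α β) := fun s hs => (hΦ s hs).continuousWithinAt
  have hu : uIcc α β = Icc α β := uIcc_of_le hαβ.le
  set J := ∫ x in α..β, ‖Φ x‖ with hJ
  have hΓ0 : 0 ≤ Γ := by simpa using hΓ t ht t ht
  have hsmall : ∀ a b, α ≤ a → a ≤ b → b ≤ β → ∫ x in a..b, ‖Φ x‖ ≤ J := fun a b h1 h2 h3 =>
    intervalIntegral.integral_mono_interval h1 h2 h3
      (Filter.Eventually.of_forall fun x => norm_nonneg _)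
      (ContinuousOn.intervalIntegrable (hu ▸ hΦc.norm))
  -- One point is chosen in each outer third: Φ is at most 3J/l at both, and they are at least l/3
  -- apart, so their difference quotient controls Φ'.
  obtain ⟨s₁, hs₁, h₁⟩ := exists_norm_mul_le_integral (Φ := Φ) (a := α) (b := α + l / 3)
    (by linarith) (hΦc.mono (Icc_subset_Icc_right (by linarith)))
  obtain ⟨s₂, hs₂, h₂⟩ := exists_norm_mul_le_integral (Φ := Φ) (a := β - l / 3) (b := β)
    (by linarith) (hΦc.mono (Icc_subset_Icc_left (by linarith)))
  have h₁' := h₁.trans (hsmall α (α + l / 3) le_rfl (by linarith) (by linarith))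
  have h₂' := h₂.trans (hsmall (β - l / 3) β (by linarith) (by linarith) le_rfl)
  have hs₁' : s₁ ∈ Icc α β := ⟨hs₁.1, by linarith [hs₁.2]⟩
  have hs₂' : s₂ ∈ Icc α β := ⟨by linarith [hs₂.1], hs₂.2⟩
  have hlip : ∀ s ∈ Icc α β, ‖Φ s - Φ s₁ - (s - s₁) • Φ' t‖ ≤ Γ * |s - s₁| := by
    intro s hs
    have := (convex_Icc α β).norm_image_sub_le_of_norm_hasDerivWithin_le
      (f := fun s => Φ s - s • Φ' t) (f' := fun s => Φ' s - (1 : ℝ) • Φ' t) (C := Γ)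
      (fun x hx => (hΦ x hx).sub ((hasDerivWithinAt_id x _).smul_const _))
      (fun x hx => by rw [one_smul]; exact hΓ x hx t ht) hs₁' hs
    rw [Real.norm_eq_abs] at this
    refine le_trans (le_of_eq ?_) this
    congr 1
    rw [sub_smul]; abel
  have hd : l / 3 ≤ s₂ - s₁ := by linarith [hs₁.2, hs₂.1]
  have hd0 : 0 < s₂ - s₁ := by linarith
  have hJ1 : ‖Φ s₁‖ ≤ 3 / l * J := by
    rw [div_mul_eq_mul_div, le_div_iff₀ hl0]; linarith
  have hJ2 : ‖Φ s₂‖ ≤ 3 / l * J := by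
    rw [div_mul_eq_mul_div, le_div_iff₀ hl0]; linarith
  have hder : l * ‖Φ' t‖ ≤ 18 / l * J + l * Γ := by
    have e1 : (s₂ - s₁) * ‖Φ' t‖ ≤ Γ * (s₂ - s₁) + (‖Φ s₂‖ + ‖Φ s₁‖) := by
      have := hlip s₂ hs₂'
      rw [abs_of_pos hd0] at this
      calc (s₂ - s₁) * ‖Φ' t‖ = ‖(s₂ - s₁) • Φ' t‖ := by
            rw [norm_smul, Real.norm_of_nonneg hd0.le]
        _ = ‖(Φ s₂ - Φ s₁) - (Φ s₂ - Φ s₁ - (s₂ - s₁) • Φ' t)‖ := by congr 1; abel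
        _ ≤ ‖Φ s₂ - Φ s₁‖ + ‖Φ s₂ - Φ s₁ - (s₂ - s₁) • Φ' t‖ := norm_sub_le _ _
        _ ≤ (‖Φ s₂‖ + ‖Φ s₁‖) + Γ * (s₂ - s₁) := add_le_add (norm_sub_le _ _) this
        _ = _ := add_comm _ _
    have e2 : (s₂ - s₁) * (‖Φ' t‖ - Γ) ≤ 6 / l * J := by
      have : 6 / l * J = 3 / l * J + 3 / l * J := by ring
      linarith
    rcases le_total ‖Φ' t‖ Γ with h | h
    · have hJ0 : 0 ≤ J := by
        have := norm_nonneg (Φ s₁)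
        have h3 : 0 ≤ l * (3 / l * J) := mul_nonneg hl0.le (this.trans hJ1)
        have h4 : l * (3 / l * J) = 3 * J := by field_simp
        linarith
      have : 0 ≤ 18 / l * J := by positivity
      have := mul_le_mul_of_nonneg_left h hl0.le
      linarith
    · have e3 : l / 3 * (‖Φ' t‖ - Γ) ≤ 6 / l * J :=
        (mul_le_mul_of_nonneg_right hd (by linarith)).trans e2
      have e4 : 18 / l * J = 3 * (6 / l * J) := by ring
      rw [e4]; linarith
  have hval : ‖Φ t‖ ≤ 3 / l * J + l * Γ + l * ‖Φ' t‖ := by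
    have h3 : |t - s₁| ≤ l := by
      rw [abs_le]; constructor <;> linarith [ht.1, ht.2, hs₁'.1, hs₁'.2]
    calc ‖Φ t‖ = ‖Φ s₁ + (Φ t - Φ s₁ - (t - s₁) • Φ' t) + (t - s₁) • Φ' t‖ := by
          congr 1; abel
      _ ≤ ‖Φ s₁‖ + ‖Φ t - Φ s₁ - (t - s₁) • Φ' t‖ + ‖(t - s₁) • Φ' t‖ := norm_add₃_le
      _ ≤ 3 / l * J + Γ * |t - s₁| + |t - s₁| * ‖Φ' t‖ := by
          rw [norm_smul, Real.norm_eq_abs]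
          gcongr
          exact hlip t ht
      _ ≤ 3 / l * J + Γ * l + l * ‖Φ' t‖ := by gcongr
      _ = _ := by ring
  -- The bound on l‖Φ'‖ is used twice, once for itself and once inside the bound on ‖Φ‖: 39 = 3 + 2
  -- · 18, and similarly 3 = 1 + 2 for Γ.
  have e5 : 39 / l * J = 3 / l * J + 2 * (18 / l * J) := by ring
  rw [e5]; linarith

end Window

/-! ### Localized functions as elements of L^q. -/

section LebesgueProjection

variable {c : ℝ}

/-- The frequency projection as an operator from `L²` to `L^q`. -/
lemma exists_projLp (hc : 1 ≤ c) : ∃ C : ℝ≥0, ∀ (k : ℤ) (q : ℝ≥0∞) [Fact (1 ≤ q)], 2 ≤ q →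
    ∃ T : L2 →L[ℂ] Lp ℂ q (volume : Measure Space),
      (∀ f, FreqLocalized c k f → ‖T f‖ₑ = eLpNorm f q volume) ∧
      ∀ f, ‖T f‖ ≤ C * (((2 : ℝ) ^ k) ^ 2 * (2 : ℝ) ^ (-(4 * (q⁻¹).toReal * k))) * ‖f‖ := by
  obtain ⟨C, hC⟩ := exists_bernstein hc
  refine ⟨C, fun k q _ hq => ?_⟩
  set A : ℝ := ((2 : ℝ) ^ k) ^ 2 * (2 : ℝ) ^ (-(4 * (q⁻¹).toReal * k)) with hA
  have hAe : (2 : ℝ≥0∞) ^ ((2 - 4 * (q⁻¹).toReal) * (k : ℝ)) = ENNReal.ofReal A := by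
    rw [hA, ← Real.rpow_intCast, ← Real.rpow_natCast, ← Real.rpow_mul (by norm_num),
      ← Real.rpow_add (by norm_num), ← ENNReal.ofReal_rpow_of_pos (by norm_num),
      ENNReal.ofReal_ofNat]
    congr 1
    push_cast; ring
  -- Projecting first makes Bernstein available for every f, so the operator is defined on all of
  -- L². On localized functions it only records the L^q norm, and it carries L²-continuity in time
  -- over to L^q.
  have hproj : ∀ f, eLpNorm (proj c k f) q volume ≤ C * ENNReal.ofReal A * ‖f‖ₑ := by
    intro f
    refine (hC k _ (freqLocalized_proj hc f) q hq).trans ?_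
    rw [hAe]
    have h1 : ‖proj c k f‖ ≤ 1 * ‖f‖ := (proj c k).le_of_opNorm_le
      (norm_bandOp_le hc (isSymbol_const 1) zero_le_one fun r _ => by simp) f
    rw [one_mul] at h1
    have h2 : ‖proj c k f‖ₑ ≤ ‖f‖ₑ := enorm_le_iff_norm_le.2 h1
    gcongr
  have hmem : ∀ f, MemLp (proj c k f : Space → ℂ) q volume := fun f =>
    ⟨Lp.aestronglyMeasurable _, (hproj f).trans_lt (ENNReal.mul_lt_top
      (ENNReal.mul_lt_top ENNReal.coe_lt_top ENNReal.ofReal_lt_top) enorm_lt_top)⟩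
  let T₀ : L2 →ₗ[ℂ] Lp ℂ q (volume : Measure Space) :=
    { toFun := fun f => (hmem f).toLp _
      map_add' := fun f g => by
        rw [← MemLp.toLp_add]
        refine MemLp.toLp_congr _ _ ?_
        rw [map_add]
        exact Lp.coeFn_add _ _
      map_smul' := fun a f => by
        rw [RingHom.id_apply, ← MemLp.toLp_const_smul]
        refine MemLp.toLp_congr _ _ ?_
        rw [map_smul]
        exact Lp.coeFn_smul _ _ }
  have hT₀ : ∀ f, ‖T₀ f‖ₑ = eLpNorm (proj c k f) q volume := fun f => Lp.enorm_toLp (hf := hmem f)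
  have hbd : ∀ f, ‖T₀ f‖ ≤ C * A * ‖f‖ := by
    intro f
    have h1 : ‖T₀ f‖ₑ ≤ ENNReal.ofReal (C * A * ‖f‖) := by
      rw [hT₀, ENNReal.ofReal_mul (by positivity), ENNReal.ofReal_mul (by positivity),
        ofReal_norm, ENNReal.ofReal_coe_nnreal]
      exact hproj f
    rw [← ofReal_norm] at h1
    exact (ENNReal.ofReal_le_ofReal_iff (by positivity)).1 h1
  refine ⟨T₀.mkContinuous _ hbd, fun f hf => ?_, hbd⟩
  change ‖T₀ f‖ₑ = _
  rw [hT₀, hf.proj_eq hc]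

/-- Scaled form of the multiplier bound for the operators `bandOp`. -/
lemma exists_bandOp_bound (hc : 1 ≤ c) {b : ℝ → ℝ} (hb : ContDiffOn ℝ ∞ b (Ioi 0)) :
    ∃ C : ℝ≥0, ∀ g : ℝ → ℝ, IsWave g → ∀ (s a : ℝ) (k : ℤ) (σ : ℝ → ℝ), IsSymbol σ → 0 < a →
      (∀ r, 0 < r → σ r = a * (b (r / 2 ^ k) * g (s * (r / 2 ^ k)))) →
      ∀ f : L2, FreqLocalized c k f → ∀ q : ℝ≥0∞, 1 ≤ q →
        eLpNorm (bandOp c k σ f) q volume ≤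
          ENNReal.ofReal a * (C * ENNReal.ofReal ((1 + |s|) ^ 5) * eLpNorm f q volume) := by
  obtain ⟨C, hC⟩ := exists_multiplier_bound hc hb
  refine ⟨C, fun g hg s a k σ hσ ha hσe f hf q hq => ?_⟩
  have h1 := hC g hg s k f ((a⁻¹ : ℂ) • bandOp c k σ f) hf (by
    filter_upwards [fourier_smul_ae (a⁻¹ : ℂ) (bandOp c k σ f), fourier_bandOp hc hσ f,
      freqLocalized_iff.1 hf] with ζ e1 e2 e3
    rw [e1, e2]
    by_cases hζ : ζ ∈ annulus c k
    · have ha' : (a : ℂ) ≠ 0 := by exact_mod_cast ha.ne'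
      simp only [bandSymbol, hζ, indicator_of_mem, hσe _ (band_pos hc hζ)]
      push_cast
      field_simp
    · simp [not_imp_comm.1 e3 hζ]) q hq
  have h2 : bandOp c k σ f = (a : ℂ) • ((a⁻¹ : ℂ) • bandOp c k σ f) := by
    rw [smul_smul, mul_inv_cancel₀ (by exact_mod_cast ha.ne'), one_smul]
  have h3 : eLpNorm (bandOp c k σ f) q volume =
      ENNReal.ofReal a * eLpNorm ((a⁻¹ : ℂ) • bandOp c k σ f : L2) q volume := by
    conv_lhs => rw [h2]
    rw [eLpNorm_congr_ae (Lp.coeFn_smul (a : ℂ) _), eLpNorm_const_smul]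
    congr 1
    rw [← ofReal_norm, Complex.norm_real, Real.norm_of_nonneg ha.le]
  rw [h3]
  gcongr

end LebesgueProjection

/-! ### Bounding the data at one time by an average over a nearby window. -/

section CoreEstimate

variable {c : ℝ}

/-- If t + l/3 and t - l/3 were both outside I, then I would lie in an interval of length 2l/3,
against its measure. -/
lemma exists_window {I : Set ℝ} (hI : I.OrdConnected) {l : ℝ} (hl : 0 < l)
    (hvol : ENNReal.ofReal l ≤ volume I) {t : ℝ} (ht : t ∈ I) :
    ∃ α ∈ I, ∃ β ∈ I, β - α = l / 3 ∧ t ∈ Icc α β := by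
  by_cases h1 : t + l / 3 ∈ I
  · exact ⟨t, ht, _, h1, by ring, by constructor <;> linarith⟩
  by_cases h2 : t - l / 3 ∈ I
  · exact ⟨_, h2, t, ht, by ring, by constructor <;> linarith⟩
  exfalso
  have hsub : I ⊆ Icc (t - l / 3) (t + l / 3) := by
    intro s hs
    constructor
    · by_contra h
      exact h2 (hI.out hs ht ⟨(not_le.1 h).le, by linarith⟩)
    · by_contra h
      exact h1 (hI.out ht hs ⟨by linarith, (not_le.1 h).le⟩)
  have := hvol.trans (measure_mono hsub)
  rw [Real.volume_Icc, ENNReal.ofReal_le_ofReal_iff (by linarith)] at this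
  linarith

set_option maxHeartbeats 1000000 in
/-- The size of the data at a time in `I` is controlled by `φ` and `□φ` near that time. -/
lemma exists_pointwise_bound (hc : 1 ≤ c) : ∃ C : ℝ≥0, ∀ (k : ℤ) (I : Set ℝ), I.OrdConnected →
    IsClosed I → ENNReal.ofReal ((2 : ℝ) ^ (-k)) ≤ volume I →
    ∀ φ F : ℝ → L2, ContDiffOn ℝ 1 φ I → (∀ t ∈ I, FreqLocalized c k (φ t)) → IsBox I φ F →
    ∀ q : ℝ≥0∞, 2 ≤ q → ∀ t ∈ I,
      eLpNorm (φ t) q volume +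
          ENNReal.ofReal ((2 : ℝ) ^ (-k)) * eLpNorm (derivWithin φ I t : L2) q volume ≤
        C * ENNReal.ofReal ((2 : ℝ) ^ k) *
          ∫⁻ s in I ∩ Metric.closedBall t ((2 : ℝ) ^ (-k)),
            (eLpNorm (φ s) q volume +
              ENNReal.ofReal ((2 : ℝ) ^ (-(4 * (q⁻¹).toReal * k))) * ‖F s‖ₑ) := by
  obtain ⟨Cb, hCb⟩ := exists_projLp hc
  obtain ⟨CL, hCL⟩ := exists_bandOp_bound hc (b := fun r => -r ^ 2) (by fun_prop)
  -- On a window of length K⁻¹/3 the factor 39 becomes 117K, and restoring the weight K⁻¹ from K⁻¹/3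
  -- costs another 3; so 351 + 3CL + 3Cb would suffice.
  obtain ⟨D, hD⟩ : ∃ D : ℝ≥0, (D : ℝ) = 1000 + 9 * CL + 9 * Cb :=
    ⟨1000 + 9 * CL + 9 * Cb, by push_cast; ring⟩
  refine ⟨D, fun k I hI hIc hvol φ F hφ hloc hF q hq t ht => ?_⟩
  have hq1 : 1 ≤ q := le_trans (by norm_num) hq
  have : Fact (1 ≤ q) := ⟨hq1⟩
  obtain ⟨T, hTe, hTn⟩ := hCb k q hq
  set w : ℝ := (2 : ℝ) ^ (-(4 * (q⁻¹).toReal * k)) with hw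
  have hw0 : 0 < w := by positivity
  set K : ℝ := (2 : ℝ) ^ k with hK
  have hK0 : 0 < K := by positivity
  have hl : (2 : ℝ) ^ (-k) = K⁻¹ := by rw [zpow_neg]
  rw [hl] at hvol ⊢
  obtain ⟨α, hα, β, hβ, hlen, htw⟩ := exists_window hI (inv_pos.2 hK0) hvol ht
  have hαβ : α < β := by have := inv_pos.2 hK0; linarith
  have hsub : Icc α β ⊆ I := hI.out hα hβ
  have hu : uIcc α β = Icc α β := uIcc_of_le hαβ.le
  have huI := uniqueDiffOn_of_nontrivial hI ⟨α, hα, β, hβ, hαβ.ne⟩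
  set Φ : ℝ → Lp ℂ q (volume : Measure Space) := fun s => T (φ s) with hΦ
  set Φ' : ℝ → Lp ℂ q (volume : Measure Space) := fun s => T (derivWithin φ I s) with hΦ'
  have hder : ∀ s ∈ Icc α β, HasDerivWithinAt Φ (Φ' s) (Icc α β) s := fun s hs =>
    (((T.restrictScalars ℝ).hasFDerivAt.comp_hasDerivWithinAt s
      ((hφ.differentiableOn one_ne_zero s (hsub hs)).hasDerivWithinAt)).mono hsub)
  have hφc : ContinuousOn φ (Icc α β) := hφ.continuousOn.mono hsub
  have hΦc : ContinuousOn Φ (Icc α β) := T.continuous.comp_continuousOn hφc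
  have hΦi : IntervalIntegrable (fun s => ‖Φ s‖) volume α β :=
    ContinuousOn.intervalIntegrable (hu ▸ hΦc.norm)
  have hFi : IntervalIntegrable F volume α β := by
    rw [intervalIntegrable_iff_integrableOn_Ioc_of_le hαβ.le]
    exact (hF.memLp.mono_measure (Measure.restrict_mono_set _
      (Ioc_subset_Icc_self.trans hsub))).integrable (by norm_num)
  have hLi : IntervalIntegrable (fun s => lapOp c k (φ s)) volume α β :=
    ContinuousOn.intervalIntegrable (hu ▸ (lapOp c k).continuous.comp_continuousOn hφc)
  set J := ∫ s in α..β, ‖Φ s‖ with hJ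
  set A := ∫ s in α..β, ‖F s‖ with hA
  -- The Laplacian costs K² in L^q: this is the multiplier bound without oscillation, cos at
  -- parameter 0.
  have hTlap : ∀ s ∈ Icc α β, ‖T (lapOp c k (φ s))‖ ≤ CL * K ^ 2 * ‖Φ s‖ := by
    intro s hs
    have h1 := hCL Real.cos isWave_cos 0 (K ^ 2) k (fun r => -r ^ 2)
      (isSymbol_of_continuous (by fun_prop)) (by positivity)
      (fun r _ => by rw [← hK]; simp; field_simp) (φ s) (hloc s (hsub hs)) q hq1
    have hLloc : FreqLocalized c k (lapOp c k (φ s)) :=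
      freqLocalized_bandOp hc (isSymbol_of_continuous (by fun_prop)) _
    have h2 : ‖T (lapOp c k (φ s))‖ₑ ≤ ENNReal.ofReal (CL * K ^ 2 * ‖Φ s‖) := by
      rw [hTe _ hLloc]
      refine le_trans h1 (le_of_eq ?_)
      rw [← hTe _ (hloc s (hsub hs)), ENNReal.ofReal_mul (by positivity),
        ENNReal.ofReal_mul (by positivity), ofReal_norm, ENNReal.ofReal_coe_nnreal]
      simp only [hΦ, abs_zero, add_zero, one_pow, ENNReal.ofReal_one, mul_one]
      ring
    rw [← ofReal_norm] at h2
    exact (ENNReal.ofReal_le_ofReal_iff (by positivity)).1 h2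
  set Γ : ℝ := CL * K ^ 2 * J + Cb * (K ^ 2 * w) * A with hΓdef
  -- Between two times ∂ₜφ changes by the integral of Δφ - F. No localization of F is needed,
  -- because T projects it to the annulus; Bernstein then gives the factor K²w.
  have hosc₀ : ∀ s₁ ∈ Icc α β, ∀ s₂ ∈ Icc α β, s₁ < s₂ → ‖Φ' s₂ - Φ' s₁‖ ≤ Γ := by
    intro s₁ h₁ s₂ h₂ h12
    have hss : Icc s₁ s₂ ⊆ Icc α β := Icc_subset_Icc h₁.1 h₂.2
    have hsub' : uIcc s₁ s₂ ⊆ uIcc α β := by rw [uIcc_of_le h12.le, hu]; exact hss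
    have heq := hF.derivWithin_sub_eq_integral hc hI hIc hφ hloc h12 (hsub h₁) (hsub h₂)
    have hi : IntervalIntegrable (fun s => lapOp c k (φ s) - F s) volume s₁ s₂ :=
      (hLi.sub hFi).mono_set hsub'
    have e1 : Φ' s₂ - Φ' s₁ = ∫ s in s₁..s₂, T (lapOp c k (φ s) - F s) := by
      rw [hΦ', ← map_sub, heq]
      exact (T.intervalIntegral_comp_comm hi).symm
    have hbi : IntervalIntegrable (fun s => CL * K ^ 2 * ‖Φ s‖ + Cb * (K ^ 2 * w) * ‖F s‖)
        volume α β := (hΦi.const_mul _).add (hFi.norm.const_mul _)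
    rw [e1]
    calc ‖∫ s in s₁..s₂, T (lapOp c k (φ s) - F s)‖
        ≤ ∫ s in s₁..s₂, (CL * K ^ 2 * ‖Φ s‖ + Cb * (K ^ 2 * w) * ‖F s‖) := by
          refine intervalIntegral.norm_integral_le_of_norm_le h12.le ?_ (hbi.mono_set hsub')
          refine Filter.Eventually.of_forall fun s hs => ?_
          rw [map_sub]
          exact (norm_sub_le _ _).trans (add_le_add
            (hTlap s (hss (Ioc_subset_Icc_self hs))) (hTn (F s)))
      _ ≤ ∫ s in α..β, (CL * K ^ 2 * ‖Φ s‖ + Cb * (K ^ 2 * w) * ‖F s‖) :=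
          intervalIntegral.integral_mono_interval h₁.1 h12.le h₂.2
            (Filter.Eventually.of_forall fun s => by positivity) hbi
      _ = Γ := by
          rw [intervalIntegral.integral_add (hΦi.const_mul _) (hFi.norm.const_mul _),
            intervalIntegral.integral_const_mul, intervalIntegral.integral_const_mul]
  have hJ0 : 0 ≤ J := intervalIntegral.integral_nonneg hαβ.le fun s _ => norm_nonneg _
  have hA0 : 0 ≤ A := intervalIntegral.integral_nonneg hαβ.le fun s _ => norm_nonneg _
  have hΓ0 : 0 ≤ Γ := by positivity
  have hosc : ∀ s₁ ∈ Icc α β, ∀ s₂ ∈ Icc α β, ‖Φ' s₁ - Φ' s₂‖ ≤ Γ := by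
    intro s₁ h₁ s₂ h₂
    rcases lt_trichotomy s₁ s₂ with h | h | h
    · rw [norm_sub_rev]; exact hosc₀ s₁ h₁ s₂ h₂ h
    · rw [h, sub_self, norm_zero]; exact hΓ0
    · exact hosc₀ s₂ h₂ s₁ h₁ h
  have hmain := norm_add_norm_deriv_le hαβ hder hosc htw
  rw [hlen, ← hJ] at hmain
  have hreal : ‖Φ t‖ + K⁻¹ * ‖Φ' t‖ ≤ (1000 + 9 * CL + 9 * Cb) * K * (J + w * A) := by
    have h1 : ‖Φ t‖ + K⁻¹ * ‖Φ' t‖ ≤ 3 * (‖Φ t‖ + K⁻¹ / 3 * ‖Φ' t‖) := by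
      have := norm_nonneg (Φ t); linarith
    have h2 : 39 / (K⁻¹ / 3) * J + 3 * (K⁻¹ / 3) * Γ =
        (117 + CL) * K * J + Cb * K * (w * A) := by
      rw [hΓdef]; field_simp; ring
    rw [h2] at hmain
    have h3 : 0 ≤ K * J := by positivity
    have h4 : 0 ≤ K * (w * A) := by positivity
    have h5 : 0 ≤ CL * (K * (w * A)) := by positivity
    have h6 : 0 ≤ Cb * (K * J) := by positivity
    have h7 : 0 ≤ CL * (K * J) := by positivity
    have h8 : 0 ≤ Cb * (K * (w * A)) := by positivity
    calc ‖Φ t‖ + K⁻¹ * ‖Φ' t‖ ≤ 3 * ((117 + CL) * K * J + Cb * K * (w * A)) := by linarith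
      _ ≤ _ := by linarith
  have hsum : J + w * A = ∫ s in α..β, (‖Φ s‖ + w * ‖F s‖) := by
    rw [intervalIntegral.integral_add hΦi (hFi.norm.const_mul _),
      intervalIntegral.integral_const_mul]
  have hint : IntegrableOn (fun s => ‖Φ s‖ + w * ‖F s‖) (Ioc α β) :=
    (intervalIntegrable_iff_integrableOn_Ioc_of_le hαβ.le).1 (hΦi.add (hFi.norm.const_mul _))
  have hlint : ENNReal.ofReal (J + w * A) ≤ ∫⁻ s in I ∩ Metric.closedBall t K⁻¹,
      (eLpNorm (φ s) q volume + ENNReal.ofReal w * ‖F s‖ₑ) := by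
    rw [hsum, intervalIntegral.integral_of_le hαβ.le, ofReal_integral_eq_lintegral_ofReal hint
      (Filter.Eventually.of_forall fun s => by positivity)]
    have hIoc : Ioc α β ⊆ I ∩ Metric.closedBall t K⁻¹ := by
      intro s hs
      refine ⟨hsub (Ioc_subset_Icc_self hs), ?_⟩
      rw [Metric.mem_closedBall, Real.dist_eq, abs_le]
      have := inv_pos.2 hK0
      constructor <;> linarith [hs.1, hs.2, htw.1, htw.2]
    refine le_trans (le_of_eq ?_) (lintegral_mono_set hIoc)
    refine setLIntegral_congr_fun measurableSet_Ioc fun s hs => ?_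
    rw [ENNReal.ofReal_add (norm_nonneg _) (by positivity), ENNReal.ofReal_mul hw0.le,
      ofReal_norm, ofReal_norm, hTe _ (hloc s (hsub (Ioc_subset_Icc_self hs)))]
  rw [← hTe _ (hloc t ht), ← hTe _ (freqLocalized_derivWithin hc huI hφ hloc ht)]
  calc ‖T (φ t)‖ₑ + ENNReal.ofReal K⁻¹ * ‖T (derivWithin φ I t)‖ₑ
      = ENNReal.ofReal (‖Φ t‖ + K⁻¹ * ‖Φ' t‖) := by
        rw [ENNReal.ofReal_add (norm_nonneg _) (by positivity),
          ENNReal.ofReal_mul (by positivity), ofReal_norm, ofReal_norm]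
    _ ≤ ENNReal.ofReal (D * K * (J + w * A)) := by
        rw [hD]
        exact ENNReal.ofReal_le_ofReal hreal
    _ = D * ENNReal.ofReal K * ENNReal.ofReal (J + w * A) := by
        rw [ENNReal.ofReal_mul (by positivity), ENNReal.ofReal_mul (by positivity),
          ENNReal.ofReal_coe_nnreal]
    _ ≤ _ := by gcongr

end CoreEstimate

/-! ### Young's inequality in time and the time kernel. -/

section Convolution

lemma lintegral_conv_congr {κ G G' : ℝ → ℝ≥0∞} (h : G =ᵐ[volume] G') (t : ℝ) :
    ∫⁻ s, κ (t - s) * G s = ∫⁻ s, κ (t - s) * G' s :=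
  lintegral_congr_ae (by filter_upwards [h] with s hs; rw [hs])

lemma aemeasurable_conv {κ G : ℝ → ℝ≥0∞} (hκ : Measurable κ) (hG : AEMeasurable G) :
    AEMeasurable fun t => ∫⁻ s, κ (t - s) * G s := by
  simp_rw [lintegral_conv_congr hG.ae_eq_mk]
  refine (Measurable.lintegral_prod_right' (f := fun z : ℝ × ℝ => κ (z.1 - z.2) * hG.mk G z.2)
    ?_).aemeasurable
  exact (hκ.comp (measurable_fst.sub measurable_snd)).mul (hG.measurable_mk.comp measurable_snd)

/-- Young's inequality `L¹ * L^p ⊆ L^p`. -/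
lemma eLpNorm_conv_le {κ G : ℝ → ℝ≥0∞} (hκ : Measurable κ) (hκi : ∫⁻ u, κ u ≠ ⊤)
    (hG : AEMeasurable G) {p : ℝ≥0∞} (hp : 1 ≤ p) :
    eLpNorm (fun t => ∫⁻ s, κ (t - s) * G s) p volume ≤ (∫⁻ u, κ u) * eLpNorm G p volume := by
  have hGm := hG.measurable_mk
  rw [eLpNorm_congr_ae hG.ae_eq_mk]
  simp_rw [lintegral_conv_congr hG.ae_eq_mk]
  have : IsFiniteMeasure (volume.withDensity κ) := isFiniteMeasure_withDensity hκi
  have h1 : ∀ t, ∫⁻ s, κ (t - s) * hG.mk G s =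
      ∫⁻ u, hG.mk G (t - u) ∂(volume.withDensity κ) := by
    intro t
    rw [lintegral_withDensity_eq_lintegral_mul _ hκ (by fun_prop),
      ← lintegral_sub_left_eq_self _ t]
    simp
  simp_rw [h1]
  refine (eLpNorm_lintegral_le (g := fun t u => hG.mk G (t - u))
    (hGm.comp (measurable_fst.sub measurable_snd)) hp (B := eLpNorm (hG.mk G) p volume)
    fun u => ?_).trans ?_
  · exact (eLpNorm_comp_measurePreserving hGm.aestronglyMeasurable
      (measurePreserving_sub_right volume u)).le
  · simp

/-- Cauchy–Schwarz, together with κ² ≤ Mκ. -/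
lemma lintegral_conv_le {κ G : ℝ → ℝ≥0∞} (hκ : Measurable κ) {M : ℝ≥0∞} (hM : ∀ u, κ u ≤ M)
    (hG : AEMeasurable G) (t : ℝ) :
    ∫⁻ s, κ (t - s) * G s ≤ (M * ∫⁻ u, κ u) ^ (1 / 2 : ℝ) * eLpNorm G 2 volume := by
  refine (ENNReal.lintegral_mul_le_Lp_mul_Lq volume Real.HolderConjugate.two_two
    (f := fun s => κ (t - s)) (by fun_prop) hG).trans ?_
  have h2 : eLpNorm G 2 volume = (∫⁻ s, G s ^ (2 : ℝ)) ^ (1 / 2 : ℝ) := by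
    rw [eLpNorm_eq_lintegral_rpow_enorm_toReal (by norm_num) (by norm_num)]
    simp
  rw [h2]
  gcongr
  rw [← lintegral_const_mul _ hκ, ← lintegral_sub_left_eq_self (fun u => M * κ u) t]
  refine lintegral_mono fun s => ?_
  rw [ENNReal.rpow_two, sq]
  gcongr
  exact hM _

/-- Young's inequality `L^r * L² ⊆ L^p` for a bounded integrable kernel. -/
lemma eLpNorm_conv_le_two {κ G : ℝ → ℝ≥0∞} (hκ : Measurable κ) {M K : ℝ≥0} (hK : 1 ≤ K)
    (hκM : ∀ u, κ u ≤ M) (hκi : ∫⁻ u, κ u ≤ K) (hG : AEMeasurable G) {p : ℝ≥0∞}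
    (hp : 2 ≤ p) :
    eLpNorm (fun t => ∫⁻ s, κ (t - s) * G s) p volume ≤
      K * (M : ℝ≥0∞) ^ (1 / 2 - (p⁻¹).toReal) * eLpNorm G 2 volume := by
  have hp1 : (p⁻¹).toReal ≤ 1 / 2 := by
    have : p⁻¹ ≤ 2⁻¹ := ENNReal.inv_le_inv.2 hp
    have := ENNReal.toReal_mono (by norm_num) this
    simpa using this
  have hp0 : 0 ≤ (p⁻¹).toReal := ENNReal.toReal_nonneg
  set θ := (p⁻¹).toReal with hθ
  have hfin : ∫⁻ u, κ u ≠ ⊤ := ne_top_of_le_ne_top ENNReal.coe_ne_top hκi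
  set g := eLpNorm G 2 volume with hg
  have h1 : eLpNorm (fun t => ∫⁻ s, κ (t - s) * G s) (∞ : ℝ≥0∞) volume ≤
      ((M : ℝ≥0∞) ^ (1 / 2 : ℝ) * K) * g := by
    rw [eLpNorm_exponent_top]
    refine eLpNormEssSup_le_of_ae_enorm_bound (Filter.Eventually.of_forall fun t => ?_)
    rw [enorm_eq_self]
    refine (lintegral_conv_le hκ hκM hG t).trans ?_
    gcongr
    rw [ENNReal.mul_rpow_of_nonneg _ _ (by norm_num)]
    gcongr
    calc (∫⁻ u, κ u) ^ (1 / 2 : ℝ) ≤ (K : ℝ≥0∞) ^ (1 / 2 : ℝ) := by gcongr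
      _ ≤ (K : ℝ≥0∞) ^ (1 : ℝ) :=
        ENNReal.rpow_le_rpow_of_exponent_le (by exact_mod_cast hK) (by norm_num)
      _ = K := ENNReal.rpow_one _
  have h2 : eLpNorm (fun t => ∫⁻ s, κ (t - s) * G s) 2 volume ≤ K * g :=
    (eLpNorm_conv_le hκ hfin hG (by norm_num)).trans (by gcongr)
  -- Interpolation between the L² and L^∞ bounds: the powers of K g add up to 1, and M^(1/2) enters
  -- only with weight 1 - 2/p.
  calc eLpNorm (fun t => ∫⁻ s, κ (t - s) * G s) p volume
      ≤ _ := eLpNorm_le_top_two (aemeasurable_conv hκ hG).aestronglyMeasurable hp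
    _ ≤ (((M : ℝ≥0∞) ^ (1 / 2 : ℝ) * K) * g) ^ (1 - 2 * θ) * (K * g) ^ (2 * θ) := by
        gcongr
        linarith
    _ = ((M : ℝ≥0∞) ^ (1 / 2 : ℝ)) ^ (1 - 2 * θ) * ((K * g) ^ (1 - 2 * θ) * (K * g) ^ (2 * θ)) := by
        rw [mul_assoc ((M : ℝ≥0∞) ^ (1 / 2 : ℝ)), ENNReal.mul_rpow_of_nonneg _ _ (by linarith)]
        ring
    _ = K * (M : ℝ≥0∞) ^ (1 / 2 - θ) * g := by
        rw [← ENNReal.rpow_add_of_nonneg _ _ (by linarith) (by linarith), ← ENNReal.rpow_mul]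
        rw [show 1 - 2 * θ + 2 * θ = 1 by ring, ENNReal.rpow_one,
          show 1 / 2 * (1 - 2 * θ) = 1 / 2 - θ by ring]
        ring

/-- An approximate identity at time scale `2^(-k)`. -/
def timeKernel (k : ℤ) (u : ℝ) : ℝ≥0∞ :=
  ENNReal.ofReal ((2 : ℝ) ^ k * ((1 + (2 : ℝ) ^ k * |u|) ^ 2)⁻¹)

lemma measurable_timeKernel (k : ℤ) : Measurable (timeKernel k) := by
  unfold timeKernel; fun_prop

lemma timeKernel_le (k : ℤ) (u : ℝ) : timeKernel k u ≤ ((2 : ℝ≥0) ^ k : ℝ≥0) := by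
  rw [← ENNReal.ofReal_coe_nnreal, timeKernel]
  refine ENNReal.ofReal_le_ofReal ?_
  push_cast
  refine mul_le_of_le_one_right (by positivity) (inv_le_one_of_one_le₀ ?_)
  have : (0 : ℝ) ≤ 2 ^ k * |u| := by positivity
  exact one_le_pow₀ (by linarith)

/-- The substitution u ↦ 2^k u makes the integral independent of k. The bound is taken at least 1 as
`eLpNorm_conv_le_two` requires. -/
lemma exists_lintegral_timeKernel_le : ∃ K : ℝ≥0, 1 ≤ K ∧ ∀ k, ∫⁻ u, timeKernel k u ≤ K := by
  set J := ∫⁻ u : ℝ, ENNReal.ofReal ((1 + ‖u‖) ^ (-(2 : ℝ))) with hJ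
  have hfin : J < ⊤ := finite_integral_one_add_norm (by simp)
  refine ⟨max 1 J.toNNReal, le_max_left _ _, fun k => ?_⟩
  have hK : (0 : ℝ) < 2 ^ k := by positivity
  have h1 : ∫⁻ u, timeKernel k u = J := by
    calc ∫⁻ u, timeKernel k u
        = ∫⁻ u, ENNReal.ofReal ((2 : ℝ) ^ k) *
            ENNReal.ofReal ((1 + ‖(2 : ℝ) ^ k * u‖) ^ (-(2 : ℝ))) := by
          refine lintegral_congr fun u => ?_
          rw [timeKernel, ENNReal.ofReal_mul hK.le, norm_mul, Real.norm_of_nonneg hK.le,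
            Real.norm_eq_abs, Real.rpow_neg (by positivity), Real.rpow_two]
      _ = ENNReal.ofReal ((2 : ℝ) ^ k) *
            ∫⁻ u, ENNReal.ofReal ((1 + ‖u‖) ^ (-(2 : ℝ))) ∂(Measure.map ((2 : ℝ) ^ k * ·) volume) := by
          rw [lintegral_const_mul _ (by fun_prop), lintegral_map (by fun_prop) (by fun_prop)]
      _ = J := by
          rw [Real.map_volume_mul_left hK.ne', lintegral_smul_measure, smul_eq_mul, ← mul_assoc,
            ← ENNReal.ofReal_mul hK.le, abs_of_pos (inv_pos.2 hK), mul_inv_cancel₀ hK.ne',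
            ENNReal.ofReal_one, one_mul]
  rw [h1, ← ENNReal.coe_toNNReal hfin.ne]
  exact_mod_cast le_max_right _ _

end Convolution

/-! ### Growth of free waves in L^q. -/

section Propagation

variable {c : ℝ}

/-- Homogeneous waves localised at frequency `2^k` are bounded in `L^q` up to polynomial growth
in time. -/
lemma exists_propagation_bound (hc : 1 ≤ c) : ∃ C : ℝ≥0, ∀ (k : ℤ) (τ : ℝ) (f g : L2),
    FreqLocalized c k f → FreqLocalized c k g → ∀ q : ℝ≥0∞, 1 ≤ q →
      eLpNorm (cosOp c k τ f + sinOp c k τ g : L2) q volume +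
          ENNReal.ofReal ((2 : ℝ) ^ (-k)) *
            eLpNorm (dcosOp c k τ f + cosOp c k τ g : L2) q volume ≤
        C * ENNReal.ofReal ((1 + 2 ^ k * |τ|) ^ 5) *
          (eLpNorm f q volume + ENNReal.ofReal ((2 : ℝ) ^ (-k)) * eLpNorm g q volume) := by
  obtain ⟨C₁, h₁⟩ := exists_bandOp_bound hc (b := fun _ => 1) (by fun_prop)
  obtain ⟨C₂, h₂⟩ := exists_bandOp_bound hc (b := fun r => r⁻¹)
    (contDiffOn_inv ℝ |>.mono fun x hx => ne_of_gt hx)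
  obtain ⟨C₃, h₃⟩ := exists_bandOp_bound hc (b := fun r => -r) (by fun_prop)
  refine ⟨C₁ + C₂ + C₃, fun k τ f g hf hg q hq => ?_⟩
  have hK : (0 : ℝ) < 2 ^ k := by positivity
  set P := ENNReal.ofReal ((1 + 2 ^ k * |τ|) ^ 5) with hP
  have habs : |2 ^ k * τ| = 2 ^ k * |τ| := by rw [abs_mul, abs_of_pos hK]
  have hcos : ∀ u : L2, FreqLocalized c k u →
      eLpNorm (cosOp c k τ u) q volume ≤ C₁ * P * eLpNorm u q volume := by
    intro u hu
    have := h₁ Real.cos isWave_cos (2 ^ k * τ) 1 k _ (isSymbol_cos τ) one_pos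
      (fun r _ => by rw [one_mul, one_mul]; congr 1; field_simp) u hu q hq
    rwa [habs, ENNReal.ofReal_one, one_mul] at this
  have hsin : eLpNorm (sinOp c k τ g) q volume ≤
      ENNReal.ofReal ((2 : ℝ) ^ (-k)) * (C₂ * P * eLpNorm g q volume) := by
    have := h₂ Real.sin isWave_sin (2 ^ k * τ) (2 ^ (-k)) k _ (isSymbol_sin τ) (by positivity)
      (fun r hr => by
        have e : 2 ^ k * τ * (r / 2 ^ k) = τ * r := by field_simp
        rw [e, zpow_neg]; field_simp) g hg q hq
    rwa [habs] at this
  have hdcos : eLpNorm (dcosOp c k τ f) q volume ≤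
      ENNReal.ofReal ((2 : ℝ) ^ k) * (C₃ * P * eLpNorm f q volume) := by
    have := h₃ Real.sin isWave_sin (2 ^ k * τ) (2 ^ k) k _ (isSymbol_dcos τ) (by positivity)
      (fun r hr => by
        have e : 2 ^ k * τ * (r / 2 ^ k) = τ * r := by field_simp
        rw [e]; field_simp) f hf q hq
    rwa [habs] at this
  have hadd : ∀ u v : L2, eLpNorm (u + v : L2) q volume ≤
      eLpNorm u q volume + eLpNorm v q volume := fun u v => by
    rw [eLpNorm_congr_ae (Lp.coeFn_add u v)]
    exact eLpNorm_add_le (Lp.aestronglyMeasurable _) (Lp.aestronglyMeasurable _) hq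
  -- The factor 2^k lost to a time derivative is cancelled by the weight 2^(-k) of the velocity.
  have hl : ENNReal.ofReal ((2 : ℝ) ^ (-k)) * ENNReal.ofReal ((2 : ℝ) ^ k) = 1 := by
    rw [← ENNReal.ofReal_mul (by positivity), zpow_neg, inv_mul_cancel₀ hK.ne',
      ENNReal.ofReal_one]
  set l := ENNReal.ofReal ((2 : ℝ) ^ (-k)) with hldef
  set L := ENNReal.ofReal ((2 : ℝ) ^ k) with hLdef
  set A := eLpNorm f q volume with hA
  set B := eLpNorm g q volume with hB
  calc eLpNorm (cosOp c k τ f + sinOp c k τ g : L2) q volume +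
          l * eLpNorm (dcosOp c k τ f + cosOp c k τ g : L2) q volume
      ≤ (C₁ * P * A + l * (C₂ * P * B)) + l * (L * (C₃ * P * A) + C₁ * P * B) := by
        gcongr
        · exact (hadd _ _).trans (add_le_add (hcos f hf) hsin)
        · exact (hadd _ _).trans (add_le_add hdcos (hcos g hg))
    _ = (C₁ + l * L * C₃) * P * A + (C₁ + C₂) * P * (l * B) := by ring
    _ ≤ (C₁ + C₂ + C₃) * P * A + (C₁ + C₂ + C₃) * P * (l * B) := by
        have e₁ : (C₁ : ℝ≥0∞) + C₃ ≤ C₁ + C₂ + C₃ := by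
          rw [add_right_comm]; exact le_self_add
        have e₂ : (C₁ : ℝ≥0∞) + C₂ ≤ C₁ + C₂ + C₃ := le_self_add
        rw [hl, one_mul]
        exact add_le_add (mul_le_mul_left (mul_le_mul_left e₁ _) _)
          (mul_le_mul_left (mul_le_mul_left e₂ _) _)
    _ = _ := by push_cast; ring

end Propagation

/-! ### The mixed-norm bound for the extension. -/

section Strichartz

variable {c : ℝ}

lemma nontrivial_of_volume {I : Set ℝ} {l : ℝ} (hl : 0 < l) (h : ENNReal.ofReal l ≤ volume I) :
    I.Nontrivial := by
  by_contra hn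
  rw [not_nontrivial_iff] at hn
  rw [hn.measure_zero volume, nonpos_iff_eq_zero, ENNReal.ofReal_eq_zero] at h
  linarith

lemma one_add_le_one_add_infDist {I : Set ℝ} (hI : I.OrdConnected) (hIc : IsClosed I)
    (hne : I.Nonempty) (k : ℤ) (t : ℝ) :
    1 + (2 : ℝ) ^ k * |t - nearest I t| ≤ 1 + (2 : ℝ) ^ k * Metric.infDist t I := by
  have := abs_sub_nearest_le hI hIc hne t
  gcongr

lemma chi_le {I : Set ℝ} (hI : I.OrdConnected) (hIc : IsClosed I) (hne : I.Nonempty) {N n : ℕ}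
    (hN : n ≤ N) (k : ℤ) (t : ℝ) :
    chi N k I t ≤ ((1 + (2 : ℝ) ^ k * |t - nearest I t|) ^ n)⁻¹ := by
  have h0 : 1 ≤ 1 + (2 : ℝ) ^ k * |t - nearest I t| := by
    have : 0 ≤ (2 : ℝ) ^ k * |t - nearest I t| := by positivity
    linarith
  have h := one_add_le_one_add_infDist hI hIc hne k t
  rw [chi]
  gcongr
  exact (pow_le_pow_left₀ (by linarith) h n).trans (pow_le_pow_right₀ (h0.trans h) hN)

lemma chi_nonneg (N : ℕ) (k : ℤ) (I : Set ℝ) (t : ℝ) : 0 ≤ chi N k I t := by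
  have : 0 ≤ (2 : ℝ) ^ k * Metric.infDist t I := mul_nonneg (by positivity) Metric.infDist_nonneg
  exact inv_nonneg.2 (pow_nonneg (by linarith) _)

/-- Of the powers in χ, a absorb the growth of the free wave and b remain as decay. -/
lemma chi_mul_le {I : Set ℝ} (hI : I.OrdConnected) (hIc : IsClosed I) (hne : I.Nonempty) {N : ℕ}
    {a b : ℕ} (hN : a + b ≤ N) (k : ℤ) (t : ℝ) :
    ENNReal.ofReal (chi N k I t) * ENNReal.ofReal ((1 + 2 ^ k * |t - nearest I t|) ^ a) ≤
      ENNReal.ofReal (((1 + 2 ^ k * |t - nearest I t|) ^ b)⁻¹) := by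
  have h0 : 0 < 1 + (2 : ℝ) ^ k * |t - nearest I t| := by positivity
  rw [← ENNReal.ofReal_mul (chi_nonneg _ _ _ _)]
  refine ENNReal.ofReal_le_ofReal ((mul_le_mul_of_nonneg_right (chi_le hI hIc hne hN k t)
    (by positivity)).trans (le_of_eq ?_))
  rw [pow_add]
  field_simp

lemma eLpNorm_real_smul (a : ℝ) (ha : 0 ≤ a) (f : L2) (q : ℝ≥0∞) :
    eLpNorm (a • f : L2) q volume = ENNReal.ofReal a * eLpNorm f q volume := by
  rw [eLpNorm_congr_ae (Lp.coeFn_smul a f), eLpNorm_const_smul, Real.enorm_eq_ofReal ha]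

/-- The extension and its velocity at time `t` are controlled by a time average of `φ` and `□φ`. -/
lemma exists_waveExtension_bound (hc : 1 ≤ c) : ∃ C : ℝ≥0, ∀ N : ℕ, 7 ≤ N →
    ∀ (k : ℤ) (I : Set ℝ), I.OrdConnected → IsClosed I →
    ENNReal.ofReal ((2 : ℝ) ^ (-k)) ≤ volume I →
    ∀ φ F : ℝ → L2, ContDiffOn ℝ 1 φ I → (∀ t ∈ I, FreqLocalized c k (φ t)) → IsBox I φ F →
    ∀ q : ℝ≥0∞, 2 ≤ q → ∀ t : ℝ,
      ENNReal.ofReal (chi N k I t) * (eLpNorm (waveExtension I φ t) q volume +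
          ENNReal.ofReal ((2 : ℝ) ^ (-k)) * eLpNorm (waveVelocity c k I φ t) q volume) ≤
        C * ∫⁻ s in I, timeKernel k (t - s) * (eLpNorm (φ s) q volume +
          ENNReal.ofReal ((2 : ℝ) ^ (-(4 * (q⁻¹).toReal * k))) * ‖F s‖ₑ) := by
  obtain ⟨C₁, h₁⟩ := exists_pointwise_bound hc
  obtain ⟨C₂, h₂⟩ := exists_propagation_bound hc
  refine ⟨C₂ * (4 * C₁), fun N hN k I hI hIc hvol φ F hφ hloc hF q hq t => ?_⟩
  have hne := nontrivial_of_volume (by positivity) hvol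
  have hm := nearest_mem hI hIc hne.nonempty t
  have hu := uniqueDiffOn_of_nontrivial hI hne
  have hK : (0 : ℝ) < 2 ^ k := by positivity
  set π := nearest I t with hπ
  set G : ℝ → ℝ≥0∞ := fun s => eLpNorm (φ s) q volume +
    ENNReal.ofReal ((2 : ℝ) ^ (-(4 * (q⁻¹).toReal * k))) * ‖F s‖ₑ with hG
  set S := I ∩ Metric.closedBall π ((2 : ℝ) ^ (-k)) with hS
  have hSm : MeasurableSet S := hIc.measurableSet.inter Metric.isClosed_closedBall.measurableSet
  have e₁ := h₁ k I hI hIc hvol φ F hφ hloc hF q hq π hm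
  have e₂ := h₂ k (t - π) (φ π) (derivWithin φ I π) (hloc π hm)
    (freqLocalized_derivWithin hc hu hφ hloc hm) q (le_trans (by norm_num) hq)
  rw [waveExtension_eq hc hI hIc hne hφ hloc t, waveVelocity]
  -- Moving from π to a point s within 2^(-k) at most doubles 1 + 2^k|t - ·|, hence the factor 4
  -- after squaring.
  have hker : ∀ s ∈ S, ENNReal.ofReal (((1 + 2 ^ k * |t - π|) ^ 2)⁻¹) *
      ENNReal.ofReal ((2 : ℝ) ^ k) ≤ 4 * timeKernel k (t - s) := by
    intro s hs
    have hd : |s - π| ≤ (2 ^ k)⁻¹ := by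
      have := hs.2
      rwa [Metric.mem_closedBall, Real.dist_eq, zpow_neg] at this
    have h1 : |t - s| ≤ |t - π| + (2 ^ k)⁻¹ := by
      have := abs_sub_le t π s
      rw [abs_sub_comm π s] at this
      linarith
    have h2 : 1 + 2 ^ k * |t - s| ≤ 2 * (1 + 2 ^ k * |t - π|) := by
      have h3 := mul_le_mul_of_nonneg_left h1 hK.le
      rw [mul_add, mul_inv_cancel₀ hK.ne'] at h3
      have h4 : 0 ≤ (2 : ℝ) ^ k * |t - π| := by positivity
      linarith
    rw [timeKernel, ← ENNReal.ofReal_mul (by positivity),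
      show (4 : ℝ≥0∞) = ENNReal.ofReal 4 by simp, ← ENNReal.ofReal_mul (by norm_num)]
    refine ENNReal.ofReal_le_ofReal ?_
    have h5 : (1 + 2 ^ k * |t - s|) ^ 2 ≤ 4 * (1 + 2 ^ k * |t - π|) ^ 2 :=
      (pow_le_pow_left₀ (by positivity) h2 2).trans (by rw [mul_pow]; norm_num)
    have h6 : ((1 + 2 ^ k * |t - π|) ^ 2)⁻¹ ≤ 4 * ((1 + 2 ^ k * |t - s|) ^ 2)⁻¹ := by
      rw [← div_eq_mul_inv, le_div_iff₀ (by positivity), inv_mul_le_iff₀ (by positivity)]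
      linarith
    calc _ ≤ 4 * ((1 + 2 ^ k * |t - s|) ^ 2)⁻¹ * 2 ^ k := by gcongr
      _ = _ := by ring
  calc ENNReal.ofReal (chi N k I t) * _
      ≤ ENNReal.ofReal (chi N k I t) * (C₂ * ENNReal.ofReal ((1 + 2 ^ k * |t - π|) ^ 5) *
          (C₁ * ENNReal.ofReal ((2 : ℝ) ^ k) * ∫⁻ s in S, G s)) := by
        gcongr
        exact e₂.trans (by gcongr)
    _ = C₂ * C₁ * (ENNReal.ofReal (chi N k I t) *
          ENNReal.ofReal ((1 + 2 ^ k * |t - π|) ^ 5)) *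
            (ENNReal.ofReal ((2 : ℝ) ^ k) * ∫⁻ s in S, G s) := by ring
    _ ≤ C₂ * C₁ * ENNReal.ofReal (((1 + 2 ^ k * |t - π|) ^ 2)⁻¹) *
            (ENNReal.ofReal ((2 : ℝ) ^ k) * ∫⁻ s in S, G s) := by
        gcongr
        exact chi_mul_le hI hIc hne.nonempty (by omega) k t
    _ = C₂ * C₁ * ((ENNReal.ofReal (((1 + 2 ^ k * |t - π|) ^ 2)⁻¹) *
            ENNReal.ofReal ((2 : ℝ) ^ k)) * ∫⁻ s in S, G s) := by ring
    _ = C₂ * C₁ * ∫⁻ s in S, (ENNReal.ofReal (((1 + 2 ^ k * |t - π|) ^ 2)⁻¹) *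
            ENNReal.ofReal ((2 : ℝ) ^ k)) * G s := by
        rw [lintegral_const_mul' _ _ (ENNReal.mul_ne_top ENNReal.ofReal_ne_top
          ENNReal.ofReal_ne_top)]
    _ ≤ C₂ * C₁ * ∫⁻ s in S, 4 * (timeKernel k (t - s) * G s) := by
        gcongr 1
        refine setLIntegral_mono' hSm fun s hs => ?_
        rw [← mul_assoc]
        exact mul_le_mul_left (hker s hs) _
    _ = C₂ * (4 * C₁) * ∫⁻ s in S, timeKernel k (t - s) * G s := by
        rw [lintegral_const_mul' _ _ (by norm_num)]
        ring
    _ ≤ C₂ * (4 * C₁) * ∫⁻ s in I, timeKernel k (t - s) * G s := by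
        gcongr
        exact inter_subset_left
    _ = _ := by push_cast; rfl

/-- On I the L^q norm is the norm of a continuous L^q-valued curve, by `exists_projLp`. -/
lemma aemeasurable_eLpNorm (hc : 1 ≤ c) {k : ℤ} {I : Set ℝ} (hIc : IsClosed I) {φ : ℝ → L2}
    (hφ : ContinuousOn φ I) (hloc : ∀ t ∈ I, FreqLocalized c k (φ t)) {q : ℝ≥0∞} (hq : 2 ≤ q) :
    AEMeasurable (fun t => eLpNorm (φ t) q volume) (volume.restrict I) := by
  have : Fact (1 ≤ q) := ⟨le_trans (by norm_num) hq⟩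
  obtain ⟨_, hC⟩ := exists_projLp hc
  obtain ⟨T, hT, -⟩ := hC k q hq
  have h1 : ContinuousOn (fun t => ‖T (φ t)‖ₑ) I :=
    continuous_enorm.comp_continuousOn (T.continuous.comp_continuousOn hφ)
  refine (h1.aemeasurable hIc.measurableSet).congr ?_
  filter_upwards [ae_restrict_mem hIc.measurableSet] with t ht using hT _ (hloc t ht)

/-- Splits the power of 2 in the theorem into the Young factor, from the kernel bound 2^k, and the
Bernstein weight. -/
lemma two_rpow_eq (k : ℤ) (x y : ℝ) :
    (2 : ℝ≥0∞) ^ ((1 / 2 - x - 4 * y) * (k : ℝ)) =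
      (((2 : ℝ≥0) ^ k : ℝ≥0) : ℝ≥0∞) ^ (1 / 2 - x) * ENNReal.ofReal ((2 : ℝ) ^ (-(4 * y * k))) := by
  rw [← ENNReal.ofReal_coe_nnreal, ENNReal.ofReal_rpow_of_pos (by positivity),
    ← ENNReal.ofReal_mul (by positivity)]
  push_cast
  rw [← Real.rpow_intCast, ← Real.rpow_mul (by norm_num), ← Real.rpow_add (by norm_num),
    ← ENNReal.ofReal_rpow_of_pos (by norm_num), ENNReal.ofReal_ofNat]
  congr 1
  ring

/-- The time-average bound followed by Young twice: L¹ * L^p for φ, and from L² to L^p for F. The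
factor 2 in the constant counts the two norms on the left. -/
lemma exists_strichartz_extension_bound (hc : 1 ≤ c) : ∃ C : ℝ≥0, ∀ N : ℕ, 7 ≤ N →
    ∀ (k : ℤ) (I : Set ℝ), I.OrdConnected → IsClosed I →
    ENNReal.ofReal ((2 : ℝ) ^ (-k)) ≤ volume I →
    ∀ φ F : ℝ → L2, ContDiffOn ℝ 1 φ I → (∀ t ∈ I, FreqLocalized c k (φ t)) → IsBox I φ F →
    ∀ p q : ℝ≥0∞, 2 ≤ p → 2 ≤ q →
      mixedNorm p q univ (fun t => chi N k I t • waveExtension I φ t) +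
          mixedNorm p q univ (fun t => chi N k I t • (2 : ℝ) ^ (-k) • waveVelocity c k I φ t) ≤
        C * (mixedNorm p q I φ +
          (2 : ℝ≥0∞) ^ ((1 / 2 - (p⁻¹).toReal - 4 * (q⁻¹).toReal) * (k : ℝ)) *
            mixedNorm 2 2 I F) := by
  obtain ⟨C, hC⟩ := exists_waveExtension_bound hc
  obtain ⟨K, hK1, hK⟩ := exists_lintegral_timeKernel_le
  refine ⟨2 * C * K, fun N hN k I hI hIc hvol φ F hφ hloc hF p q hp hq => ?_⟩
  have hIm := hIc.measurableSet
  set w := ENNReal.ofReal ((2 : ℝ) ^ (-(4 * (q⁻¹).toReal * k))) with hw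
  set G₁ : ℝ → ℝ≥0∞ := I.indicator fun s => eLpNorm (φ s) q volume with hG₁
  set G₂ : ℝ → ℝ≥0∞ := I.indicator fun s => ‖F s‖ₑ with hG₂
  have hG₁m : AEMeasurable G₁ := (aemeasurable_indicator_iff hIm).2
    (aemeasurable_eLpNorm hc hIc hφ.continuousOn hloc hq)
  have hG₂m : AEMeasurable G₂ := (aemeasurable_indicator_iff hIm).2
    hF.memLp.aestronglyMeasurable.enorm
  set H₁ : ℝ → ℝ≥0∞ := fun t => ∫⁻ s, timeKernel k (t - s) * G₁ s with hH₁
  set H₂ : ℝ → ℝ≥0∞ := fun t => ∫⁻ s, timeKernel k (t - s) * G₂ s with hH₂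
  have hκ := measurable_timeKernel k
  have hH₁m : AEMeasurable H₁ := aemeasurable_conv hκ hG₁m
  have hH₂m : AEMeasurable H₂ := aemeasurable_conv hκ hG₂m
  have hsplit : ∀ t, ∫⁻ s in I, timeKernel k (t - s) * (eLpNorm (φ s) q volume + w * ‖F s‖ₑ) =
      (H₁ + fun t => w * H₂ t) t := by
    intro t
    rw [← lintegral_indicator hIm, Pi.add_apply, hH₁, hH₂]
    simp only
    rw [← lintegral_const_mul' _ _ ENNReal.ofReal_ne_top, ← lintegral_add_left']
    · refine lintegral_congr fun s => ?_
      by_cases hs : s ∈ I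
      · simp only [hG₁, hG₂, indicator_of_mem hs]; ring
      · simp only [hG₁, hG₂, indicator_of_notMem hs]; simp
    · exact (hκ.comp (measurable_const.sub measurable_id)).aemeasurable.mul hG₁m
  have hX : ∀ t, ENNReal.ofReal (chi N k I t) * (eLpNorm (waveExtension I φ t) q volume +
      ENNReal.ofReal ((2 : ℝ) ^ (-k)) * eLpNorm (waveVelocity c k I φ t) q volume) ≤
      C * (H₁ + fun t => w * H₂ t) t := fun t => by
    rw [← hsplit]
    exact hC N hN k I hI hIc hvol φ F hφ hloc hF q hq t
  have hp1 : 1 ≤ p := le_trans (by norm_num) hp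
  have hmain : eLpNorm (H₁ + fun t => w * H₂ t) p volume ≤
      K * (mixedNorm p q I φ +
          (2 : ℝ≥0∞) ^ ((1 / 2 - (p⁻¹).toReal - 4 * (q⁻¹).toReal) * (k : ℝ)) *
            mixedNorm 2 2 I F) := by
    refine (eLpNorm_add_le hH₁m.aestronglyMeasurable
      (hH₂m.const_mul w).aestronglyMeasurable hp1).trans ?_
    rw [mul_add]
    refine add_le_add ?_ ?_
    · refine (eLpNorm_conv_le hκ (ne_top_of_le_ne_top ENNReal.coe_ne_top (hK k)) hG₁m hp1).trans ?_
      rw [hG₁, eLpNorm_indicator_eq_eLpNorm_restrict hIm]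
      exact mul_le_mul_left (hK k) _
    · have h1 : eLpNorm (fun t => w * H₂ t) p volume ≤ w * eLpNorm H₂ p volume :=
        eLpNorm_le_mul_eLpNorm_of_ae_le_mul'' p hH₂m.aestronglyMeasurable
          (Filter.Eventually.of_forall fun t => le_rfl)
      have h2 := eLpNorm_conv_le_two hκ hK1 (timeKernel_le k) (hK k) hG₂m hp
      have h3 : eLpNorm G₂ 2 volume = mixedNorm 2 2 I F := by
        rw [hG₂, eLpNorm_indicator_eq_eLpNorm_restrict hIm, mixedNorm]
        simp_rw [Lp.enorm_def]
      rw [h3] at h2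
      rw [two_rpow_eq]
      calc eLpNorm (fun t => w * H₂ t) p volume ≤ _ := h1.trans (mul_le_mul_right h2 w)
        _ = _ := by ring
  have hle : ∀ u : ℝ → L2, (∀ t, eLpNorm (u t) q volume ≤
      C * (H₁ + fun t => w * H₂ t) t) →
      mixedNorm p q univ u ≤ C * eLpNorm (H₁ + fun t => w * H₂ t) p volume := by
    intro u hu
    rw [mixedNorm, Measure.restrict_univ]
    exact eLpNorm_le_mul_eLpNorm_of_ae_le_mul' (Filter.Eventually.of_forall fun t => hu t) p
  calc _ ≤ C * eLpNorm (H₁ + fun t => w * H₂ t) p volume +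
        C * eLpNorm (H₁ + fun t => w * H₂ t) p volume := by
        refine add_le_add (hle _ fun t => ?_) (hle _ fun t => ?_)
        · rw [eLpNorm_real_smul _ (chi_nonneg _ _ _ _)]
          refine le_trans ?_ (hX t)
          rw [mul_add]
          exact le_self_add
        · rw [eLpNorm_real_smul _ (chi_nonneg _ _ _ _), eLpNorm_real_smul _ (by positivity)]
          refine le_trans ?_ (hX t)
          rw [mul_add]
          exact le_add_self
    _ = 2 * C * eLpNorm (H₁ + fun t => w * H₂ t) p volume := by ring
    _ ≤ 2 * C * (K * _) := by gcongr
    _ = _ := by push_cast; ring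

end Strichartz

/-! ### The energy dispersion bound for the extension. -/

section EnergyDispersion

variable {c : ℝ} {k : ℤ} {I : Set ℝ}

/-- Every neighbourhood of a point of I, endpoints included, meets the interior of I in a nonempty
open set, which has positive measure. A continuous function cannot exceed its essential supremum
there. -/
lemma le_essSup_of_continuousOn (hI : I.OrdConnected) (hne : I.Nontrivial) {N : ℝ → ℝ≥0∞}
    (hN : ContinuousOn N I) {s : ℝ} (hs : s ∈ I) : N s ≤ essSup N (volume.restrict I) := by
  by_contra! h
  obtain ⟨O, hO, hOI⟩ := continuousOn_iff'.1 hN _ (isOpen_Ioi (a := essSup N (volume.restrict I)))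
  have hsO : s ∈ O := (hOI.subset ⟨h, hs⟩).1
  have hint : (interior I).Nonempty := by
    obtain ⟨a, ha, b, hb, hab⟩ := hne.exists_lt
    exact ⟨(a + b) / 2, mem_interior.2 ⟨Ioo a b,
      fun x hx => hI.out ha hb (Ioo_subset_Icc_self hx), isOpen_Ioo, ⟨by linarith, by linarith⟩⟩⟩
  have hcl : s ∈ closure (interior I) := by
    rw [Convex.closure_interior_eq_closure_of_nonempty_interior (𝕜 := ℝ) hI.convex hint]
    exact subset_closure hs
  have hpos : 0 < volume (O ∩ interior I) :=
    (hO.inter isOpen_interior).measure_pos volume (mem_closure_iff.1 hcl O hO hsO)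
  have hae := ae_restrict_of_ae_restrict_of_subset
    (inter_subset_right.trans interior_subset : O ∩ interior I ⊆ I)
    (ENNReal.ae_le_essSup (μ := volume.restrict I) N)
  rw [ae_restrict_iff' (hO.inter isOpen_interior).measurableSet] at hae
  refine hpos.ne' (measure_mono_null (fun x hx => ?_) hae)
  rw [mem_compl_iff, mem_ofPred_eq, Classical.not_imp, not_le]
  exact ⟨hx, (hOI.superset ⟨hx.1, interior_subset hx.2⟩).1⟩

/-- The sup norm is continuous in time thanks to the operator of `exists_projLp`, so the essential
supremum in time controls even the endpoint values from which the extension starts. -/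
lemma eLpNorm_top_le_mixedNorm (hc : 1 ≤ c) (hI : I.OrdConnected) (hne : I.Nontrivial)
    {u : ℝ → L2} (hu : ContinuousOn u I) (hloc : ∀ t ∈ I, FreqLocalized c k (u t)) {s : ℝ}
    (hs : s ∈ I) : eLpNorm (u s) (∞ : ℝ≥0∞) volume ≤ mixedNorm ∞ ∞ I u := by
  have : Fact (1 ≤ (∞ : ℝ≥0∞)) := ⟨le_top⟩
  obtain ⟨_, hC⟩ := exists_projLp hc
  obtain ⟨T, hT, -⟩ := hC k ∞ le_top
  have h1 : ContinuousOn (fun t => eLpNorm (u t) (∞ : ℝ≥0∞) volume) I :=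
    (continuous_enorm.comp_continuousOn (T.continuous.comp_continuousOn hu)).congr
      fun t ht => (hT _ (hloc t ht)).symm
  have h2 := le_essSup_of_continuousOn hI hne h1 hs
  rw [mixedNorm, eLpNorm_exponent_top]
  exact h2

lemma IsCutoff.isSymbol {m : ℝ → ℝ} (hm : IsCutoff m) (j : ℤ) : IsSymbol (dyadicSymbol m j) := by
  have := hm.smooth.continuous
  exact isSymbol_of_continuous ((this.comp (continuous_id.div_const _)).sub
    (this.comp (continuous_id.div_const _)))

/-- The two cutoffs are both 1 for r ≤ 2^(j-1) and both 0 for r ≥ 2^(j+1), so they cancel there. -/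
lemma IsCutoff.lt_of_dyadicSymbol_ne_zero {m : ℝ → ℝ} (hm : IsCutoff m) {j : ℤ} {r : ℝ}
    (h : dyadicSymbol m j r ≠ 0) : 2 ^ j < 2 * r ∧ r < 2 * 2 ^ j := by
  have hj : (0 : ℝ) < 2 ^ j := by positivity
  have hj' : (2 : ℝ) ^ (j - 1) = 2 ^ j / 2 := by rw [zpow_sub_one₀ two_ne_zero, div_eq_mul_inv]
  constructor
  · by_contra! hr
    refine h ?_
    rw [dyadicSymbol, hm.eq_one, hm.eq_one, sub_self]
    · rw [hj', div_le_one (by positivity)]; linarith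
    · rw [div_le_one hj]; linarith
  · by_contra! hr
    refine h ?_
    rw [dyadicSymbol, hm.eq_zero, hm.eq_zero, sub_self]
    · rw [hj', le_div_iff₀ (by positivity)]; linarith
    · rw [le_div_iff₀ hj]; linarith

lemma bandOp_comm (hc : 1 ≤ c) {σ τ : ℝ → ℝ} (hσ : IsSymbol σ) (hτ : IsSymbol τ) (f : L2) :
    bandOp c k σ (bandOp c k τ f) = bandOp c k τ (bandOp c k σ f) := by
  rw [bandOp_bandOp hc hσ hτ, bandOp_bandOp hc hτ hσ]
  simp_rw [mul_comm]

lemma freqLocalized_bandOp_add (hc : 1 ≤ c) {σ τ : ℝ → ℝ} (hσ : IsSymbol σ) (hτ : IsSymbol τ)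
    (f g : L2) : FreqLocalized c k (bandOp c k σ f + bandOp c k τ g) := by
  rw [freqLocalized_iff_proj hc, map_add, proj_bandOp hc hσ, proj_bandOp hc hτ]

/-- P_j commutes with the propagators, so P_j of the extension is a free wave with data P_jφ and
P_j∂ₜφ at the nearest point. The propagation bound with q = ∞ carries the weight 2^(-k) instead of
2^(-j); exchanging them before and after costs (2c)². -/
lemma exists_energyDispersion_bound {m : ℝ → ℝ} (hm : IsCutoff m) (hc : 1 ≤ c) :
    ∃ C : ℝ≥0, ∀ N : ℕ, 5 ≤ N → ∀ (k : ℤ) (I : Set ℝ), I.OrdConnected → IsClosed I →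
      I.Nontrivial → ∀ φ : ℝ → L2, ContDiffOn ℝ 1 φ I → (∀ t ∈ I, FreqLocalized c k (φ t)) →
      ∀ t : ℝ, ENNReal.ofReal (chi N k I t) *
          edAt m (waveExtension I φ t) (waveVelocity c k I φ t) ≤ C * edOn m I φ := by
  obtain ⟨C, hC⟩ := exists_propagation_bound hc
  refine ⟨C * (2 * c.toNNReal) ^ 2, fun N hN k I hI hIc hne φ hφ hloc t => ?_⟩
  have hu := uniqueDiffOn_of_nontrivial hI hne
  have hm' := nearest_mem hI hIc hne.nonempty t
  have hloc' := fun s hs => freqLocalized_derivWithin hc hu hφ hloc (t := s) hs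
  rw [waveExtension_eq hc hI hIc hne hφ hloc t, waveVelocity]
  set π := nearest I t with hπ
  set τ := t - π with hτ
  rw [edAt, ENNReal.mul_iSup]
  refine iSup_le fun j => ?_
  have hS := hm.isSymbol j
  set B := bandOp c k (dyadicSymbol m j) with hB
  have hLP : ∀ f : L2, FreqLocalized c k f → LP m j f = B f := fun f hf =>
    radialMultiplier_eq_bandOp hc hS hf
  have hw : FreqLocalized c k (cosOp c k τ (φ π) + sinOp c k τ (derivWithin φ I π)) :=
    freqLocalized_bandOp_add hc (isSymbol_cos τ) (isSymbol_sin τ) _ _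
  have hv : FreqLocalized c k (dcosOp c k τ (φ π) + cosOp c k τ (derivWithin φ I π)) :=
    freqLocalized_bandOp_add hc (isSymbol_dcos τ) (isSymbol_cos τ) _ _
  rw [hLP _ hw, hLP _ hv]
  -- If the symbol of P_j vanishes on the band there is nothing to prove; otherwise a frequency
  -- common to both makes 2^j and 2^k comparable up to the factor 2c.
  by_cases hband : ∀ r ∈ band c k, dyadicSymbol m j r = 0
  · rw [hB, bandOp_eq_zero hc hS hband]
    have h0 : eLpNorm ((0 : L2) : Space → ℂ) (∞ : ℝ≥0∞) volume = 0 := by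
      rw [eLpNorm_congr_ae (Lp.coeFn_zero ℂ 2 volume), eLpNorm_zero]
    rw [zero_apply, zero_apply, smul_zero, h0, add_zero, mul_zero, mul_zero]
    exact zero_le
  push Not at hband
  obtain ⟨r, hr, hr0⟩ := hband
  obtain ⟨hr1, hr2⟩ := hm.lt_of_dyadicSymbol_ne_zero hr0
  have hk : (0 : ℝ) < 2 ^ k := by positivity
  have hj : (0 : ℝ) < 2 ^ j := by positivity
  have hr3 : r ≤ c * 2 ^ k := hr.2
  have hr4 : 2 ^ k ≤ c * r := (inv_mul_le_iff₀ (by positivity)).1 hr.1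
  set a : ℝ≥0∞ := 2 * c.toNNReal with ha
  have ha' : a = ENNReal.ofReal (2 * c) := by
    rw [ha, ENNReal.ofReal_mul (by norm_num), ENNReal.ofReal_ofNat]; rfl
  have ha1 : 1 ≤ a := by
    rw [ha', ← ENNReal.ofReal_one]; exact ENNReal.ofReal_le_ofReal (by linarith)
  set lj := ENNReal.ofReal ((2 : ℝ) ^ (-j)) with hlj
  set lk := ENNReal.ofReal ((2 : ℝ) ^ (-k)) with hlk
  have hjk : lj ≤ a * lk := by
    rw [ha', ← ENNReal.ofReal_mul (by positivity)]
    refine ENNReal.ofReal_le_ofReal ?_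
    rw [zpow_neg, zpow_neg, ← div_eq_mul_inv, le_div_iff₀ hk, inv_mul_le_iff₀ hj]
    have := mul_le_mul_of_nonneg_left hr2.le (zero_le_one.trans hc)
    linarith
  have hkj : lk ≤ a * lj := by
    rw [ha', ← ENNReal.ofReal_mul (by positivity)]
    refine ENNReal.ofReal_le_ofReal ?_
    rw [zpow_neg, zpow_neg, ← div_eq_mul_inv, le_div_iff₀ hj, inv_mul_le_iff₀ hk]
    linarith
  have hcomm : ∀ {σ ρ : ℝ → ℝ}, IsSymbol σ → IsSymbol ρ → ∀ f g : L2,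
      B (bandOp c k σ f + bandOp c k ρ g) = bandOp c k σ (B f) + bandOp c k ρ (B g) := by
    intro σ ρ hσ hρ f g
    rw [map_add, hB, bandOp_comm hc hS hσ, bandOp_comm hc hS hρ]
  have e₁ : B (cosOp c k τ (φ π) + sinOp c k τ (derivWithin φ I π)) =
      cosOp c k τ (B (φ π)) + sinOp c k τ (B (derivWithin φ I π)) :=
    hcomm (isSymbol_cos τ) (isSymbol_sin τ) _ _
  have e₂ : B (dcosOp c k τ (φ π) + cosOp c k τ (derivWithin φ I π)) =
      dcosOp c k τ (B (φ π)) + cosOp c k τ (B (derivWithin φ I π)) :=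
    hcomm (isSymbol_dcos τ) (isSymbol_cos τ) _ _
  have hprop := hC k τ (B (φ π)) (B (derivWithin φ I π)) (freqLocalized_bandOp hc hS _)
    (freqLocalized_bandOp hc hS _) (∞ : ℝ≥0∞) le_top
  rw [← e₁, ← e₂] at hprop
  rw [eLpNorm_real_smul _ (by positivity)]
  set W := eLpNorm (B (cosOp c k τ (φ π) + sinOp c k τ (derivWithin φ I π)) : L2) (∞ : ℝ≥0∞) volume
  set V := eLpNorm (B (dcosOp c k τ (φ π) + cosOp c k τ (derivWithin φ I π)) : L2)
    (∞ : ℝ≥0∞) volume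
  set P := ENNReal.ofReal ((1 + 2 ^ k * |τ|) ^ 5) with hP
  have hchi : ENNReal.ofReal (chi N k I t) * P ≤ 1 := by
    have := chi_mul_le (a := 5) (b := 0) hI hIc hne.nonempty (by omega : 5 + 0 ≤ N) k t
    rwa [pow_zero, inv_one, ENNReal.ofReal_one] at this
  have hU : eLpNorm (B (φ π)) (∞ : ℝ≥0∞) volume ≤
      mixedNorm ∞ ∞ I (fun s => LP m j (φ s)) := by
    rw [← hLP _ (hloc _ hm')]
    refine eLpNorm_top_le_mixedNorm (u := fun s => LP m j (φ s)) hc hI hne ?_ ?_ hm' (k := k)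
    · exact (B.continuous.comp_continuousOn hφ.continuousOn).congr fun s hs => hLP _ (hloc s hs)
    · intro s hs
      rw [hLP _ (hloc s hs)]
      exact freqLocalized_bandOp hc hS _
  have hU' : lj * eLpNorm (B (derivWithin φ I π)) (∞ : ℝ≥0∞) volume ≤
      mixedNorm ∞ ∞ I (fun s => (2 : ℝ) ^ (-j) • LP m j (derivWithin φ I s)) := by
    rw [← hLP _ (hloc' _ hm'), hlj, ← eLpNorm_real_smul _ (by positivity)]
    have hcont := (B.continuous.comp_continuousOn
      (hφ.continuousOn_derivWithin hu le_rfl)).const_smul ((2 : ℝ) ^ (-j))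
    refine eLpNorm_top_le_mixedNorm (u := fun s => (2 : ℝ) ^ (-j) • LP m j (derivWithin φ I s))
      hc hI hne ?_ ?_ hm' (k := k)
    · exact hcont.congr fun s hs => by rw [hLP _ (hloc' s hs)]; rfl
    · intro s hs
      rw [hLP _ (hloc' s hs), freqLocalized_iff_proj hc]
      have : (2 : ℝ) ^ (-j) • B (derivWithin φ I s) =
          (((2 : ℝ) ^ (-j) : ℝ) : ℂ) • B (derivWithin φ I s) := rfl
      rw [this, map_smul, hB, proj_bandOp hc hS]
  set U := mixedNorm ∞ ∞ I (fun s => LP m j (φ s))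
  set U' := mixedNorm ∞ ∞ I (fun s => (2 : ℝ) ^ (-j) • LP m j (derivWithin φ I s))
  calc ENNReal.ofReal (chi N k I t) * ((2 : ℝ≥0∞) ^ (-j) * (W + lj * V))
      ≤ ENNReal.ofReal (chi N k I t) * ((2 : ℝ≥0∞) ^ (-j) * (a * (W + lk * V))) := by
        gcongr
        rw [mul_add, ← mul_assoc]
        gcongr
        exact le_mul_of_one_le_left' ha1
    _ ≤ ENNReal.ofReal (chi N k I t) * ((2 : ℝ≥0∞) ^ (-j) * (a * (C * P *
          (eLpNorm (B (φ π)) (∞ : ℝ≥0∞) volume +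
            lk * eLpNorm (B (derivWithin φ I π)) (∞ : ℝ≥0∞) volume)))) := by gcongr
    _ ≤ ENNReal.ofReal (chi N k I t) * ((2 : ℝ≥0∞) ^ (-j) * (a * (C * P * (a * (U + U'))))) := by
        gcongr
        rw [mul_add]
        refine add_le_add (hU.trans (le_mul_of_one_le_left' ha1)) ?_
        calc _ ≤ a * lj * eLpNorm (B (derivWithin φ I π)) (∞ : ℝ≥0∞) volume := by gcongr
          _ ≤ _ := by rw [mul_assoc]; gcongr
    _ = C * a ^ 2 * ((ENNReal.ofReal (chi N k I t) * P) * ((2 : ℝ≥0∞) ^ (-j) * (U + U'))) := by ring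
    _ ≤ C * a ^ 2 * (1 * edOn m I φ) := by
        gcongr
        exact le_iSup (fun j : ℤ => (2 : ℝ≥0∞) ^ (-j) *
          (mixedNorm ∞ ∞ I (fun t => LP m j (φ t)) +
            mixedNorm ∞ ∞ I (fun t => (2 : ℝ) ^ (-j) • LP m j (derivWithin φ I t)))) j
    _ = _ := by rw [one_mul, ha]; push_cast; rfl

end EnergyDispersion

end WaveExt

end

theorem proposition3p3 (m : ℝ → ℝ) (hm : WaveExt.IsCutoff m) :
    ∃ N₀ : ℕ, ∀ c : ℝ, 1 ≤ c → ∃ C : ℝ≥0, ∀ N : ℕ, N₀ ≤ N →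
      ∀ (k : ℤ) (I : Set ℝ), I.OrdConnected → IsClosed I →
        ENNReal.ofReal ((2 : ℝ) ^ (-k)) ≤ volume I →
      ∀ φ : ℝ → WaveExt.L2, ContDiffOn ℝ 1 φ I →
        (∀ t ∈ I, WaveExt.FreqLocalized c k (φ t)) →
        ContDiff ℝ 1 (WaveExt.waveExtension I φ) ∧
        (∀ (p q : ℝ≥0∞), WaveExt.Admissible p q → ∀ F : ℝ → WaveExt.L2, WaveExt.IsBox I φ F →
          WaveExt.mixedNorm p q univ
              (fun t => WaveExt.chi N k I t • WaveExt.waveExtension I φ t) +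
            WaveExt.mixedNorm p q univ
              (fun t => WaveExt.chi N k I t •
                (2 : ℝ) ^ (-k) • deriv (WaveExt.waveExtension I φ) t) ≤
          C * (WaveExt.mixedNorm p q I φ +
            (2 : ℝ≥0∞) ^ ((1 / 2 - (p⁻¹).toReal - 4 * (q⁻¹).toReal) * (k : ℝ)) *
              WaveExt.mixedNorm 2 2 I F)) ∧
        (∀ t : ℝ,
          ENNReal.ofReal (WaveExt.chi N k I t) *
              WaveExt.edAt m (WaveExt.waveExtension I φ t)
                (deriv (WaveExt.waveExtension I φ) t) ≤
            C * WaveExt.edOn m I φ) := by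
  -- 7 = 5 + 2: five powers of χ absorb the growth of the free wave and two leave an integrable time
  -- kernel. Energy dispersion needs only the five.
  refine ⟨7, fun c hc => ?_⟩
  obtain ⟨C₁, h₁⟩ := WaveExt.exists_strichartz_extension_bound hc
  obtain ⟨C₂, h₂⟩ := WaveExt.exists_energyDispersion_bound hm hc
  refine ⟨max C₁ C₂, fun N hN k I hI hIc hvol φ hφ hloc => ?_⟩
  have hne := WaveExt.nontrivial_of_volume (by positivity) hvol
  have hd := WaveExt.hasDerivAt_waveExtension hc hI hIc hne hφ hloc
  have hderiv : deriv (WaveExt.waveExtension I φ) = WaveExt.waveVelocity c k I φ :=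
    funext fun t => (hd t).deriv
  rw [hderiv]
  refine ⟨contDiff_one_iff_deriv.2 ⟨fun t => (hd t).differentiableAt, ?_⟩, ?_, fun t => ?_⟩
  · rw [hderiv]
    exact WaveExt.continuous_waveVelocity hc hI hIc hne hφ
  · intro p q hpq F hF
    refine (h₁ N hN k I hI hIc hvol φ F hφ hloc hF p q hpq.1 hpq.2.1).trans ?_
    gcongr
    exact le_max_left _ _
  · refine (h₂ N (by omega) k I hI hIc hne φ hφ hloc t).trans ?_
    gcongr
    exact le_max_right _ _
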